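/- **The model.** Let $H\in(0,1)$, $\lambda>0$, $\sigma\ne 0$, and write $\theta=(H,\lambda,\sigma)$. A stationary fractional Ornstein–Uhlenbeck (fOU) process with parameter $\theta$ is a process $(X_t)_{t\in\mathbb R}$ such that, for every $t\in\mathbb R$, almost surely $$X_t=\sigma\int_{-\infty}^t e^{-\lambda(t-u)}\,dB^H_u$$ (pathwise improper Riemann–Stieltjes integral), where $B^H$ is a two-sided fractional Brownian motion with Hurst parameter $H$. Let $$\rho_\theta(t)=2\sigma^2c_H\int_0^\infty\cos(tx)\frac{x^{1-2H}}{\lambda^2+x^2}\,dx,\qquad c_H=\frac{\Gamma(2H+1)\sin(\pi H)}{2\pi}.$$ **The estimator.** Let $L\ge 3$ and $\alpha>0$. A filter of length $L+1$ and order $l\ge1$ is a vector $\mathbf a=(a_0,\dots,a_L)\in\mathbb R^{L+1}$ with $\sum_{q}a_qq^r=0$ for $0\le r\le l-1$ and $\sum_q a_qq^l\neq0$. Put $b_0=\sum_{q=0}^L a_q^2$ and $b_k=2\sum_{j=0}^{L-k}a_{k+j}a_j$ for $1\le k\le L$. Given $L$ filters $\mathbf a_1,\dots,\mathbf a_L$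 of orders $l_1,\dots,l_L\ge1$, let $B$ be the $L\times(L+1)$ matrix whose rows are the corresponding vectors $\mathbf b_1',\dots,\mathbf b_L'$, and assume that $B$ has full rank, $\operatorname{rank}(B)=L$. For each $\ell$ let $$\varphi_\ell(t)=\sum_{q=0}^L a_{\ell,q}X_{t-\alpha q},\qquad V_\ell(\theta)=\sum_{k=0}^L b_{\ell,k}\,\rho_\theta(\alpha k).$$ For $N\ge L$ and $t_i=\alpha i$ let $\hat{\mathbf g}_N(\theta)\in\mathbb R^L$ have the entries $\frac1{N-L+1}\sum_{i=L}^N\big(\varphi_\ell(t_i)^2-V_\ell(\theta)\big)$. For a symmetric positive-definite $L\times L$ matrix $A$ let $\hat Q_N(\theta)=\hat{\mathbf g}_N(\theta)'A\,\hat{\mathbf g}_N(\theta)$. Given a set $\Theta$ of parameters, a GMM estimator is a sequence of random vectors $\hat\theta_N$ such that, for every $N\ge L$, almost surely $\hat\theta_N\in\operatorname{argmin}_{\vartheta\in\Theta}\hat Q_N(\vartheta)$. **Proposition 3.1.** Let $\Theta=[H_1,H_2]\times[\lambda_1,\lambda_2]\times[\sigma_1,\sigma_2]$ be a closed rectangle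 with $0<H_1$, $H_2<1$, $0<\lambda_1$, $\lambda_2<\exp(\Psi(3))$, where $\Psi(x)=\frac{d}{dx}\log\Gamma(x)$, and with $\sigma$ of known sign ($\sigma_1>0$ or $\sigma_2<0$). Then there is $\alpha_0>0$, depending only on $\Theta$, such that for every step size $0<\alpha<\alpha_0$, every $L\ge3$, all filters as above, every symmetric positive-definite matrix $A$, every $\theta\in\Theta$, every stationary fOU process $X$ with parameter $\theta$, and every GMM estimator $\hat\theta_N$ over $\Theta$: 1. $E\|\hat\theta_N-\theta\|^2<\infty$ for every $N\ge L$, and $E\big[\|\hat\theta_N-\theta\|^2\big]=O(N^{-1})$ as $N\to\infty$; 2. for every $\gamma<\tfrac12$, $N^{\gamma}\|\hat\theta_N-\theta\|\to0$ almost surely as $N\to\infty$. -/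

import Mathlib

open MeasureTheory ProbabilityTheory Filter Topology

namespace FOU

noncomputable section

/-! ### The stationary fractional Ornstein-Uhlenbeck process -/

/-- A two-sided fractional Brownian motion with Hurst parameter `H`: a centered Gaussian process
indexed by the real line, with almost surely continuous paths and covariance
`(|s|^(2H) + |t|^(2H) - |t - s|^(2H)) / 2`. -/
structure IsFractionalBrownianMotion {Ω : Type*} [MeasurableSpace Ω] (μ : Measure Ω)
    (H : ℝ) (B : ℝ → Ω → ℝ) : Prop where
  gaussian : IsGaussianProcess B μ
  centered : ∀ t, ∫ ω, B t ω ∂μ = 0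
  covariance : ∀ s t, cov[B s, B t; μ] =
    (|s| ^ (2 * H) + |t| ^ (2 * H) - |t - s| ^ (2 * H)) / 2
  continuous : ∀ᵐ ω ∂μ, Continuous fun t => B t ω

/-- `I` is the Riemann-Stieltjes integral of `f` with respect to `g` over `[a, b]`: the tagged sums
`∑ f(ξᵢ) (g(xᵢ₊₁) - g(xᵢ))` over the partitions `a = x₀ ≤ x₁ ≤ ⋯ ≤ xₙ = b` with tags
`ξᵢ ∈ [xᵢ, xᵢ₊₁]` converge to `I` as the mesh tends to zero. -/
def HasRiemannStieltjesIntegral (f g : ℝ → ℝ) (a b I : ℝ) : Prop :=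
  ∀ ε > 0, ∃ δ > 0, ∀ (n : ℕ) (x ξ : ℕ → ℝ), x 0 = a → x n = b →
    (∀ i < n, x i ≤ ξ i ∧ ξ i ≤ x (i + 1) ∧ x (i + 1) - x i < δ) →
    |∑ i ∈ Finset.range n, f (ξ i) * (g (x (i + 1)) - g (x i)) - I| < ε

/-- `I` is the improper Riemann-Stieltjes integral of `f` with respect to `g` over `(-∞, t]`. -/
def HasImproperRiemannStieltjesIntegral (f g : ℝ → ℝ) (t I : ℝ) : Prop :=
  ∃ J : ℝ → ℝ, (∀ a ≤ t, HasRiemannStieltjesIntegral f g a t (J a)) ∧ Tendsto J atBot (𝓝 I)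

/-- The parameters `θ = (H, lam, σ)`, with the Euclidean norm. -/
abbrev Param : Type := EuclideanSpace ℝ (Fin 3)

/-- `X` is a stationary fractional Ornstein-Uhlenbeck process with parameters
`θ = (θ 0, θ 1, θ 2) = (H, lam, σ)`: there is a fractional Brownian motion `B` with Hurst
parameter `H` such that, for every `t`, almost surely
`X_t = σ ∫_{-∞}^t exp (-lam (t - u)) dB_u`, a pathwise Riemann-Stieltjes integral. -/
def IsStationaryFOU {Ω : Type*} [MeasurableSpace Ω] (μ : Measure Ω) (θ : Param)
    (X : ℝ → Ω → ℝ) : Prop :=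
  ∃ B : ℝ → Ω → ℝ, IsFractionalBrownianMotion μ (θ 0) B ∧
    ∀ t, ∀ᵐ ω ∂μ, ∃ I : ℝ,
      HasImproperRiemannStieltjesIntegral
        (fun u => Real.exp (-(θ 1) * (t - u))) (fun u => B u ω) t I ∧
      X t ω = θ 2 * I

/-- The constant `c_H = Γ(2H + 1) sin(πH) / (2π)`. -/
def cH (H : ℝ) : ℝ := Real.Gamma (2 * H + 1) * Real.sin (Real.pi * H) / (2 * Real.pi)

/-- The autocovariance function of the stationary fractional Ornstein-Uhlenbeck process,
`ρ_θ(t) = 2 σ² c_H ∫₀^∞ cos(tx) x^(1-2H) / (lam² + x²) dx`. -/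
def rho (θ : Param) (t : ℝ) : ℝ :=
  2 * θ 2 ^ 2 * cH (θ 0) *
    ∫ x in Set.Ioi (0 : ℝ), Real.cos (t * x) * (x ^ (1 - 2 * θ 0) / (θ 1 ^ 2 + x ^ 2))

/-- The closed rectangle with opposite corners `lo` and `hi` in the parameter space. -/
def rectangle (lo hi : Param) : Set Param := {θ | ∀ i, lo i ≤ θ i ∧ θ i ≤ hi i}

/-- The digamma function `Ψ(x) = d/dx log Γ(x)`. -/
def digamma (x : ℝ) : ℝ := deriv (fun y => Real.log (Real.Gamma y)) x

/-! ### Filters and the generalized method of moments -/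

/-- `a = (a_0, …, a_L)` is a filter of length `L + 1` and order `l`. -/
def IsFilter {L : ℕ} (a : Fin (L + 1) → ℝ) (l : ℕ) : Prop :=
  (0 < l → (∀ r < l, ∑ q, a q * ((q : ℕ) : ℝ) ^ r = 0) ∧ ∑ q, a q * ((q : ℕ) : ℝ) ^ l ≠ 0) ∧
  (l = 0 → a 0 = 1 ∧ ∀ q, q ≠ 0 → a q = 0)

/-- `b_0 = ∑_q a_q²` and `b_k = 2 ∑_j a_{k+j} a_j` for `k > 0`. -/
def filterB {L : ℕ} (a : Fin (L + 1) → ℝ) (k : Fin (L + 1)) : ℝ :=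
  (if k = 0 then 1 else 2) *
    ∑ i : Fin (L + 1), ∑ j : Fin (L + 1), if (i : ℕ) = k + j then a i * a j else 0

/-- The `L × (L + 1)` matrix whose rows are the vectors `b` of the filters `a_1, …, a_L`. -/
def matrixB {L : ℕ} (a : Fin L → Fin (L + 1) → ℝ) : Matrix (Fin L) (Fin (L + 1)) ℝ :=
  Matrix.of fun ℓ k => filterB (a ℓ) k

/-- `V(θ) = ∑_{k=0}^L b_k ρ_θ(α k)`. -/
def theoreticalVariance {L : ℕ} (a : Fin (L + 1) → ℝ) (α : ℝ) (θ : Param) : ℝ :=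
  ∑ k : Fin (L + 1), filterB a k * rho θ (α * (k : ℕ))

/-- The filtered process `φ(t) = ∑_{q=0}^L a_q X_{t - α q}`. -/
def filtered {Ω : Type*} {L : ℕ} (X : ℝ → Ω → ℝ) (a : Fin (L + 1) → ℝ) (α t : ℝ) (ω : Ω) : ℝ :=
  ∑ q : Fin (L + 1), a q * X (t - α * (q : ℕ)) ω

/-- The vector `ĝ_N(θ)`, whose entries are
`(N - L + 1)⁻¹ ∑_{i=L}^N (φ_ℓ(t_i)² - V_ℓ(θ))` with observation times `t_i = α i`. -/
def gHat {Ω : Type*} {L : ℕ} (X : ℝ → Ω → ℝ) (a : Fin L → Fin (L + 1) → ℝ) (α : ℝ) (N : ℕ)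
    (θ : Param) (ω : Ω) (ℓ : Fin L) : ℝ :=
  ((N : ℝ) - L + 1)⁻¹ *
    ∑ i ∈ Finset.Icc L N, (filtered X (a ℓ) α (α * i) ω ^ 2 - theoreticalVariance (a ℓ) α θ)

/-- The objective function `Q̂_N(θ) = ĝ_N(θ)' A ĝ_N(θ)`. -/
def QHat {Ω : Type*} {L : ℕ} (X : ℝ → Ω → ℝ) (a : Fin L → Fin (L + 1) → ℝ) (α : ℝ)
    (A : Matrix (Fin L) (Fin L) ℝ) (N : ℕ) (θ : Param) (ω : Ω) : ℝ :=
  gHat X a α N θ ω ⬝ᵥ A.mulVec (gHat X a α N θ ω)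

/-- `θhat` is a GMM estimator over the parameter set `Θ`: for every sample size `N ≥ L`, `θhat N`
is a random vector that almost surely minimizes `Q̂_N` over `Θ`. -/
def IsGMMEstimator {Ω : Type*} [MeasurableSpace Ω] (μ : Measure Ω) {L : ℕ} (X : ℝ → Ω → ℝ)
    (a : Fin L → Fin (L + 1) → ℝ) (α : ℝ) (A : Matrix (Fin L) (Fin L) ℝ) (Θ : Set Param)
    (θhat : ℕ → Ω → Param) : Prop :=
  ∀ N ≥ L, AEMeasurable (θhat N) μ ∧
    ∀ᵐ ω ∂μ, θhat N ω ∈ Θ ∧ ∀ θ ∈ Θ, QHat X a α A N (θhat N ω) ω ≤ QHat X a α A N θ ω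

end

end FOU

/-!
The difference `ĝ_N(θ') - ĝ_N(θ)` is deterministic: it is `B` applied to the differences of the
autocovariances. Since `B` has rank `L` and kills the constant vectors, it determines the
differences of the semivariograms at the lags `α, 2α, …, Lα`. If the lags `α, 2α, 3α` identify the
parameter with a Lipschitz bound, positive definiteness of `A` bounds the estimation error by a
multiple of `‖ĝ_N(θ)‖` at the true parameter `θ`.

For the identification, write the semivariogram as `σ² t ^ (2H) (1 - defect H lam t) / 2`. As
`α → 0`, the difference of the logarithms of the semivariograms of `θ` and `θ'` at `αk` is close to
a combination of `1`, `log k` and `k ^ β`, where `β = 2 - 2H'`, whose coefficients measure the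
errors in `σ`, `H` and `lam`. These functions are linearly independent on `{1, 2, 3}`, uniformly in
`β`, by strict convexity of the exponential.

The filtered process is Gaussian and, since the coefficients of a filter sum to zero, its
autocovariance is a combination of second differences of `ρ_θ`, which decay like `1 / |t|` by one
integration by parts in the spectral integral. Hence the squared autocovariances are summable, and
the fourth moments of the Gaussian law give `E‖ĝ_N(θ)‖² = O(1 / N)`. The almost sure rate follows by
decomposing partial sums into dyadic blocks, as in the Rademacher-Menshov theorem.
-/

namespace FOU

/-! ### Spectral representation of the autocovariance -/

theorem integrableOn_Ioi_of_rpow_bounds {f : ℝ → ℝ} {C p q : ℝ} (hp : -1 < p) (hq : q < -1)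
    (hf : AEStronglyMeasurable f (volume.restrict (Set.Ioi 0)))
    (h0 : ∀ x, 0 < x → x ≤ 1 → |f x| ≤ C * x ^ p) (h1 : ∀ x, 1 < x → |f x| ≤ C * x ^ q) :
    IntegrableOn f (Set.Ioi 0) := by
  rw [← Set.Ioc_union_Ioi_eq_Ioi zero_le_one]
  refine IntegrableOn.union ?_ ?_
  · have hint : IntegrableOn (fun x : ℝ => C * x ^ p) (Set.Ioc 0 1) := by
      rw [← intervalIntegrable_iff_integrableOn_Ioc_of_le zero_le_one]
      exact (intervalIntegral.intervalIntegrable_rpow' hp).const_mul C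
    refine Integrable.mono' hint (hf.mono_set Set.Ioc_subset_Ioi_self) ?_
    exact ae_restrict_of_forall_mem measurableSet_Ioc fun x hx => h0 x hx.1 hx.2
  · refine Integrable.mono' ((integrableOn_Ioi_rpow_of_lt hq zero_lt_one).const_mul C)
      (hf.mono_set (Set.Ioi_subset_Ioi zero_le_one)) ?_
    exact ae_restrict_of_forall_mem measurableSet_Ioi fun x hx => h1 x hx

theorem integral_integral_swap_of_nonneg {α β : Type*} [MeasurableSpace α] [MeasurableSpace β]
    {μ : Measure α} {ν : Measure β} [SFinite μ] [SFinite ν] {f : α → β → ℝ}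
    (hf : AEStronglyMeasurable (Function.uncurry f) (μ.prod ν))
    (h0 : ∀ᵐ x ∂μ, 0 ≤ᵐ[ν] f x) (hint : ∀ᵐ x ∂μ, Integrable (f x) ν)
    (hint' : Integrable (fun x => ∫ y, f x y ∂ν) μ) :
    ∫ x, ∫ y, f x y ∂ν ∂μ = ∫ y, ∫ x, f x y ∂μ ∂ν := by
  refine integral_integral_swap ((integrable_prod_iff hf).mpr ⟨hint, hint'.congr ?_⟩)
  filter_upwards [h0] with x hx
  refine integral_congr_ae ?_
  filter_upwards [hx] with y hy using (Real.norm_of_nonneg hy).symm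

section SpectralBound

variable {H : ℝ}

/-- The majorant `min(1, x²) x ^ (-1 - 2 H)` of the spectral integrands of fractional Brownian
motion; it is integrable on the half line for `0 < H < 1`. -/
noncomputable def spectralBound (H x : ℝ) : ℝ := min 1 (x ^ 2) * x ^ (-1 - 2 * H)

theorem spectralBound_nonneg (H : ℝ) {x : ℝ} (hx : 0 < x) : 0 ≤ spectralBound H x := by
  unfold spectralBound; positivity

theorem integrableOn_spectralBound (hH0 : 0 < H) (hH1 : H < 1) :
    IntegrableOn (spectralBound H) (Set.Ioi 0) := by
  have hm : Measurable (spectralBound H) := by unfold spectralBound; fun_prop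
  refine integrableOn_Ioi_of_rpow_bounds (C := 1) (p := 1 - 2 * H) (q := -1 - 2 * H)
    (by linarith) (by linarith) hm.aestronglyMeasurable ?_ ?_
  · intro x hx _
    rw [abs_of_nonneg (spectralBound_nonneg H hx), one_mul, spectralBound,
      show (1 - 2 * H) = 2 + (-1 - 2 * H) by ring, Real.rpow_add hx]
    gcongr
    rw [Real.rpow_two]
    exact min_le_right _ _
  · intro x hx
    have hx0 : 0 < x := by linarith
    rw [abs_of_nonneg (spectralBound_nonneg H hx0), spectralBound]
    gcongr
    exact min_le_left _ _

theorem integrableOn_of_le_spectralBound {C : ℝ} (hH0 : 0 < H) (hH1 : H < 1) {E : Type*}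
    [NormedAddCommGroup E] {f : ℝ → E}
    (hf : AEStronglyMeasurable f (volume.restrict (Set.Ioi 0)))
    (h : ∀ x, 0 < x → ‖f x‖ ≤ C * spectralBound H x) : IntegrableOn f (Set.Ioi 0) :=
  Integrable.mono' ((integrableOn_spectralBound hH0 hH1).const_mul C) hf
    (ae_restrict_of_forall_mem measurableSet_Ioi fun x hx => h x hx)

theorem one_sub_cos_le_two_mul_min (y : ℝ) : 1 - Real.cos y ≤ 2 * min 1 (y ^ 2) := by
  have h1 := Real.neg_one_le_cos y
  have h2 := Real.one_sub_sq_div_two_le_cos (x := y)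
  rcases le_total 1 (y ^ 2) with h | h
  · rw [min_eq_left h]; linarith
  · rw [min_eq_right h]; nlinarith [sq_nonneg y]

theorem min_one_mul_le (a : ℝ) {b : ℝ} (hb : 0 ≤ b) : min 1 (a * b) ≤ max 1 a * min 1 b := by
  rcases le_total 1 b with h | h
  · rw [min_eq_left h, mul_one]; exact (min_le_left _ _).trans (le_max_left _ _)
  · rw [min_eq_right h]
    exact (min_le_right _ _).trans (mul_le_mul_of_nonneg_right (le_max_right _ _) hb)

theorem norm_one_sub_cos_mul_rpow_le (H t : ℝ) {x : ℝ} (hx : 0 < x) :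
    ‖(1 - Real.cos (t * x)) * x ^ (-1 - 2 * H)‖ ≤ 2 * max 1 (t ^ 2) * spectralBound H x := by
  have h1 := Real.cos_le_one (t * x)
  rw [Real.norm_of_nonneg (mul_nonneg (by linarith) (by positivity)), spectralBound, ← mul_assoc]
  gcongr
  refine (one_sub_cos_le_two_mul_min _).trans ?_
  rw [mul_assoc, mul_pow]
  gcongr
  exact min_one_mul_le _ (by positivity)

theorem integrableOn_one_sub_cos (hH0 : 0 < H) (hH1 : H < 1) (t : ℝ) :
    IntegrableOn (fun x : ℝ => (1 - Real.cos (t * x)) * x ^ (-1 - 2 * H)) (Set.Ioi 0) :=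
  integrableOn_of_le_spectralBound hH0 hH1
    (Measurable.aestronglyMeasurable (by fun_prop)) fun _ hx => norm_one_sub_cos_mul_rpow_le H t hx

end SpectralBound

section EulerianIntegrals

variable {H : ℝ}

theorem integrableOn_rpow_div_one_add_sq (hH0 : 0 < H) (hH1 : H < 1) :
    IntegrableOn (fun y : ℝ => y ^ (2 * H - 1) * (1 / (1 + y ^ 2))) (Set.Ioi 0) := by
  refine integrableOn_Ioi_of_rpow_bounds (C := 1) (p := 2 * H - 1) (q := 2 * H - 3)
    (by linarith) (by linarith) (Measurable.aestronglyMeasurable (by fun_prop)) ?_ ?_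
  · intro x hx _
    rw [abs_of_nonneg (by positivity), one_mul]
    refine mul_le_of_le_one_right (by positivity) ?_
    rw [div_le_one (by positivity)]
    nlinarith [sq_nonneg x]
  · intro x hx
    have hx0 : 0 < x := by linarith
    rw [abs_of_nonneg (by positivity), one_mul, show 2 * H - 3 = (2 * H - 1) - 2 by ring,
      Real.rpow_sub hx0 (2 * H - 1) 2, Real.rpow_two, div_eq_mul_one_div (x ^ (2 * H - 1))]
    gcongr
    linarith

theorem integral_rpow_mul_exp_neg_one_add_sq_mul (hH0 : 0 < H) {z : ℝ} (hz : 0 < z) :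
    ∫ y in Set.Ioi (0 : ℝ), y ^ (2 * H - 1) * Real.exp (-(1 + y ^ 2) * z) =
      (Real.Gamma H / 2) * (Real.exp (-z) * z ^ ((1 - H) - 1)) := by
  have hfactor : ∀ y : ℝ, y ^ (2 * H - 1) * Real.exp (-(1 + y ^ 2) * z) =
      Real.exp (-z) * (y ^ (2 * H - 1) * Real.exp (-z * y ^ (2 : ℝ))) := by
    intro y
    rw [Real.rpow_two, mul_left_comm, ← Real.exp_add]
    ring_nf
  simp_rw [hfactor]
  rw [integral_const_mul,
    integral_rpow_mul_exp_neg_mul_rpow (p := 2) (q := 2 * H - 1) two_pos (by linarith) hz,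
    show -(2 * H - 1 + 1) / 2 = (1 - H) - 1 by ring, show (2 * H - 1 + 1) / 2 = H by ring]
  ring

-- Writing `1 / (1 + y²) = ∫ exp (-(1 + y²) z) dz` and integrating in `y` first gives
-- `Γ(H) Γ(1 - H) / 2`, to which Euler's reflection formula applies.
theorem integral_rpow_div_one_add_sq (hH0 : 0 < H) (hH1 : H < 1) :
    ∫ y in Set.Ioi (0 : ℝ), y ^ (2 * H - 1) * (1 / (1 + y ^ 2)) =
      Real.pi / (2 * Real.sin (Real.pi * H)) := by
  have hneg (y : ℝ) : -(1 + y ^ 2) < 0 := by nlinarith [sq_nonneg y]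
  have hinner (y : ℝ) : ∫ z in Set.Ioi (0 : ℝ), y ^ (2 * H - 1) * Real.exp (-(1 + y ^ 2) * z) =
      y ^ (2 * H - 1) * (1 / (1 + y ^ 2)) := by
    rw [integral_const_mul, integral_exp_mul_Ioi (hneg y) 0, neg_div_neg_eq, mul_zero,
      Real.exp_zero]
  have hmeas : Measurable
      (Function.uncurry fun y z : ℝ => y ^ (2 * H - 1) * Real.exp (-(1 + y ^ 2) * z)) := by
    unfold Function.uncurry
    fun_prop
  calc ∫ y in Set.Ioi (0 : ℝ), y ^ (2 * H - 1) * (1 / (1 + y ^ 2))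
      = ∫ y in Set.Ioi (0 : ℝ), ∫ z in Set.Ioi (0 : ℝ),
          y ^ (2 * H - 1) * Real.exp (-(1 + y ^ 2) * z) := by simp_rw [hinner]
    _ = ∫ z in Set.Ioi (0 : ℝ), ∫ y in Set.Ioi (0 : ℝ),
          y ^ (2 * H - 1) * Real.exp (-(1 + y ^ 2) * z) := by
        refine integral_integral_swap_of_nonneg hmeas.aestronglyMeasurable ?_ ?_ ?_
        · exact ae_restrict_of_forall_mem measurableSet_Ioi fun y hy =>
            Eventually.of_forall fun z =>
              mul_nonneg (Real.rpow_nonneg (le_of_lt hy) _) (Real.exp_nonneg _)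
        · exact Eventually.of_forall fun y => (integrableOn_exp_mul_Ioi (hneg y) 0).const_mul _
        · simp only [hinner]
          exact integrableOn_rpow_div_one_add_sq hH0 hH1
    _ = Real.Gamma H * Real.Gamma (1 - H) / 2 := by
        rw [setIntegral_congr_fun measurableSet_Ioi
            fun z hz => integral_rpow_mul_exp_neg_one_add_sq_mul hH0 hz,
          integral_const_mul, ← Real.Gamma_eq_integral (by linarith)]
        ring
    _ = Real.pi / (2 * Real.sin (Real.pi * H)) := by
        rw [Real.Gamma_mul_Gamma_one_sub, div_div, mul_comm 2]

theorem re_exp_neg_add_I_mul (y x : ℝ) :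
    (Complex.exp (((-y : ℝ) + Complex.I) * x)).re = Real.cos x * Real.exp (-y * x) := by
  rw [Complex.exp_re]
  simp [mul_comm]

theorem integrableOn_cos_mul_exp {y : ℝ} (hy : 0 < y) :
    IntegrableOn (fun x : ℝ => Real.cos x * Real.exp (-y * x)) (Set.Ioi 0) := by
  have hre : ((-y : ℝ) + Complex.I : ℂ).re < 0 := by simpa using hy
  have h := (integrableOn_exp_mul_complex_Ioi hre 0).re
  simp only [RCLike.re_to_complex, re_exp_neg_add_I_mul] at h
  exact h

theorem integral_cos_mul_exp {y : ℝ} (hy : 0 < y) :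
    ∫ x in Set.Ioi (0 : ℝ), Real.cos x * Real.exp (-y * x) = y / (1 + y ^ 2) := by
  have hre : ((-y : ℝ) + Complex.I : ℂ).re < 0 := by simpa using hy
  have h := integral_re (integrableOn_exp_mul_complex_Ioi hre 0)
  simp only [RCLike.re_to_complex, re_exp_neg_add_I_mul] at h
  rw [h, integral_exp_mul_complex_Ioi hre 0, Complex.ofReal_zero, mul_zero, Complex.exp_zero,
    Complex.div_re, Complex.normSq_apply]
  simp only [Complex.neg_re, Complex.one_re, Complex.add_re, Complex.ofReal_re, Complex.I_re,
    Complex.add_im, Complex.ofReal_im, Complex.I_im, Complex.neg_im, Complex.one_im]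
  field_simp
  ring

theorem integral_one_sub_cos_mul_exp {y : ℝ} (hy : 0 < y) :
    ∫ x in Set.Ioi (0 : ℝ), (1 - Real.cos x) * Real.exp (-y * x) = 1 / (y * (1 + y ^ 2)) := by
  have hy' : -y < 0 := by linarith
  simp_rw [sub_mul, one_mul]
  rw [integral_sub (integrableOn_exp_mul_Ioi hy' 0) (integrableOn_cos_mul_exp hy),
    integral_cos_mul_exp hy, integral_exp_mul_Ioi hy' 0, mul_zero, Real.exp_zero, neg_div_neg_eq]
  field_simp
  ring

theorem integral_one_sub_cos_mul_rpow_mul_exp {y : ℝ} (hy : 0 < y) :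
    ∫ x in Set.Ioi (0 : ℝ), (1 - Real.cos x) * (y ^ (2 * H) * Real.exp (-(x * y))) =
      y ^ (2 * H - 1) * (1 / (1 + y ^ 2)) := by
  have hfactor : ∀ x : ℝ, (1 - Real.cos x) * (y ^ (2 * H) * Real.exp (-(x * y))) =
      y ^ (2 * H) * ((1 - Real.cos x) * Real.exp (-y * x)) := fun x => by
    rw [neg_mul, mul_comm y x]
    ring
  simp_rw [hfactor]
  rw [integral_const_mul, integral_one_sub_cos_mul_exp hy, Real.rpow_sub_one hy.ne']
  field_simp

theorem integral_rpow_mul_exp_neg_mul (hH0 : 0 < H) {x : ℝ} (hx : 0 < x) :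
    ∫ y in Set.Ioi (0 : ℝ), y ^ (2 * H) * Real.exp (-(x * y)) =
      x ^ (-1 - 2 * H) * Real.Gamma (2 * H + 1) := by
  have h := Real.integral_rpow_mul_exp_neg_mul_Ioi (a := 2 * H + 1) (by linarith) hx
  rw [show 2 * H + 1 - 1 = 2 * H by ring] at h
  rw [h, one_div, Real.inv_rpow hx.le, ← Real.rpow_neg hx.le,
    show -(2 * H + 1) = -1 - 2 * H by ring]

theorem integrableOn_rpow_mul_exp_neg_mul (hH0 : 0 < H) {x : ℝ} (hx : 0 < x) :
    IntegrableOn (fun y : ℝ => y ^ (2 * H) * Real.exp (-(x * y))) (Set.Ioi 0) := by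
  refine not_imp_comm.mp integral_undef ?_
  rw [integral_rpow_mul_exp_neg_mul hH0 hx]
  exact (mul_pos (Real.rpow_pos_of_pos hx _) (Real.Gamma_pos_of_pos (by linarith))).ne'

-- Fubini, after writing `Γ(2H + 1) x ^ (-1 - 2H) = ∫ y ^ (2H) exp (-x y) dy`.
theorem integral_one_sub_cos (hH0 : 0 < H) (hH1 : H < 1) :
    ∫ x in Set.Ioi (0 : ℝ), (1 - Real.cos x) * x ^ (-1 - 2 * H) =
      Real.pi / (2 * Real.Gamma (2 * H + 1) * Real.sin (Real.pi * H)) := by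
  have hΓ : 0 < Real.Gamma (2 * H + 1) := Real.Gamma_pos_of_pos (by linarith)
  have hx_first : Set.EqOn
      (fun x : ℝ => ∫ y in Set.Ioi (0 : ℝ), (1 - Real.cos x) * (y ^ (2 * H) * Real.exp (-(x * y))))
      (fun x => (1 - Real.cos x) * x ^ (-1 - 2 * H) * Real.Gamma (2 * H + 1)) (Set.Ioi 0) := by
    intro x hx
    simp only
    rw [integral_const_mul, integral_rpow_mul_exp_neg_mul hH0 hx, mul_assoc]
  have hmeas : Measurable (Function.uncurry
      fun x y : ℝ => (1 - Real.cos x) * (y ^ (2 * H) * Real.exp (-(x * y)))) := by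
    unfold Function.uncurry
    fun_prop
  have hbase : IntegrableOn (fun x : ℝ => (1 - Real.cos x) * x ^ (-1 - 2 * H)) (Set.Ioi 0) := by
    have h := integrableOn_one_sub_cos hH0 hH1 1
    simp only [one_mul] at h
    exact h
  have hswap := integral_integral_swap_of_nonneg
    (μ := volume.restrict (Set.Ioi 0)) (ν := volume.restrict (Set.Ioi 0))
    hmeas.aestronglyMeasurable
    (Eventually.of_forall fun x => ae_restrict_of_forall_mem measurableSet_Ioi fun y hy =>
      mul_nonneg (sub_nonneg.mpr (Real.cos_le_one x))
        (mul_nonneg (Real.rpow_nonneg (le_of_lt hy) _) (Real.exp_nonneg _)))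
    (ae_restrict_of_forall_mem measurableSet_Ioi fun x hx =>
      (integrableOn_rpow_mul_exp_neg_mul hH0 hx).const_mul _)
    (IntegrableOn.congr_fun (hbase.mul_const _) hx_first.symm measurableSet_Ioi)
  rw [setIntegral_congr_fun measurableSet_Ioi hx_first,
    setIntegral_congr_fun measurableSet_Ioi
      fun y hy => integral_one_sub_cos_mul_rpow_mul_exp hy, integral_mul_const,
    integral_rpow_div_one_add_sq hH0 hH1, ← eq_div_iff hΓ.ne'] at hswap
  rw [hswap]
  field_simp

theorem sin_pi_mul_pos (hH0 : 0 < H) (hH1 : H < 1) : 0 < Real.sin (Real.pi * H) :=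
  Real.sin_pos_of_pos_of_lt_pi (by positivity) (by nlinarith [Real.pi_pos])

theorem cH_pos (hH0 : 0 < H) (hH1 : H < 1) : 0 < cH H := by
  have hsin := sin_pi_mul_pos hH0 hH1
  have hΓ : 0 < Real.Gamma (2 * H + 1) := Real.Gamma_pos_of_pos (by linarith)
  exact div_pos (mul_pos hΓ hsin) Real.two_pi_pos

theorem four_mul_cH_mul_integral_one_sub_cos (hH0 : 0 < H) (hH1 : H < 1) :
    4 * cH H * ∫ x in Set.Ioi (0 : ℝ), (1 - Real.cos x) * x ^ (-1 - 2 * H) = 1 := by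
  have hsin := (sin_pi_mul_pos hH0 hH1).ne'
  have hΓ : Real.Gamma (2 * H + 1) ≠ 0 := (Real.Gamma_pos_of_pos (by linarith)).ne'
  rw [integral_one_sub_cos hH0 hH1, cH]
  generalize Real.sin (Real.pi * H) = s at hsin
  field_simp
  norm_num

theorem abs_rpow_eq_integral (hH0 : 0 < H) (hH1 : H < 1) (t : ℝ) :
    |t| ^ (2 * H) =
      4 * cH H * ∫ x in Set.Ioi (0 : ℝ), (1 - Real.cos (t * x)) * x ^ (-1 - 2 * H) := by
  rcases eq_or_ne t 0 with rfl | ht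
  · simp [Real.zero_rpow (by linarith : 2 * H ≠ 0)]
  have ht' : 0 < |t| := abs_pos.mpr ht
  have hscale : Set.EqOn (fun x : ℝ => (1 - Real.cos (|t| * x)) * (|t| * x) ^ (-1 - 2 * H))
      (fun x => |t| ^ (-1 - 2 * H) * ((1 - Real.cos (t * x)) * x ^ (-1 - 2 * H))) (Set.Ioi 0) := by
    intro x (hx : 0 < x)
    have hcos : Real.cos (|t| * x) = Real.cos (t * x) := by
      rw [← Real.cos_abs (t * x), abs_mul, abs_of_pos hx]
    simp only [hcos, Real.mul_rpow ht'.le hx.le]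
    ring
  have h := integral_comp_mul_left_Ioi
    (fun x : ℝ => (1 - Real.cos x) * x ^ (-1 - 2 * H)) 0 ht'
  rw [mul_zero, setIntegral_congr_fun measurableSet_Ioi hscale, integral_const_mul,
    smul_eq_mul] at h
  have hpow : |t| ^ (2 * H) * (|t| * |t| ^ (-1 - 2 * H)) = 1 := by
    rw [← Real.rpow_one_add' ht'.le (by linarith), ← Real.rpow_add ht']
    ring_nf
    exact Real.rpow_zero _
  set I := ∫ x in Set.Ioi (0 : ℝ), (1 - Real.cos (t * x)) * x ^ (-1 - 2 * H)
  calc |t| ^ (2 * H)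
      = |t| ^ (2 * H) * (|t| * (|t|⁻¹ * (4 * cH H *
          ∫ x in Set.Ioi (0 : ℝ), (1 - Real.cos x) * x ^ (-1 - 2 * H)))) := by
        rw [four_mul_cH_mul_integral_one_sub_cos hH0 hH1, mul_inv_cancel_left₀ ht'.ne', mul_one]
    _ = |t| ^ (2 * H) * (|t| * |t| ^ (-1 - 2 * H)) * (4 * cH H * I) := by
        rw [mul_left_comm |t|⁻¹, ← h]
        ring
    _ = 4 * cH H * I := by rw [hpow, one_mul]

end EulerianIntegrals

section GaussianLimits

theorem tendsto_charFun_gaussianReal {ι : Type*} {l : Filter ι} {m : ι → ℝ} {v : ι → NNReal}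
    {m₀ : ℝ} {v₀ : NNReal} (hm : Tendsto m l (𝓝 m₀)) (hv : Tendsto v l (𝓝 v₀)) (t : ℝ) :
    Tendsto (fun n => charFun (gaussianReal (m n) (v n)) t) l
      (𝓝 (charFun (gaussianReal m₀ v₀) t)) := by
  simp_rw [charFun_gaussianReal]
  have hm' := (Complex.continuous_ofReal.tendsto m₀).comp hm
  have hv' := (Complex.continuous_ofReal.tendsto _).comp
    ((NNReal.continuous_coe.tendsto v₀).comp hv)
  exact (((hm'.const_mul (t : ℂ)).mul_const Complex.I).sub
    ((hv'.mul_const ((t : ℂ) ^ 2)).div_const 2)).cexp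

theorem hasLaw_gaussianReal_of_tendsto_ae {Ω : Type*} [MeasurableSpace Ω] {μ : Measure Ω}
    [IsProbabilityMeasure μ] {Z : ℕ → Ω → ℝ} {Y : Ω → ℝ} {m : ℕ → ℝ} {v : ℕ → NNReal} {m₀ : ℝ}
    {v₀ : NNReal} (hZ : ∀ n, HasLaw (Z n) (gaussianReal (m n) (v n)) μ)
    (hm : Tendsto m atTop (𝓝 m₀)) (hv : Tendsto v atTop (𝓝 v₀))
    (h : ∀ᵐ ω ∂μ, Tendsto (fun n => Z n ω) atTop (𝓝 (Y ω))) :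
    HasLaw Y (gaussianReal m₀ v₀) μ := by
  have hY := aemeasurable_of_tendsto_metrizable_ae' (fun n => (hZ n).aemeasurable) h
  have hdist : TendstoInDistribution Z atTop Y (fun _ => μ) μ :=
    (tendstoInMeasure_of_tendsto_ae (fun n => (hZ n).aemeasurable.aestronglyMeasurable)
      h).tendstoInDistribution fun n => (hZ n).aemeasurable
  have : IsProbabilityMeasure (μ.map Y) := Measure.isProbabilityMeasure_map hY
  refine ⟨hY, Measure.ext_of_charFun (funext fun t => ?_)⟩
  refine tendsto_nhds_unique ?_ (tendsto_charFun_gaussianReal hm hv t)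
  have hchar := ProbabilityMeasure.tendsto_iff_tendsto_charFun.mp hdist.tendsto t
  simp only [ProbabilityMeasure.coe_mk, (hZ _).map_eq] at hchar
  exact hchar

end GaussianLimits

/-- The difference `exp (i p x) - exp (i q x)`: up to the factor `i x`, the Fourier transform at `x`
of the indicator function of `[q, p]`. -/
noncomputable def expIncrement (p q x : ℝ) : ℂ :=
  Complex.exp ((p * x : ℝ) * Complex.I) - Complex.exp ((q * x : ℝ) * Complex.I)

theorem continuous_expIncrement (p q : ℝ) : Continuous (expIncrement p q) := by
  unfold expIncrement; fun_prop

theorem norm_expIncrement_le (p q x : ℝ) : ‖expIncrement p q x‖ ≤ |p - q| * |x| := by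
  have hfactor : expIncrement p q x = Complex.exp ((q * x : ℝ) * Complex.I) *
      (Complex.exp (Complex.I * ((p - q) * x : ℝ)) - 1) := by
    unfold expIncrement
    rw [mul_sub, ← Complex.exp_add, mul_one]
    congr 2
    push_cast
    ring
  rw [hfactor, norm_mul, Complex.norm_exp_ofReal_mul_I, one_mul, ← abs_mul]
  exact Real.norm_exp_I_mul_ofReal_sub_one_le

theorem re_expIncrement_mul_conj (p q p' q' x : ℝ) :
    (expIncrement p q x * (starRingEnd ℂ) (expIncrement p' q' x)).re =
      (1 - Real.cos ((p - q') * x)) + (1 - Real.cos ((q - p') * x))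
        - (1 - Real.cos ((p - p') * x)) - (1 - Real.cos ((q - q') * x)) := by
  simp only [expIncrement, sub_mul, Real.cos_sub, Complex.mul_re, Complex.conj_re, Complex.conj_im,
    Complex.sub_re, Complex.sub_im, Complex.exp_ofReal_mul_I_re, Complex.exp_ofReal_mul_I_im]
  ring

theorem normSq_sum_eq_sum_sum_re {κ : Type*} (s : Finset κ) (w : κ → ℝ) (z : κ → ℂ) :
    ‖∑ k ∈ s, (w k : ℂ) * z k‖ ^ 2 =
      ∑ k ∈ s, ∑ j ∈ s, w k * w j * (z k * (starRingEnd ℂ) (z j)).re := by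
  have h : ‖∑ k ∈ s, (w k : ℂ) * z k‖ ^ 2 =
      ((∑ k ∈ s, (w k : ℂ) * z k) * (starRingEnd ℂ) (∑ k ∈ s, (w k : ℂ) * z k)).re := by
    rw [Complex.mul_conj, Complex.normSq_eq_norm_sq, Complex.ofReal_re]
  simp only [h, map_sum, Finset.sum_mul_sum, Complex.re_sum]
  refine Finset.sum_congr rfl fun k _ => Finset.sum_congr rfl fun j _ => ?_
  rw [map_mul, Complex.conj_ofReal, mul_mul_mul_comm, ← Complex.ofReal_mul, Complex.re_ofReal_mul]

theorem norm_sq_mul_rpow_le_spectralBound {E : Type*} [SeminormedAddCommGroup E] {z : E} {C x : ℝ}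
    (hx : 0 < x) (H : ℝ) (h1 : ‖z‖ ≤ C) (h2 : ‖z‖ ≤ C * x) :
    ‖‖z‖ ^ 2 * x ^ (-1 - 2 * H)‖ ≤ C ^ 2 * spectralBound H x := by
  rw [Real.norm_of_nonneg (by positivity), spectralBound, ← mul_assoc]
  gcongr
  have h1' : ‖z‖ ^ 2 ≤ C ^ 2 := by gcongr
  have h2' : ‖z‖ ^ 2 ≤ (C * x) ^ 2 := by gcongr
  rcases le_total 1 (x ^ 2) with h | h
  · rw [min_eq_left h]; linarith
  · rw [min_eq_right h]; linarith [mul_pow C x 2]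

section FractionalIncrements

variable {Ω : Type*} [MeasurableSpace Ω] {μ : Measure Ω} {H : ℝ} {B : ℝ → Ω → ℝ}

theorem setIntegral_re_expIncrement (hH0 : 0 < H) (hH1 : H < 1) (p q p' q' : ℝ) :
    IntegrableOn (fun x : ℝ =>
      (expIncrement p q x * (starRingEnd ℂ) (expIncrement p' q' x)).re * x ^ (-1 - 2 * H))
      (Set.Ioi 0) ∧
    4 * cH H * ∫ x in Set.Ioi (0 : ℝ),
      (expIncrement p q x * (starRingEnd ℂ) (expIncrement p' q' x)).re * x ^ (-1 - 2 * H) =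
    |p - q'| ^ (2 * H) + |q - p'| ^ (2 * H) - |p - p'| ^ (2 * H) - |q - q'| ^ (2 * H) := by
  have hI := fun t => integrableOn_one_sub_cos hH0 hH1 t
  set g : ℝ → ℝ → ℝ := fun t x => (1 - Real.cos (t * x)) * x ^ (-1 - 2 * H) with hg
  have hsplit : (fun x : ℝ =>
      (expIncrement p q x * (starRingEnd ℂ) (expIncrement p' q' x)).re * x ^ (-1 - 2 * H)) =
      g (p - q') + g (q - p') - g (p - p') - g (q - q') := by
    funext x
    rw [re_expIncrement_mul_conj]
    simp only [hg, Pi.add_apply, Pi.sub_apply]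
    ring
  rw [hsplit]
  refine ⟨(((hI _).add (hI _)).sub (hI _)).sub (hI _), ?_⟩
  rw [integral_sub' (((hI _).add (hI _)).sub (hI _)) (hI _),
    integral_sub' ((hI _).add (hI _)) (hI _), integral_add' (hI _) (hI _)]
  simp only [abs_rpow_eq_integral hH0 hH1]
  ring

theorem IsFractionalBrownianMotion.memLp_two (hB : IsFractionalBrownianMotion μ H B) (t : ℝ) :
    MemLp (B t) 2 μ :=
  (hB.gaussian.hasGaussianLaw_eval t).memLp_two

theorem IsFractionalBrownianMotion.covariance_increments [IsProbabilityMeasure μ]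
    (hB : IsFractionalBrownianMotion μ H B) (hH0 : 0 < H) (hH1 : H < 1) (p q p' q' : ℝ) :
    cov[fun ω => B p ω - B q ω, fun ω => B p' ω - B q' ω; μ] =
      2 * cH H * ∫ x in Set.Ioi (0 : ℝ),
        (expIncrement p q x * (starRingEnd ℂ) (expIncrement p' q' x)).re * x ^ (-1 - 2 * H) := by
  rw [covariance_fun_sub_fun_sub (hB.memLp_two p) (hB.memLp_two q) (hB.memLp_two p')
    (hB.memLp_two q')]
  simp only [hB.covariance]
  rw [abs_sub_comm p' p, abs_sub_comm q' p, abs_sub_comm p' q, abs_sub_comm q' q]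
  linarith [(setIntegral_re_expIncrement hH0 hH1 p q p' q').2]

theorem IsFractionalBrownianMotion.variance_sum_increments [IsProbabilityMeasure μ]
    (hB : IsFractionalBrownianMotion μ H B) (hH0 : 0 < H) (hH1 : H < 1) {κ : Type*}
    (s : Finset κ) (w p q : κ → ℝ) :
    cov[fun ω => ∑ k ∈ s, w k * (B (p k) ω - B (q k) ω),
        fun ω => ∑ k ∈ s, w k * (B (p k) ω - B (q k) ω); μ] =
      2 * cH H * ∫ x in Set.Ioi (0 : ℝ),
        ‖∑ k ∈ s, (w k : ℂ) * expIncrement (p k) (q k) x‖ ^ 2 * x ^ (-1 - 2 * H) := by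
  have hmem : ∀ k ∈ s, MemLp (fun ω => w k * (B (p k) ω - B (q k) ω)) 2 μ := fun k _ =>
    ((hB.memLp_two _).sub (hB.memLp_two _)).const_mul _
  have hI := fun k j => ((setIntegral_re_expIncrement hH0 hH1 (p k) (q k) (p j) (q j)).1).const_mul
    (w k * w j)
  rw [covariance_fun_sum_fun_sum' hmem hmem]
  simp_rw [covariance_const_mul_left, covariance_const_mul_right,
    hB.covariance_increments hH0 hH1, normSq_sum_eq_sum_sum_re, Finset.sum_mul, mul_assoc (_ * _)]
  rw [integral_finsetSum _ fun k _ => integrable_finsetSum _ fun j _ => hI k j, Finset.mul_sum]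
  refine Finset.sum_congr rfl fun k _ => ?_
  rw [integral_finsetSum _ fun j _ => hI k j, Finset.mul_sum]
  refine Finset.sum_congr rfl fun j _ => ?_
  rw [integral_const_mul]
  ring

theorem IsFractionalBrownianMotion.hasLaw_sum_increments [IsProbabilityMeasure μ]
    (hB : IsFractionalBrownianMotion μ H B) (hH0 : 0 < H) (hH1 : H < 1) {κ : Type*}
    (s : Finset κ) (w p q : κ → ℝ) :
    HasLaw (fun ω => ∑ k ∈ s, w k * (B (p k) ω - B (q k) ω))
      (gaussianReal 0 (2 * cH H * ∫ x in Set.Ioi (0 : ℝ),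
        ‖∑ k ∈ s, (w k : ℂ) * expIncrement (p k) (q k) x‖ ^ 2 * x ^ (-1 - 2 * H)).toNNReal) μ := by
  classical
  have hprocess : IsGaussianProcess (fun k ω => w k * (B (p k) ω - B (q k) ω)) μ := by
    refine hB.gaussian.of_isGaussianProcess fun k => ⟨{p k, q k},
      w k • (ContinuousLinearMap.proj ⟨p k, by simp⟩ - ContinuousLinearMap.proj ⟨q k, by simp⟩), ?_⟩
    intro ω
    simp [Finset.restrict_def]
  have hsum : HasGaussianLaw (fun ω => ∑ k ∈ s, w k * (B (p k) ω - B (q k) ω)) μ :=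
    hprocess.hasGaussianLaw_fun_sum
  have hint := fun t => (hB.memLp_two t).integrable one_le_two
  have hmean : ∫ ω, ∑ k ∈ s, w k * (B (p k) ω - B (q k) ω) ∂μ = 0 := by
    rw [integral_finsetSum]
    swap
    · exact fun k _ => ((hint _).sub (hint _)).const_mul _
    refine Finset.sum_eq_zero fun k _ => ?_
    rw [integral_const_mul, integral_sub (hint _) (hint _), hB.centered, hB.centered, sub_zero,
      mul_zero]
  refine ⟨hsum.aemeasurable, ?_⟩
  rw [hsum.map_eq_gaussianReal, hmean, ← covariance_self hsum.aemeasurable,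
    hB.variance_sum_increments hH0 hH1]

end FractionalIncrements

/-- The `i`-th point of the uniform partition of `[a, t]` into `n + 1` pieces. -/
noncomputable def partitionPoint (a t : ℝ) (n i : ℕ) : ℝ := a + i * ((t - a) / (n + 1))

theorem partitionPoint_zero (a t : ℝ) (n : ℕ) : partitionPoint a t n 0 = a := by
  simp [partitionPoint]

theorem partitionPoint_last (a t : ℝ) (n : ℕ) : partitionPoint a t n (n + 1) = t := by
  have : (n : ℝ) + 1 ≠ 0 := by positivity
  simp only [partitionPoint]
  push_cast
  field_simp
  ring

theorem partitionPoint_succ_sub (a t : ℝ) (n i : ℕ) :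
    partitionPoint a t n (i + 1) - partitionPoint a t n i = (t - a) / (n + 1) := by
  simp only [partitionPoint]
  push_cast
  ring

theorem partitionPoint_mono {a t : ℝ} (h : a ≤ t) (n : ℕ) : Monotone (partitionPoint a t n) := by
  refine monotone_nat_of_le_succ fun i => ?_
  have := partitionPoint_succ_sub a t n i
  have : 0 ≤ (t - a) / ((n : ℝ) + 1) := div_nonneg (by linarith) (by positivity)
  linarith

theorem tendsto_partition_mesh (a t : ℝ) :
    Tendsto (fun n : ℕ => (t - a) / ((n : ℝ) + 1)) atTop (𝓝 0) :=
  tendsto_const_nhds.div_atTop (tendsto_natCast_atTop_atTop.atTop_add tendsto_const_nhds)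

/-- The Riemann-Stieltjes sum of `u ↦ exp (-lam (t - u))` with respect to `u ↦ exp (i u x)`. -/
noncomputable def expRiemannSum (lam a t : ℝ) (n : ℕ) (x : ℝ) : ℂ :=
  ∑ i ∈ Finset.range (n + 1), (Real.exp (-lam * (t - partitionPoint a t n i)) : ℂ) *
    expIncrement (partitionPoint a t n (i + 1)) (partitionPoint a t n i) x

theorem continuous_expRiemannSum (lam a t : ℝ) (n : ℕ) : Continuous (expRiemannSum lam a t n) := by
  unfold expRiemannSum
  have := fun i => continuous_expIncrement
    (partitionPoint a t n (i + 1)) (partitionPoint a t n i)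
  fun_prop

theorem norm_sum_smul_sub_sub_le {E : Type*} [SeminormedAddCommGroup E] [NormedSpace ℝ E]
    {f : ℕ → ℝ} {z : ℕ → E} (hf : Monotone f) (hf0 : 0 ≤ f 0) (hz : ∀ i, ‖z i‖ ≤ 1) (n : ℕ) :
    ‖∑ i ∈ Finset.range n, f i • (z (i + 1) - z i) - f n • z n‖ ≤ f n := by
  induction n with
  | zero =>
    simpa [norm_smul, abs_of_nonneg hf0] using mul_le_of_le_one_right hf0 (hz 0)
  | succ n ih =>
    have hstep : 0 ≤ f (n + 1) - f n := sub_nonneg.2 (hf n.le_succ)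
    calc ‖∑ i ∈ Finset.range (n + 1), f i • (z (i + 1) - z i) - f (n + 1) • z (n + 1)‖
        = ‖(∑ i ∈ Finset.range n, f i • (z (i + 1) - z i) - f n • z n)
            - (f (n + 1) - f n) • z (n + 1)‖ := by
          rw [Finset.sum_range_succ]
          congr 1
          module
      _ ≤ f n + (f (n + 1) - f n) * 1 := by
          refine (norm_sub_le _ _).trans (add_le_add ih ?_)
          rw [norm_smul, Real.norm_of_nonneg hstep]
          exact mul_le_mul_of_nonneg_left (hz _) hstep
      _ = f (n + 1) := by ring

theorem norm_expRiemannSum_le_two {lam a t : ℝ} (hl : 0 ≤ lam) (hat : a ≤ t) (n : ℕ) (x : ℝ) :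
    ‖expRiemannSum lam a t n x‖ ≤ 2 := by
  have hmono : Monotone fun i => Real.exp (-lam * (t - partitionPoint a t n i)) := by
    intro i j hij
    have := partitionPoint_mono hat n hij
    simp only [Real.exp_le_exp]
    nlinarith
  have habel := norm_sum_smul_sub_sub_le hmono (Real.exp_pos _).le
    (z := fun i => Complex.exp ((partitionPoint a t n i * x : ℝ) * Complex.I))
    (fun i => (Complex.norm_exp_ofReal_mul_I _).le) (n + 1)
  simp only [partitionPoint_last, sub_self, mul_zero, Real.exp_zero, Complex.real_smul,
    Complex.ofReal_one, one_mul] at habel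
  have htri := norm_le_norm_sub_add (expRiemannSum lam a t n x)
    (Complex.exp ((t * x : ℝ) * Complex.I))
  rw [Complex.norm_exp_ofReal_mul_I] at htri
  unfold expRiemannSum expIncrement at *
  linarith

theorem norm_expRiemannSum_le {lam a t : ℝ} (hl : 0 ≤ lam) (hat : a ≤ t) (n : ℕ) {x : ℝ}
    (hx : 0 ≤ x) : ‖expRiemannSum lam a t n x‖ ≤ (t - a) * x := by
  have hterm : ∀ i ∈ Finset.range (n + 1),
      ‖(Real.exp (-lam * (t - partitionPoint a t n i)) : ℂ) *
        expIncrement (partitionPoint a t n (i + 1)) (partitionPoint a t n i) x‖ ≤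
      (t - a) / (n + 1) * x := by
    intro i hi
    have hit : partitionPoint a t n i ≤ t := by
      have := partitionPoint_mono hat n (Finset.mem_range.mp hi).le
      rwa [partitionPoint_last] at this
    have hmesh : 0 ≤ (t - a) / ((n : ℝ) + 1) := div_nonneg (by linarith) (by positivity)
    have hincr := norm_expIncrement_le (partitionPoint a t n (i + 1)) (partitionPoint a t n i) x
    rw [partitionPoint_succ_sub, abs_of_nonneg hmesh, abs_of_nonneg hx] at hincr
    have hexp : Real.exp (-lam * (t - partitionPoint a t n i)) ≤ 1 := by
      rw [Real.exp_le_one_iff]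
      nlinarith
    rw [norm_mul, Complex.norm_real, Real.norm_of_nonneg (Real.exp_pos _).le]
    exact (mul_le_of_le_one_left (norm_nonneg _) hexp).trans hincr
  refine (norm_sum_le _ _).trans ((Finset.sum_le_card_nsmul _ _ _ hterm).trans_eq ?_)
  rw [Finset.card_range, nsmul_eq_mul]
  have : (n : ℝ) + 1 ≠ 0 := by positivity
  push_cast
  field_simp

theorem expRiemannSum_term_eq (lam a t : ℝ) (n i : ℕ) (x : ℝ) :
    (Real.exp (-lam * (t - partitionPoint a t n i)) : ℂ) *
        expIncrement (partitionPoint a t n (i + 1)) (partitionPoint a t n i) x =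
      Real.exp (-lam * (t - a)) * Complex.exp ((a * x : ℝ) * Complex.I) *
        (Complex.exp (x * Complex.I * ((t - a) / (n + 1) : ℝ)) - 1) *
        Complex.exp ((lam + x * Complex.I) * ((t - a) / (n + 1) : ℝ)) ^ i := by
  rw [← Complex.exp_nat_mul]
  simp only [expIncrement, partitionPoint, Complex.ofReal_exp]
  rw [mul_sub _ _ (1 : ℂ), mul_one, sub_mul, mul_sub]
  simp only [← Complex.exp_add]
  congr 2 <;> (push_cast; ring)

theorem exp_mul_ne_one_of_re_pos {c : ℂ} (hc : 0 < c.re) {h : ℝ} (hh : 0 < h) :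
    Complex.exp (c * h) ≠ 1 := by
  refine fun hone => (Real.one_lt_exp_iff.2 (mul_pos hc hh)).ne' ?_
  have hnorm := congrArg norm hone
  rwa [Complex.norm_exp, Complex.re_mul_ofReal, norm_one] at hnorm

theorem expRiemannSum_eq {lam a t : ℝ} (hl : 0 < lam) (hat : a < t) (n : ℕ) (x : ℝ) :
    expRiemannSum lam a t n x =
      (Complex.exp ((t * x : ℝ) * Complex.I) -
        Real.exp (-lam * (t - a)) * Complex.exp ((a * x : ℝ) * Complex.I)) *
      ((Complex.exp (x * Complex.I * ((t - a) / (n + 1) : ℝ)) - 1) /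
        (Complex.exp ((lam + x * Complex.I) * ((t - a) / (n + 1) : ℝ)) - 1)) := by
  have hratio : Complex.exp ((lam + x * Complex.I) * ((t - a) / (n + 1) : ℝ)) ≠ 1 :=
    exp_mul_ne_one_of_re_pos (by simpa using hl) (div_pos (sub_pos.2 hat) (by positivity))
  have hpow : Complex.exp ((lam + x * Complex.I) * ((t - a) / (n + 1) : ℝ)) ^ (n + 1) =
      Complex.exp ((lam + x * Complex.I) * (t - a : ℝ)) := by
    have : (n : ℂ) + 1 ≠ 0 := by exact_mod_cast n.succ_ne_zero
    rw [← Complex.exp_nat_mul]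
    congr 1
    push_cast
    field_simp
  have hends : (Real.exp (-lam * (t - a)) * Complex.exp ((a * x : ℝ) * Complex.I)) *
      (Complex.exp ((lam + x * Complex.I) * (t - a : ℝ)) - 1) =
      Complex.exp ((t * x : ℝ) * Complex.I) -
        Real.exp (-lam * (t - a)) * Complex.exp ((a * x : ℝ) * Complex.I) := by
    rw [mul_sub, mul_one, Complex.ofReal_exp, ← Complex.exp_add, ← Complex.exp_add]
    congr 2
    push_cast
    ring
  simp only [expRiemannSum, expRiemannSum_term_eq, ← Finset.mul_sum]
  rw [geom_sum_eq hratio, hpow, ← hends]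
  ring

theorem tendsto_exp_mul_sub_one_div (c : ℂ) :
    Tendsto (fun h : ℝ => (Complex.exp (c * h) - 1) / h) (𝓝[≠] 0) (𝓝 c) := by
  have hderiv : HasDerivAt (fun h : ℝ => Complex.exp (c * h)) c 0 := by
    have hcomplex : HasDerivAt (fun h : ℂ => Complex.exp (c * h)) (Complex.exp (c * (0 : ℝ)) * c)
        ((0 : ℝ) : ℂ) := by
      simpa using ((hasDerivAt_id ((0 : ℝ) : ℂ)).const_mul c).cexp
    simpa using hcomplex.comp_ofReal
  refine (hasDerivAt_iff_tendsto_slope_zero.mp hderiv).congr fun h => ?_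
  simp [div_eq_inv_mul]

/-- The transfer function `i x / (lam + i x)` of the stationary solution of the Langevin equation
`dX = -lam X dt + dB`, from the increments of `B` to those of `X`. -/
noncomputable def langevinTransfer (lam x : ℝ) : ℂ := x * Complex.I / (lam + x * Complex.I)

theorem measurable_langevinTransfer (lam : ℝ) : Measurable (langevinTransfer lam) := by
  unfold langevinTransfer
  fun_prop

theorem norm_sq_langevinTransfer (lam x : ℝ) :
    ‖langevinTransfer lam x‖ ^ 2 = x ^ 2 / (lam ^ 2 + x ^ 2) := by
  rw [langevinTransfer, norm_div, div_pow, ← Complex.normSq_eq_norm_sq,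
    ← Complex.normSq_eq_norm_sq, Complex.normSq_apply, Complex.normSq_apply]
  simp [sq]

theorem norm_langevinTransfer_le_one (lam x : ℝ) : ‖langevinTransfer lam x‖ ≤ 1 := by
  refine (sq_le_one_iff₀ (norm_nonneg _)).mp ?_
  rw [norm_sq_langevinTransfer]
  exact div_le_one_of_le₀ (by nlinarith [sq_nonneg lam]) (by positivity)

theorem norm_langevinTransfer_le {lam x : ℝ} (hl : 0 < lam) (hx : 0 ≤ x) :
    ‖langevinTransfer lam x‖ ≤ lam⁻¹ * x := by
  refine le_of_sq_le_sq ?_ (by positivity)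
  rw [norm_sq_langevinTransfer, mul_pow, inv_pow, ← div_eq_inv_mul]
  gcongr
  nlinarith [sq_nonneg x]

/-- The integral of `u ↦ exp (-lam (t - u))` over `[a, t]` with respect to `u ↦ exp (i u x)`, in
closed form. -/
noncomputable def expStieltjes (lam a t x : ℝ) : ℂ :=
  (Complex.exp ((t * x : ℝ) * Complex.I) -
    Real.exp (-lam * (t - a)) * Complex.exp ((a * x : ℝ) * Complex.I)) * langevinTransfer lam x

theorem tendsto_expRiemannSum {lam a t : ℝ} (hl : 0 < lam) (hat : a < t) (x : ℝ) :
    Tendsto (fun n => expRiemannSum lam a t n x) atTop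
      (𝓝 (expStieltjes lam a t x)) := by
  simp_rw [fun n => expRiemannSum_eq hl hat n x, expStieltjes]
  refine Tendsto.const_mul _ ?_
  have hmesh : ∀ n : ℕ, (t - a) / ((n : ℝ) + 1) ≠ 0 := fun n =>
    (div_pos (sub_pos.2 hat) (by positivity)).ne'
  have hdenom : (lam + x * Complex.I : ℂ) ≠ 0 := fun h => hl.ne' (by
    simpa using congrArg Complex.re h)
  have hlim := ((tendsto_exp_mul_sub_one_div (x * Complex.I)).div
    (tendsto_exp_mul_sub_one_div (lam + x * Complex.I)) hdenom).comp
    (tendsto_nhdsWithin_iff.2 ⟨tendsto_partition_mesh a t, Eventually.of_forall hmesh⟩)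
  refine hlim.congr fun n => ?_
  simp only [Function.comp, Pi.div_apply]
  rw [div_div_div_cancel_right₀ (Complex.ofReal_ne_zero.2 (hmesh n))]

theorem measurable_expStieltjes (lam a t : ℝ) : Measurable (expStieltjes lam a t) := by
  unfold expStieltjes
  have := measurable_langevinTransfer lam
  fun_prop

theorem norm_expStieltjes_le {lam a t : ℝ} (hl : 0 ≤ lam) (hat : a ≤ t) (x : ℝ) :
    ‖expStieltjes lam a t x‖ ≤ 2 * ‖langevinTransfer lam x‖ := by
  rw [expStieltjes, norm_mul]
  refine mul_le_mul_of_nonneg_right ((norm_sub_le _ _).trans ?_) (norm_nonneg _)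
  rw [norm_mul, Complex.norm_exp_ofReal_mul_I, Complex.norm_exp_ofReal_mul_I, Complex.norm_real,
    Real.norm_of_nonneg (Real.exp_pos _).le, mul_one]
  have : Real.exp (-lam * (t - a)) ≤ 1 := Real.exp_le_one_iff.2 (by nlinarith)
  linarith

theorem tendsto_expStieltjes_atBot {lam : ℝ} (hl : 0 < lam) (t x : ℝ) :
    Tendsto (fun a => expStieltjes lam a t x) atBot
      (𝓝 (Complex.exp ((t * x : ℝ) * Complex.I) * langevinTransfer lam x)) := by
  have hboundary : Tendsto (fun a : ℝ => (Real.exp (-lam * (t - a)) : ℂ) *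
      Complex.exp ((a * x : ℝ) * Complex.I)) atBot (𝓝 0) := by
    rw [tendsto_zero_iff_norm_tendsto_zero]
    simp only [norm_mul, Complex.norm_exp_ofReal_mul_I, Complex.norm_real, mul_one,
      Real.norm_of_nonneg (Real.exp_pos _).le]
    have hlength : Tendsto (fun a : ℝ => t - a) atBot atTop :=
      tendsto_atTop_add_const_left _ t tendsto_neg_atBot_atTop
    exact Real.tendsto_exp_atBot.comp (hlength.const_mul_atTop_of_neg (neg_lt_zero.2 hl))
  simpa only [expStieltjes, sub_zero] using
    (tendsto_const_nhds.sub hboundary).mul_const (langevinTransfer lam x)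

theorem tendsto_integral_norm_sq_mul_rpow {E : Type*} [NormedAddCommGroup E] [MeasurableSpace E]
    [OpensMeasurableSpace E] {H C : ℝ} (hH0 : 0 < H) (hH1 : H < 1)
    {g : ℕ → ℝ → E} {g' : ℝ → E} (hg : ∀ n, Measurable (g n))
    (h1 : ∀ n, ∀ x > 0, ‖g n x‖ ≤ C) (h2 : ∀ n, ∀ x > 0, ‖g n x‖ ≤ C * x)
    (h : ∀ x > 0, Tendsto (fun n => g n x) atTop (𝓝 (g' x))) :
    Tendsto (fun n => ∫ x in Set.Ioi (0 : ℝ), ‖g n x‖ ^ 2 * x ^ (-1 - 2 * H)) atTop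
      (𝓝 (∫ x in Set.Ioi (0 : ℝ), ‖g' x‖ ^ 2 * x ^ (-1 - 2 * H))) := by
  refine tendsto_integral_of_dominated_convergence (fun x => C ^ 2 * spectralBound H x)
    (fun n => ?_) ((integrableOn_spectralBound hH0 hH1).const_mul _) (fun n => ?_) ?_
  · have := hg n
    exact Measurable.aestronglyMeasurable (by fun_prop)
  · exact ae_restrict_of_forall_mem measurableSet_Ioi fun x hx =>
      norm_sq_mul_rpow_le_spectralBound hx H (h1 n x hx) (h2 n x hx)
  · exact ae_restrict_of_forall_mem measurableSet_Ioi fun x hx =>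
      ((h x hx).norm.pow 2).mul_const _

theorem norm_sum_ofReal_mul_le {ι : Type*} (s : Finset ι) (c : ι → ℝ) (z : ι → ℂ) {D : ℝ}
    (h : ∀ j ∈ s, ‖z j‖ ≤ D) : ‖∑ j ∈ s, (c j : ℂ) * z j‖ ≤ (∑ j ∈ s, |c j|) * D := by
  rw [Finset.sum_mul]
  refine norm_sum_le_of_le s fun j hj => ?_
  rw [norm_mul, Complex.norm_real, Real.norm_eq_abs]
  exact mul_le_mul_of_nonneg_left (h j hj) (abs_nonneg _)

/-- The spectral density of the stationary Ornstein-Uhlenbeck process with Hurst parameter `H` and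
rate `lam`, up to the factor `σ ^ 2 * cH H`. -/
noncomputable def spectralDensity (H lam x : ℝ) : ℝ := x ^ (1 - 2 * H) / (lam ^ 2 + x ^ 2)

theorem measurable_spectralDensity (H lam : ℝ) : Measurable (spectralDensity H lam) := by
  unfold spectralDensity
  fun_prop

theorem norm_sq_langevinTransfer_mul_rpow (H lam : ℝ) {x : ℝ} (hx : 0 < x) :
    ‖langevinTransfer lam x‖ ^ 2 * x ^ (-1 - 2 * H) = spectralDensity H lam x := by
  rw [norm_sq_langevinTransfer, spectralDensity, show 1 - 2 * H = 2 + (-1 - 2 * H) by ring,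
    Real.rpow_add hx, Real.rpow_two]
  ring

theorem integrableOn_cos_mul_spectralDensity {H lam : ℝ} (hH0 : 0 < H) (hH1 : H < 1) (hl : 0 < lam)
    (t : ℝ) : IntegrableOn (fun x : ℝ => Real.cos (t * x) * spectralDensity H lam x)
      (Set.Ioi 0) := by
  have := measurable_spectralDensity H lam
  refine integrableOn_of_le_spectralBound (C := max 1 lam⁻¹ ^ 2) hH0 hH1
    (Measurable.aestronglyMeasurable (by fun_prop)) fun x hx => ?_
  have hx : 0 < x := hx
  have hbound := norm_sq_mul_rpow_le_spectralBound hx H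
    ((norm_langevinTransfer_le_one lam x).trans (le_max_left _ _))
    ((norm_langevinTransfer_le hl hx.le).trans
      (mul_le_mul_of_nonneg_right (le_max_right _ _) hx.le))
  rw [norm_sq_langevinTransfer_mul_rpow H lam hx] at hbound
  rw [norm_mul]
  exact (mul_le_of_le_one_left (norm_nonneg _) (Real.abs_cos_le_one _)).trans hbound

theorem re_exp_mul_conj_exp (a b : ℝ) :
    (Complex.exp (a * Complex.I) * (starRingEnd ℂ) (Complex.exp (b * Complex.I))).re =
      Real.cos (a - b) := by
  rw [Real.cos_sub]
  simp only [Complex.mul_re, Complex.conj_re, Complex.conj_im, Complex.exp_ofReal_mul_I_re,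
    Complex.exp_ofReal_mul_I_im]
  ring

theorem norm_sq_sum_exp_mul_langevinTransfer (H lam : ℝ) {ι : Type*} (s : Finset ι) (c t : ι → ℝ)
    {x : ℝ} (hx : 0 < x) :
    ‖∑ j ∈ s, (c j : ℂ) * (Complex.exp ((t j * x : ℝ) * Complex.I) * langevinTransfer lam x)‖ ^ 2 *
        x ^ (-1 - 2 * H) =
      ∑ i ∈ s, ∑ j ∈ s, c i * c j *
        (Real.cos ((t i - t j) * x) * spectralDensity H lam x) := by
  simp_rw [← mul_assoc]
  rw [← Finset.sum_mul, norm_mul, mul_pow, normSq_sum_eq_sum_sum_re, mul_assoc,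
    norm_sq_langevinTransfer_mul_rpow H lam hx]
  simp_rw [Finset.sum_mul, re_exp_mul_conj_exp, ← sub_mul]

theorem rho_eq (θ : Param) (t : ℝ) : rho θ t = 2 * θ 2 ^ 2 * cH (θ 0) *
    ∫ x in Set.Ioi (0 : ℝ), Real.cos (t * x) * spectralDensity (θ 0) (θ 1) x := rfl

theorem integral_norm_sum_sq_eq_sum_rho {θ : Param} (hH0 : 0 < θ 0) (hH1 : θ 0 < 1)
    (hl : 0 < θ 1) {ι : Type*} (s : Finset ι) (c t : ι → ℝ) :
    2 * cH (θ 0) * ∫ x in Set.Ioi (0 : ℝ),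
        ‖∑ j ∈ s, ((θ 2 * c j : ℝ) : ℂ) * (Complex.exp ((t j * x : ℝ) * Complex.I) *
          langevinTransfer (θ 1) x)‖ ^ 2 * x ^ (-1 - 2 * θ 0) =
      ∑ i ∈ s, ∑ j ∈ s, c i * c j * rho θ (t i - t j) := by
  have hI := fun i j => (integrableOn_cos_mul_spectralDensity hH0 hH1 hl (t i - t j)).const_mul
    (θ 2 * c i * (θ 2 * c j))
  rw [setIntegral_congr_fun measurableSet_Ioi fun x hx =>
      norm_sq_sum_exp_mul_langevinTransfer (θ 0) (θ 1) s (fun j => θ 2 * c j) t hx,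
    integral_finsetSum _ fun i _ => integrable_finsetSum _ fun j _ => hI i j, Finset.mul_sum]
  refine Finset.sum_congr rfl fun i _ => ?_
  rw [integral_finsetSum _ fun j _ => hI i j, Finset.mul_sum]
  refine Finset.sum_congr rfl fun j _ => ?_
  rw [integral_const_mul, rho_eq]
  ring

theorem HasRiemannStieltjesIntegral.tendsto {f g : ℝ → ℝ} {a b I : ℝ}
    (h : HasRiemannStieltjesIntegral f g a b I) (hab : a ≤ b) :
    Tendsto (fun n : ℕ => ∑ i ∈ Finset.range (n + 1), f (partitionPoint a b n i) *
      (g (partitionPoint a b n (i + 1)) - g (partitionPoint a b n i))) atTop (𝓝 I) := by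
  rw [Metric.tendsto_atTop]
  intro ε hε
  obtain ⟨δ, hδ, hclose⟩ := h ε hε
  obtain ⟨N, hN⟩ := eventually_atTop.mp
    ((tendsto_partition_mesh a b).eventually (gt_mem_nhds hδ))
  refine ⟨N, fun n hn => ?_⟩
  rw [Real.dist_eq]
  refine hclose (n + 1) (partitionPoint a b n) (partitionPoint a b n) (partitionPoint_zero _ _ _)
    (partitionPoint_last _ _ _) fun i _ => ⟨le_rfl, partitionPoint_mono hab n i.le_succ, ?_⟩
  rw [partitionPoint_succ_sub]
  exact hN n hn

theorem tendsto_integral_norm_sum_expRiemannSum_sq {H lam a : ℝ} (hH0 : 0 < H) (hH1 : H < 1)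
    (hl : 0 < lam) {ι : Type*} (s : Finset ι) (c t : ι → ℝ) (hat : ∀ j ∈ s, a < t j) :
    Tendsto (fun n => ∫ x in Set.Ioi (0 : ℝ),
        ‖∑ j ∈ s, (c j : ℂ) * expRiemannSum lam a (t j) n x‖ ^ 2 * x ^ (-1 - 2 * H)) atTop
      (𝓝 (∫ x in Set.Ioi (0 : ℝ),
        ‖∑ j ∈ s, (c j : ℂ) * expStieltjes lam a (t j) x‖ ^ 2 * x ^ (-1 - 2 * H))) := by
  obtain ⟨D, hD⟩ := (insert 2 (s.image fun j => t j - a)).exists_le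
  simp only [Finset.forall_mem_insert, Finset.forall_mem_image] at hD
  refine tendsto_integral_norm_sq_mul_rpow (C := (∑ j ∈ s, |c j|) * D) hH0 hH1
    (fun n => ?_) (fun n x _ => ?_) (fun n x hx => ?_) fun x _ => ?_
  · have := fun j => continuous_expRiemannSum lam a (t j) n
    fun_prop
  · exact norm_sum_ofReal_mul_le s c _ fun j hj =>
      (norm_expRiemannSum_le_two hl.le (hat j hj).le n x).trans hD.1
  · rw [mul_assoc]
    exact norm_sum_ofReal_mul_le s c _ fun j hj =>
      (norm_expRiemannSum_le hl.le (hat j hj).le n (le_of_lt hx)).trans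
        (mul_le_mul_of_nonneg_right (hD.2 hj) (le_of_lt hx))
  · exact tendsto_finsetSum _ fun j hj => (tendsto_expRiemannSum hl (hat j hj) x).const_mul _

theorem hasLaw_sum_integral {Ω : Type*} [MeasurableSpace Ω] {μ : Measure Ω}
    [IsProbabilityMeasure μ] {H lam : ℝ} {B : ℝ → Ω → ℝ} (hB : IsFractionalBrownianMotion μ H B)
    (hH0 : 0 < H) (hH1 : H < 1) (hl : 0 < lam) {ι : Type*} (s : Finset ι) (c t : ι → ℝ) {a : ℝ}
    (hat : ∀ j ∈ s, a < t j) {J : ι → Ω → ℝ}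
    (hJ : ∀ᵐ ω ∂μ, ∀ j ∈ s, HasRiemannStieltjesIntegral
      (fun u => Real.exp (-lam * (t j - u))) (fun u => B u ω) a (t j) (J j ω)) :
    HasLaw (fun ω => ∑ j ∈ s, c j * J j ω) (gaussianReal 0 (2 * cH H * ∫ x in Set.Ioi (0 : ℝ),
      ‖∑ j ∈ s, (c j : ℂ) * expStieltjes lam a (t j) x‖ ^ 2 * x ^ (-1 - 2 * H)).toNNReal) μ := by
  have hlaw := fun n : ℕ => hB.hasLaw_sum_increments hH0 hH1 (s ×ˢ Finset.range (n + 1))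
    (fun k => c k.1 * Real.exp (-lam * (t k.1 - partitionPoint a (t k.1) n k.2)))
    (fun k => partitionPoint a (t k.1) n (k.2 + 1)) (fun k => partitionPoint a (t k.1) n k.2)
  simp only [Finset.sum_product, Complex.ofReal_mul, mul_assoc, ← Finset.mul_sum] at hlaw
  simp only [mul_assoc]
  refine hasLaw_gaussianReal_of_tendsto_ae hlaw tendsto_const_nhds
    ((continuous_real_toNNReal.tendsto _).comp ?_) ?_
  · exact ((tendsto_integral_norm_sum_expRiemannSum_sq hH0 hH1 hl s c t hat).const_mul _).const_mul
      _
  · filter_upwards [hJ] with ω hω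
    exact tendsto_finsetSum _ fun j hj => ((hω j hj).tendsto (hat j hj).le).const_mul _

theorem tendsto_integral_norm_sum_expStieltjes_sq {H lam : ℝ} (hH0 : 0 < H) (hH1 : H < 1)
    (hl : 0 < lam) {ι : Type*} (s : Finset ι) (c t : ι → ℝ) {a : ℕ → ℝ}
    (hat : ∀ n, ∀ j ∈ s, a n ≤ t j) (ha : Tendsto a atTop atBot) :
    Tendsto (fun n => ∫ x in Set.Ioi (0 : ℝ),
        ‖∑ j ∈ s, (c j : ℂ) * expStieltjes lam (a n) (t j) x‖ ^ 2 * x ^ (-1 - 2 * H)) atTop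
      (𝓝 (∫ x in Set.Ioi (0 : ℝ), ‖∑ j ∈ s, (c j : ℂ) *
        (Complex.exp ((t j * x : ℝ) * Complex.I) * langevinTransfer lam x)‖ ^ 2 *
          x ^ (-1 - 2 * H))) := by
  refine tendsto_integral_norm_sq_mul_rpow (C := (∑ j ∈ s, |c j|) * (2 * max 1 lam⁻¹)) hH0 hH1
    (fun n => ?_) (fun n x _ => ?_) (fun n x hx => ?_) fun x _ => ?_
  · have := fun j => measurable_expStieltjes lam (a n) (t j)
    fun_prop
  · refine norm_sum_ofReal_mul_le s c _ fun j hj =>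
      (norm_expStieltjes_le hl.le (hat n j hj) x).trans ?_
    gcongr
    exact (norm_langevinTransfer_le_one lam x).trans (le_max_left _ _)
  · rw [mul_assoc, mul_assoc]
    refine norm_sum_ofReal_mul_le s c _ fun j hj =>
      (norm_expStieltjes_le hl.le (hat n j hj) x).trans ?_
    gcongr
    exact (norm_langevinTransfer_le hl (le_of_lt hx)).trans
      (mul_le_mul_of_nonneg_right (le_max_right _ _) (le_of_lt hx))
  · exact tendsto_finsetSum _ fun j _ =>
      ((tendsto_expStieltjes_atBot hl (t j) x).comp ha).const_mul _

theorem IsStationaryFOU.hasLaw_sum {Ω : Type*} [MeasurableSpace Ω] {μ : Measure Ω}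
    [IsProbabilityMeasure μ] {θ : Param} {X : ℝ → Ω → ℝ} (hX : IsStationaryFOU μ θ X)
    (hH0 : 0 < θ 0) (hH1 : θ 0 < 1) (hl : 0 < θ 1) {ι : Type*} (s : Finset ι) (c t : ι → ℝ) :
    HasLaw (fun ω => ∑ j ∈ s, c j * X (t j) ω)
      (gaussianReal 0 (∑ i ∈ s, ∑ j ∈ s, c i * c j * rho θ (t i - t j)).toNNReal) μ := by
  obtain ⟨B, hB, hX⟩ := hX
  have htrunc : ∀ j, ∀ᵐ ω ∂μ, ∃ J : ℝ → ℝ,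
      (∀ a ≤ t j, HasRiemannStieltjesIntegral (fun u => Real.exp (-(θ 1) * (t j - u)))
        (fun u => B u ω) a (t j) (J a)) ∧
      Tendsto (fun a => θ 2 * J a) atBot (𝓝 (X (t j) ω)) := fun j => by
    filter_upwards [hX (t j)] with ω ⟨I, ⟨J, hJint, hJlim⟩, hI⟩
    exact ⟨J, hJint, hI ▸ hJlim.const_mul _⟩
  choose J hJ using fun j => (htrunc j).choice
  replace hJ := (eventually_all_finset s).2 fun j _ => hJ j
  obtain ⟨a₀, ha₀⟩ := (s.image t).bddBelow
  have hlim : Tendsto (fun m : ℕ => a₀ - 1 - m) atTop atBot :=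
    tendsto_atBot_add_const_left _ _ (tendsto_neg_atTop_atBot.comp tendsto_natCast_atTop_atTop)
  have hlt : ∀ m : ℕ, ∀ j ∈ s, a₀ - 1 - m < t j := fun m j hj => by
    linarith [ha₀ (Finset.mem_image_of_mem t hj), m.cast_nonneg (α := ℝ)]
  have hlaw := fun m : ℕ => hasLaw_sum_integral hB hH0 hH1 hl s (fun j => θ 2 * c j) t
    (hlt m) (J := fun j ω => J j ω (a₀ - 1 - m)) (by
      filter_upwards [hJ] with ω hω j hj
      exact (hω j hj).1 _ (hlt m j hj).le)
  rw [← integral_norm_sum_sq_eq_sum_rho hH0 hH1 hl]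
  refine hasLaw_gaussianReal_of_tendsto_ae hlaw tendsto_const_nhds
    ((continuous_real_toNNReal.tendsto _).comp (Tendsto.const_mul _ ?_)) ?_
  · exact tendsto_integral_norm_sum_expStieltjes_sq hH0 hH1 hl s _ t
      (fun m j hj => (hlt m j hj).le) hlim
  · filter_upwards [hJ] with ω hω
    refine tendsto_finsetSum _ fun j hj => ?_
    refine (((hω j hj).2.comp hlim).const_mul (c j)).congr fun m => ?_
    simp only [Function.comp]
    ring

/-! ### Decay of the filtered autocovariance -/

theorem rho_neg (θ : Param) (t : ℝ) : rho θ (-t) = rho θ t := by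
  simp [rho]

theorem spectralDensity_nonneg (H lam : ℝ) {x : ℝ} (hx : 0 ≤ x) : 0 ≤ spectralDensity H lam x := by
  unfold spectralDensity
  positivity

theorem hasDerivAt_spectralDensity (H lam : ℝ) {x : ℝ} (hx : 0 < x) :
    HasDerivAt (spectralDensity H lam)
      (spectralDensity H lam x * ((1 - 2 * H) / x - 2 * x / (lam ^ 2 + x ^ 2))) x := by
  have hnum : HasDerivAt (fun x : ℝ => x ^ (1 - 2 * H)) ((1 - 2 * H) * x ^ (1 - 2 * H - 1)) x :=
    Real.hasDerivAt_rpow_const (Or.inl hx.ne')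
  have hden : HasDerivAt (fun x : ℝ => lam ^ 2 + x ^ 2) (2 * x) x := by
    simpa using (hasDerivAt_pow 2 x).const_add (lam ^ 2)
  have hne : lam ^ 2 + x ^ 2 ≠ 0 := by positivity
  refine (hnum.div hden hne).congr_deriv ?_
  rw [Real.rpow_sub_one hx.ne', spectralDensity]
  field_simp

theorem spectralDensity_le_small (H : ℝ) {lam x : ℝ} (hl : 0 < lam) (hx : 0 ≤ x) :
    spectralDensity H lam x ≤ x ^ (1 - 2 * H) * (lam ^ 2)⁻¹ := by
  unfold spectralDensity
  rw [div_eq_mul_inv]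
  gcongr
  nlinarith

theorem spectralDensity_le_large (H lam : ℝ) {x : ℝ} (hx : 0 < x) :
    spectralDensity H lam x ≤ x ^ (-1 - 2 * H) := by
  unfold spectralDensity
  rw [div_le_iff₀ (by positivity), show 1 - 2 * H = (-1 - 2 * H) + 2 by ring, Real.rpow_add hx,
    Real.rpow_two]
  gcongr
  nlinarith [sq_nonneg lam]

theorem abs_spectralDensity_logDeriv_le {H x : ℝ} (hH0 : 0 ≤ H) (hH1 : H ≤ 1) (lam : ℝ)
    (hx : 0 < x) : |(1 - 2 * H) / x - 2 * x / (lam ^ 2 + x ^ 2)| ≤ 3 / x := by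
  have hpow : |(1 - 2 * H) / x| ≤ 1 / x := by
    rw [abs_div, abs_of_pos hx]
    gcongr
    rw [abs_le]
    constructor <;> linarith
  have hden : |2 * x / (lam ^ 2 + x ^ 2)| ≤ 2 / x := by
    rw [abs_of_nonneg (by positivity), div_le_div_iff₀ (by positivity) hx]
    nlinarith [sq_nonneg lam]
  refine (abs_sub _ _).trans ((add_le_add hpow hden).trans_eq ?_)
  ring

theorem one_sub_cos_nonneg (y : ℝ) : 0 ≤ 1 - Real.cos y := sub_nonneg.2 (Real.cos_le_one y)

theorem one_sub_cos_le_two (y : ℝ) : 1 - Real.cos y ≤ 2 := by linarith [Real.neg_one_le_cos y]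

theorem one_sub_cos_le_sq (y : ℝ) : 1 - Real.cos y ≤ y ^ 2 := by
  nlinarith [sq_nonneg y, Real.one_sub_sq_div_two_le_cos (x := y)]

theorem abs_integral_mul_cos_le {u u' : ℝ → ℝ} (hderiv : ∀ x ∈ Set.Ioi (0 : ℝ),
    HasDerivAt u (u' x) x) (hint : IntegrableOn u' (Set.Ioi 0)) (hzero : Tendsto u (𝓝[>] 0) (𝓝 0))
    (htop : Tendsto u atTop (𝓝 0)) {t : ℝ} (ht : t ≠ 0)
    (hcos : IntegrableOn (fun x => u x * Real.cos (t * x)) (Set.Ioi 0)) :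
    |∫ x in Set.Ioi (0 : ℝ), u x * Real.cos (t * x)| ≤
      (∫ x in Set.Ioi (0 : ℝ), |u' x|) * (1 / |t|) := by
  set v : ℝ → ℝ := fun x => Real.sin (t * x) / t with hv
  have hvderiv : ∀ x ∈ Set.Ioi (0 : ℝ), HasDerivAt v (Real.cos (t * x)) x := by
    intro x _
    refine (((hasDerivAt_id x).const_mul t).sin.div_const t).congr_deriv ?_
    simp only [id, mul_one]
    field_simp
  have hvbound : ∀ x, ‖v x‖ ≤ 1 / |t| := by
    intro x
    rw [hv, norm_div, Real.norm_eq_abs, Real.norm_eq_abs]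
    gcongr
    exact Real.abs_sin_le_one _
  have hmul : IntegrableOn (u' * v) (Set.Ioi 0) :=
    hint.mul_bdd (Measurable.aestronglyMeasurable (by fun_prop)) (Eventually.of_forall hvbound)
  have hboundary : ∀ {l : Filter ℝ}, Tendsto u l (𝓝 0) → Tendsto (u * v) l (𝓝 0) := by
    intro l hl
    have hbound : Tendsto (fun x => ‖u x‖ * (1 / |t|)) l (𝓝 0) := by
      simpa using hl.norm.mul_const (1 / |t|)
    refine squeeze_zero_norm (fun x => ?_) hbound
    rw [Pi.mul_apply, norm_mul]
    exact mul_le_mul_of_nonneg_left (hvbound x) (norm_nonneg (u x))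
  rw [integral_Ioi_mul_deriv_eq_deriv_mul hderiv hvderiv hcos hmul (hboundary hzero)
    (hboundary htop), sub_zero, zero_sub, abs_neg, ← integral_mul_const]
  refine abs_integral_le_integral_abs.trans (integral_mono_of_nonneg
    (Eventually.of_forall fun x => abs_nonneg _) (hint.norm.mul_const _)
    (Eventually.of_forall fun x => ?_))
  simp only [abs_mul]
  exact mul_le_mul_of_nonneg_left (hvbound x) (abs_nonneg _)

/-- The spectral density of the second difference of `rho` with lag `τ`, up to a constant. The
factor `1 - cos (τ x)` removes the singularity of `spectralDensity` at `0`. -/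
noncomputable def differencedDensity (H lam τ x : ℝ) : ℝ :=
  (1 - Real.cos (τ * x)) * spectralDensity H lam x

theorem differencedDensity_nonneg (H lam τ : ℝ) {x : ℝ} (hx : 0 ≤ x) :
    0 ≤ differencedDensity H lam τ x :=
  mul_nonneg (one_sub_cos_nonneg _) (spectralDensity_nonneg H lam hx)

theorem hasDerivAt_differencedDensity (H lam τ : ℝ) {x : ℝ} (hx : 0 < x) :
    HasDerivAt (differencedDensity H lam τ)
      (τ * Real.sin (τ * x) * spectralDensity H lam x + (1 - Real.cos (τ * x)) *
        (spectralDensity H lam x * ((1 - 2 * H) / x - 2 * x / (lam ^ 2 + x ^ 2)))) x := by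
  have hcos : HasDerivAt (fun x : ℝ => 1 - Real.cos (τ * x)) (τ * Real.sin (τ * x)) x := by
    refine (((hasDerivAt_id x).const_mul τ).cos.const_sub 1).congr_deriv ?_
    simp [mul_comm]
  exact hcos.mul (hasDerivAt_spectralDensity H lam hx)

theorem abs_deriv_differencedDensity_le {H : ℝ} (hH0 : 0 ≤ H) (hH1 : H ≤ 1) (lam τ : ℝ) {x : ℝ}
    (hx : 0 < x) : |deriv (differencedDensity H lam τ) x| ≤
      (|τ * Real.sin (τ * x)| + (1 - Real.cos (τ * x)) * (3 / x)) * spectralDensity H lam x := by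
  have hdensity := spectralDensity_nonneg H lam hx.le
  rw [(hasDerivAt_differencedDensity H lam τ hx).deriv]
  refine (abs_add_le _ _).trans ?_
  rw [abs_mul _ (spectralDensity H lam x), abs_mul (1 - Real.cos (τ * x)),
    abs_mul (spectralDensity H lam x), abs_of_nonneg hdensity,
    abs_of_nonneg (one_sub_cos_nonneg _), add_mul, mul_assoc _ (3 / x),
    mul_comm (3 / x) (spectralDensity H lam x)]
  gcongr
  · exact one_sub_cos_nonneg _
  · exact abs_spectralDensity_logDeriv_le hH0 hH1 lam hx

theorem abs_deriv_differencedDensity_le_small {H lam : ℝ} (hH0 : 0 ≤ H) (hH1 : H ≤ 1)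
    (hl : 0 < lam) (τ : ℝ) {x : ℝ} (hx : 0 < x) :
    |deriv (differencedDensity H lam τ) x| ≤ 4 * τ ^ 2 * (lam ^ 2)⁻¹ * x ^ (2 - 2 * H) := by
  have hsin : |τ * Real.sin (τ * x)| ≤ τ ^ 2 * x := by
    have hle := Real.abs_sin_le_abs (x := τ * x)
    rw [abs_mul τ x, abs_of_pos hx] at hle
    calc |τ * Real.sin (τ * x)| = |τ| * |Real.sin (τ * x)| := abs_mul _ _
      _ ≤ |τ| * (|τ| * x) := by gcongr
      _ = τ ^ 2 * x := by rw [← sq_abs τ]; ring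
  have hcos : (1 - Real.cos (τ * x)) * (3 / x) ≤ 3 * τ ^ 2 * x := by
    calc (1 - Real.cos (τ * x)) * (3 / x) ≤ (τ * x) ^ 2 * (3 / x) := by
          gcongr
          exact one_sub_cos_le_sq _
      _ = 3 * τ ^ 2 * x := by field_simp
  calc |deriv (differencedDensity H lam τ) x|
      ≤ _ := abs_deriv_differencedDensity_le hH0 hH1 lam τ hx
    _ ≤ (τ ^ 2 * x + 3 * τ ^ 2 * x) * (x ^ (1 - 2 * H) * (lam ^ 2)⁻¹) := by
        gcongr
        · exact spectralDensity_nonneg H lam hx.le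
        · exact spectralDensity_le_small H hl hx.le
    _ = 4 * τ ^ 2 * (lam ^ 2)⁻¹ * x ^ (2 - 2 * H) := by
        rw [show 2 - 2 * H = 1 + (1 - 2 * H) by ring, Real.rpow_add hx, Real.rpow_one]
        ring

theorem abs_deriv_differencedDensity_le_large {H : ℝ} (hH0 : 0 ≤ H) (hH1 : H ≤ 1) (lam τ : ℝ)
    {x : ℝ} (hx : 1 ≤ x) :
    |deriv (differencedDensity H lam τ) x| ≤ (|τ| + 6) * x ^ (-1 - 2 * H) := by
  have hx0 : 0 < x := by linarith
  have hsin : |τ * Real.sin (τ * x)| ≤ |τ| := by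
    rw [abs_mul]
    exact mul_le_of_le_one_right (abs_nonneg _) (Real.abs_sin_le_one _)
  have hcos : (1 - Real.cos (τ * x)) * (3 / x) ≤ 2 * 3 :=
    mul_le_mul (one_sub_cos_le_two _) (div_le_self (by norm_num) hx) (by positivity) (by norm_num)
  calc |deriv (differencedDensity H lam τ) x|
      ≤ _ := abs_deriv_differencedDensity_le hH0 hH1 lam τ hx0
    _ ≤ (|τ| + 2 * 3) * x ^ (-1 - 2 * H) := by
        gcongr
        · exact spectralDensity_nonneg H lam hx0.le
        · exact spectralDensity_le_large H lam hx0
    _ = (|τ| + 6) * x ^ (-1 - 2 * H) := by norm_num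

theorem integrableOn_deriv_differencedDensity {H lam : ℝ} (hH0 : 0 < H) (hH1 : H < 1)
    (hl : 0 < lam) (τ : ℝ) : IntegrableOn (deriv (differencedDensity H lam τ)) (Set.Ioi 0) := by
  refine integrableOn_Ioi_of_rpow_bounds (C := max (4 * τ ^ 2 * (lam ^ 2)⁻¹) (|τ| + 6))
    (p := 2 - 2 * H) (q := -1 - 2 * H) (by linarith) (by linarith)
    (measurable_deriv _).aestronglyMeasurable (fun x hx _ => ?_) fun x hx => ?_
  · exact (abs_deriv_differencedDensity_le_small hH0.le hH1.le hl τ hx).trans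
      (mul_le_mul_of_nonneg_right (le_max_left _ _) (Real.rpow_nonneg hx.le _))
  · exact (abs_deriv_differencedDensity_le_large hH0.le hH1.le lam τ hx.le).trans
      (mul_le_mul_of_nonneg_right (le_max_right _ _) (Real.rpow_nonneg (by linarith) _))

theorem tendsto_differencedDensity_zero {H lam : ℝ} (hH1 : H < 1) (hl : 0 < lam) (τ : ℝ) :
    Tendsto (differencedDensity H lam τ) (𝓝[>] 0) (𝓝 0) := by
  have hpow : Tendsto (fun x : ℝ => τ ^ 2 * (lam ^ 2)⁻¹ * x ^ (3 - 2 * H)) (𝓝[>] 0) (𝓝 0) := by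
    have := (Real.continuous_rpow_const (q := 3 - 2 * H) (by linarith)).tendsto 0
    rw [Real.zero_rpow (by linarith)] at this
    simpa using (this.mono_left nhdsWithin_le_nhds).const_mul (τ ^ 2 * (lam ^ 2)⁻¹)
  refine squeeze_zero_norm' ?_ hpow
  filter_upwards [self_mem_nhdsWithin] with x (hx : 0 < x)
  rw [Real.norm_of_nonneg (differencedDensity_nonneg H lam τ hx.le)]
  calc (1 - Real.cos (τ * x)) * spectralDensity H lam x
      ≤ (τ * x) ^ 2 * (x ^ (1 - 2 * H) * (lam ^ 2)⁻¹) :=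
        mul_le_mul (one_sub_cos_le_sq _) (spectralDensity_le_small H hl hx.le)
          (spectralDensity_nonneg H lam hx.le) (sq_nonneg _)
    _ = τ ^ 2 * (lam ^ 2)⁻¹ * x ^ (3 - 2 * H) := by
        rw [show 3 - 2 * H = 2 + (1 - 2 * H) by ring, Real.rpow_add hx, Real.rpow_two]
        ring

theorem tendsto_differencedDensity_atTop {H : ℝ} (hH0 : 0 < H) (lam τ : ℝ) :
    Tendsto (differencedDensity H lam τ) atTop (𝓝 0) := by
  have hpow : Tendsto (fun x : ℝ => 2 * x ^ (-1 - 2 * H)) atTop (𝓝 0) := by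
    rw [show -1 - 2 * H = -(1 + 2 * H) by ring]
    simpa using (tendsto_rpow_neg_atTop (by linarith : 0 < 1 + 2 * H)).const_mul 2
  refine squeeze_zero_norm' ?_ hpow
  filter_upwards [eventually_gt_atTop 0] with x hx
  rw [Real.norm_of_nonneg (differencedDensity_nonneg H lam τ hx.le)]
  exact mul_le_mul (one_sub_cos_le_two _) (spectralDensity_le_large H lam hx)
    (spectralDensity_nonneg H lam hx.le) zero_le_two

theorem rho_second_difference_eq {θ : Param} (hH0 : 0 < θ 0) (hH1 : θ 0 < 1) (hl : 0 < θ 1)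
    (t τ : ℝ) :
    IntegrableOn (fun x => differencedDensity (θ 0) (θ 1) τ x * Real.cos (t * x)) (Set.Ioi 0) ∧
    rho θ t - (rho θ (t - τ) + rho θ (t + τ)) / 2 = 2 * θ 2 ^ 2 * cH (θ 0) *
      ∫ x in Set.Ioi (0 : ℝ), differencedDensity (θ 0) (θ 1) τ x * Real.cos (t * x) := by
  have hI := integrableOn_cos_mul_spectralDensity hH0 hH1 hl
  have hsplit : (fun x => differencedDensity (θ 0) (θ 1) τ x * Real.cos (t * x)) =
      ((fun x : ℝ => Real.cos (t * x) * spectralDensity (θ 0) (θ 1) x) -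
        fun x : ℝ => Real.cos ((t - τ) * x) * spectralDensity (θ 0) (θ 1) x / 2) -
        fun x : ℝ => Real.cos ((t + τ) * x) * spectralDensity (θ 0) (θ 1) x / 2 := by
    funext x
    simp only [Pi.sub_apply, differencedDensity, sub_mul t, add_mul t, Real.cos_sub, Real.cos_add]
    ring
  rw [hsplit]
  refine ⟨((hI t).sub ((hI (t - τ)).div_const 2)).sub ((hI (t + τ)).div_const 2), ?_⟩
  rw [integral_sub' ((hI t).sub ((hI (t - τ)).div_const 2)) ((hI (t + τ)).div_const 2),
    integral_sub' (hI t) ((hI (t - τ)).div_const 2), integral_div, integral_div]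
  simp only [rho_eq]
  ring

theorem exists_abs_rho_second_difference_le {θ : Param} (hH0 : 0 < θ 0) (hH1 : θ 0 < 1)
    (hl : 0 < θ 1) (τ : ℝ) :
    ∃ C, ∀ t ≠ 0, |rho θ t - (rho θ (t - τ) + rho θ (t + τ)) / 2| ≤ C / |t| := by
  refine ⟨|2 * θ 2 ^ 2 * cH (θ 0)| *
    ∫ x in Set.Ioi (0 : ℝ), |deriv (differencedDensity (θ 0) (θ 1) τ) x|, fun t ht => ?_⟩
  obtain ⟨hint, heq⟩ := rho_second_difference_eq hH0 hH1 hl t τ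
  rw [heq, abs_mul, mul_div_assoc, div_eq_mul_one_div]
  refine mul_le_mul_of_nonneg_left ?_ (abs_nonneg (2 * θ 2 ^ 2 * cH (θ 0)))
  exact abs_integral_mul_cos_le
    (fun x hx => (hasDerivAt_differencedDensity _ _ τ hx).differentiableAt.hasDerivAt)
    (integrableOn_deriv_differencedDensity hH0 hH1 hl τ)
    (tendsto_differencedDensity_zero hH1 hl τ) (tendsto_differencedDensity_atTop hH0 _ τ) ht hint

theorem deriv_eval_mul_exp_sq (p : Polynomial ℝ) (v : ℝ) :
    deriv (fun t => p.eval t * Real.exp (v * t ^ 2 / 2)) = fun t =>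
      (p.derivative + Polynomial.C v * Polynomial.X * p).eval t * Real.exp (v * t ^ 2 / 2) := by
  funext t
  have hexp : HasDerivAt (fun t => Real.exp (v * t ^ 2 / 2))
      (Real.exp (v * t ^ 2 / 2) * (v * t)) t := by
    refine (((hasDerivAt_pow 2 t).const_mul v).div_const 2).exp.congr_deriv ?_
    simp
    ring
  refine ((p.hasDerivAt t).mul hexp).deriv.trans ?_
  simp only [Polynomial.eval_add, Polynomial.eval_mul, Polynomial.eval_C, Polynomial.eval_X]
  ring

theorem integral_pow_four_gaussianReal (v : NNReal) :
    ∫ x, x ^ 4 ∂(gaussianReal 0 v) = 3 * (v : ℝ) ^ 2 := by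
  have hmgf : mgf id (gaussianReal 0 v) =
      fun t => (1 : Polynomial ℝ).eval t * Real.exp (v * t ^ 2 / 2) := by
    simp [mgf_id_gaussianReal]
  have hmoment := iteratedDeriv_mgf_zero (X := id) (μ := gaussianReal 0 v) (by simp) 4
  simp only [iteratedDeriv_succ, iteratedDeriv_zero, hmgf, deriv_eval_mul_exp_sq] at hmoment
  refine hmoment.symm.trans ?_
  simp
  ring

section GaussianMoments

variable {Ω : Type*} [MeasurableSpace Ω] {μ : Measure Ω} {Y Z : Ω → ℝ}

theorem integrable_pow_of_hasLaw_gaussianReal {m : ℝ} {v : NNReal}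
    (h : HasLaw Y (gaussianReal m v) μ) (n : ℕ) : Integrable (fun ω => Y ω ^ n) μ := by
  have := h.hasGaussianLaw.isProbabilityMeasure
  have hmem : MemLp Y n μ := h.hasGaussianLaw.memLp (by simp)
  refine (integrable_norm_iff (h.aemeasurable.pow_const n).aestronglyMeasurable).mp ?_
  simpa only [norm_pow] using hmem.integrable_norm_pow'

theorem integral_sq_of_hasLaw_gaussianReal {v : NNReal} (h : HasLaw Y (gaussianReal 0 v) μ) :
    ∫ ω, Y ω ^ 2 ∂μ = v := by
  rw [← variance_id_gaussianReal (μ := 0) (v := v), ← h.variance_eq,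
    variance_of_integral_eq_zero h.aemeasurable (by simp [h.integral_eq])]

theorem integral_pow_four_of_hasLaw_gaussianReal {v : NNReal}
    (h : HasLaw Y (gaussianReal 0 v) μ) : ∫ ω, Y ω ^ 4 ∂μ = 3 * (v : ℝ) ^ 2 := by
  rw [← integral_pow_four_gaussianReal]
  exact h.integral_comp (f := fun x => x ^ 4) (Measurable.aestronglyMeasurable (by fun_prop))

/-- `Y` and `Z` are jointly Gaussian and centered, with variances `p` and `r` and covariance `q`.
This is expressed through the laws of the linear combinations of `Y` and `Z`; since `Real.toNNReal`
truncates, the quadratic form giving their variances is required to be nonnegative. -/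
def IsCenteredGaussianPair (μ : Measure Ω) (Y Z : Ω → ℝ) (p q r : ℝ) : Prop :=
  ∀ u w : ℝ, 0 ≤ u ^ 2 * p + 2 * u * w * q + w ^ 2 * r ∧
    HasLaw (fun ω => u * Y ω + w * Z ω)
      (gaussianReal 0 (u ^ 2 * p + 2 * u * w * q + w ^ 2 * r).toNNReal) μ

namespace IsCenteredGaussianPair

variable {p q r : ℝ} (h : IsCenteredGaussianPair μ Y Z p q r)
include h

theorem integrable_pow_add (u w : ℝ) (n : ℕ) :
    Integrable (fun ω => (u * Y ω + w * Z ω) ^ n) μ :=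
  integrable_pow_of_hasLaw_gaussianReal (h u w).2 n

theorem integral_pow_four_add (u w : ℝ) :
    ∫ ω, (u * Y ω + w * Z ω) ^ 4 ∂μ = 3 * (u ^ 2 * p + 2 * u * w * q + w ^ 2 * r) ^ 2 := by
  rw [integral_pow_four_of_hasLaw_gaussianReal (h u w).2, Real.coe_toNNReal _ (h u w).1]

theorem integrable_sq : Integrable (fun ω => Y ω ^ 2) μ := by
  simpa using h.integrable_pow_add 1 0 2

theorem integral_sq : ∫ ω, Y ω ^ 2 ∂μ = p := by
  have hp : 0 ≤ p := by simpa using (h 1 0).1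
  simpa [hp] using integral_sq_of_hasLaw_gaussianReal (h 1 0).2

theorem symm : IsCenteredGaussianPair μ Z Y r q p := fun u w => by
  have := h w u
  simp only [add_comm, add_left_comm, mul_right_comm] at this ⊢
  exact this

-- Polarization reduces the mixed moment to fourth moments of linear combinations.
theorem integrable_sq_mul_sq_and_integral :
    Integrable (fun ω => Y ω ^ 2 * Z ω ^ 2) μ ∧
      ∫ ω, Y ω ^ 2 * Z ω ^ 2 ∂μ = p * r + 2 * q ^ 2 := by
  set M : ℝ → ℝ → Ω → ℝ := fun u w ω => (u * Y ω + w * Z ω) ^ 4 with hM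
  have hpolar : (fun ω => Y ω ^ 2 * Z ω ^ 2) =
      (1 / 12 : ℝ) • (M 1 1 + M 1 (-1) - (2 : ℝ) • M 1 0 - (2 : ℝ) • M 0 1) := by
    funext ω
    simp only [hM, Pi.smul_apply, Pi.sub_apply, Pi.add_apply, smul_eq_mul]
    ring
  have hint : ∀ u w, Integrable (M u w) μ := fun u w => h.integrable_pow_add u w 4
  have hadd := (hint 1 1).add (hint 1 (-1))
  have hsub := hadd.sub ((hint 1 0).smul (2 : ℝ))
  rw [hpolar]
  refine ⟨(hsub.sub ((hint 0 1).smul (2 : ℝ))).smul _, ?_⟩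
  refine (integral_smul (1 / 12 : ℝ) _).trans ?_
  rw [integral_sub' hsub ((hint 0 1).smul (2 : ℝ)), integral_sub' hadd ((hint 1 0).smul (2 : ℝ)),
    integral_add' (hint 1 1) (hint 1 (-1))]
  simp only [Pi.smul_apply, smul_eq_mul, integral_const_mul, hM, h.integral_pow_four_add]
  ring

theorem integrable_centered_sq_mul_and_integral [IsProbabilityMeasure μ] :
    Integrable (fun ω => (Y ω ^ 2 - p) * (Z ω ^ 2 - r)) μ ∧
      ∫ ω, (Y ω ^ 2 - p) * (Z ω ^ 2 - r) ∂μ = 2 * q ^ 2 := by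
  obtain ⟨hint, hmoment⟩ := h.integrable_sq_mul_sq_and_integral
  have hY := h.integrable_sq.mul_const r
  have hZ := h.symm.integrable_sq.const_mul p
  have hconst : Integrable (fun _ => p * r) μ := integrable_const _
  have hexpand : (fun ω => (Y ω ^ 2 - p) * (Z ω ^ 2 - r)) =
      ((fun ω => Y ω ^ 2 * Z ω ^ 2) - (fun ω => Y ω ^ 2 * r) - fun ω => p * Z ω ^ 2) +
        fun _ => p * r := by
    funext ω
    simp only [Pi.add_apply, Pi.sub_apply]
    ring
  rw [hexpand]
  refine ⟨((hint.sub hY).sub hZ).add hconst, ?_⟩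
  rw [integral_add' ((hint.sub hY).sub hZ) hconst, integral_sub' (hint.sub hY) hZ,
    integral_sub' hint hY, hmoment, integral_mul_const, integral_const_mul, h.integral_sq,
    h.symm.integral_sq, integral_const, probReal_univ, one_smul]
  ring

end IsCenteredGaussianPair

theorem integral_sum_sq_le_tsum_mul_card {Z : ℕ → Ω → ℝ} {γ : ℤ → ℝ} (s : Finset ℕ)
    (hint : ∀ i j, Integrable (fun ω => Z i ω * Z j ω) μ)
    (hcov : ∀ i j : ℕ, ∫ ω, Z i ω * Z j ω ∂μ = γ (i - j)) (hγ : Summable γ) (hnn : ∀ k, 0 ≤ γ k) :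
    Integrable (fun ω => (∑ i ∈ s, Z i ω) ^ 2) μ ∧
      ∫ ω, (∑ i ∈ s, Z i ω) ^ 2 ∂μ ≤ (∑' k, γ k) * s.card := by
  have hrow : ∀ i : ℕ, ∑ j ∈ s, γ (i - j) ≤ ∑' k, γ k := by
    intro i
    have hinj : Set.InjOn (fun j : ℕ => (i : ℤ) - j) s := fun x _ y _ hxy => by
      simpa using hxy
    rw [← Finset.sum_image hinj]
    exact hγ.sum_le_tsum _ fun k _ => hnn k
  simp only [sq, Finset.sum_mul_sum]
  refine ⟨integrable_finsetSum _ fun i _ => integrable_finsetSum _ fun j _ => hint i j, ?_⟩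
  rw [integral_finsetSum _ fun i _ => integrable_finsetSum _ fun j _ => hint i j, mul_comm,
    ← nsmul_eq_mul]
  refine Finset.sum_le_card_nsmul _ _ _ fun i _ => ?_
  rw [integral_finsetSum _ fun j _ => hint i j]
  simpa only [hcov] using hrow i

end GaussianMoments

theorem sum_sum_mul_symmetrize {ι : Type*} [Fintype ι] (a : ι → ℝ) (w : ι → ι → ℝ) :
    ∑ i, ∑ j, a i * a j * w i j = ∑ i, ∑ j, a i * a j * ((w i j + w j i) / 2) := by
  have hswap : ∑ i, ∑ j, a i * a j * w j i = ∑ i, ∑ j, a i * a j * w i j := by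
    rw [Finset.sum_comm]
    refine Finset.sum_congr rfl fun i _ => Finset.sum_congr rfl fun j _ => ?_
    rw [mul_comm (a i)]
  have hsplit : ∑ i, ∑ j, a i * a j * ((w i j + w j i) / 2) =
      (∑ i, ∑ j, a i * a j * w i j + ∑ i, ∑ j, a i * a j * w j i) / 2 := by
    simp only [← Finset.sum_add_distrib, Finset.sum_div]
    refine Finset.sum_congr rfl fun i _ => Finset.sum_congr rfl fun j _ => ?_
    ring
  rw [hsplit, hswap, add_self_div_two]

theorem sum_ite_eq_add {L : ℕ} (i j : Fin (L + 1)) (f : ℕ → ℝ) :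
    ∑ k : Fin (L + 1), (if (i : ℕ) = k + j then f k else 0) = if j ≤ i then f (i - j) else 0 := by
  split_ifs with h
  · rw [Finset.sum_eq_single ⟨i - j, by omega⟩]
    · rw [if_pos (by simp only; omega)]
    · exact fun k _ hk => if_neg fun hik => hk (Fin.ext (by simp only; omega))
    · simp
  · exact Finset.sum_eq_zero fun k _ => if_neg (by omega)

theorem sum_filterB_mul {L : ℕ} (a : Fin (L + 1) → ℝ) {g : ℝ → ℝ} (hg : ∀ x, g (-x) = g x) :
    ∑ k : Fin (L + 1), filterB a k * g (k : ℕ) =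
      ∑ i : Fin (L + 1), ∑ j : Fin (L + 1), a i * a j * g ((i : ℕ) - (j : ℕ)) := by
  set w : Fin (L + 1) → Fin (L + 1) → ℝ := fun i j =>
    if j ≤ i then (if (i : ℕ) - (j : ℕ) = 0 then 1 else 2) * g ((i : ℕ) - (j : ℕ) : ℕ) else 0
    with hw
  have hpairs : ∑ k : Fin (L + 1), filterB a k * g (k : ℕ) = ∑ i, ∑ j, a i * a j * w i j := by
    simp only [filterB, Finset.mul_sum, Finset.sum_mul]
    rw [Finset.sum_comm]
    refine Finset.sum_congr rfl fun i _ => ?_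
    rw [Finset.sum_comm]
    refine Finset.sum_congr rfl fun j _ => ?_
    simp only [hw]
    rw [← sum_ite_eq_add i j fun k => (if k = 0 then 1 else 2) * g k, Finset.mul_sum]
    refine Finset.sum_congr rfl fun k _ => ?_
    simp only [Fin.ext_iff, Fin.val_zero]
    split_ifs <;> ring
  have hsymm : ∀ i j, (w i j + w j i) / 2 = g ((i : ℕ) - (j : ℕ)) := by
    intro i j
    simp only [hw, Nat.sub_eq_zero_iff_le]
    rcases lt_trichotomy i j with h | rfl | h
    · rw [if_neg (by omega), if_pos h.le, if_neg (by omega), Nat.cast_sub h.le, ← hg]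
      ring_nf
    · simp
    · rw [if_pos h.le, if_neg (by omega), if_neg (by omega), Nat.cast_sub h.le]
      ring_nf
  simp only [hpairs, sum_sum_mul_symmetrize a w, hsymm]

theorem IsFilter.sum_eq_zero {L l : ℕ} {a : Fin (L + 1) → ℝ} (h : IsFilter a l) (hl : 1 ≤ l) :
    ∑ q, a q = 0 := by
  simpa using (h.1 hl).1 0 hl

theorem sum_filterB_eq_zero {L : ℕ} {a : Fin (L + 1) → ℝ} (h : ∑ q, a q = 0) :
    ∑ k, filterB a k = 0 := by
  have := sum_filterB_mul a (g := fun _ => 1) fun _ => rfl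
  simp only [mul_one] at this
  rw [this, ← Finset.sum_mul_sum, h, zero_mul]

/-- The autocovariance function of the filtered process. -/
noncomputable def filteredCov {L : ℕ} (θ : Param) (a : Fin (L + 1) → ℝ) (α t : ℝ) : ℝ :=
  ∑ q : Fin (L + 1), ∑ r : Fin (L + 1), a q * a r * rho θ (t - (α * (q : ℕ) - α * (r : ℕ)))

theorem filteredCov_eq_sum_symm {L : ℕ} (θ : Param) (a : Fin (L + 1) → ℝ) (α t : ℝ) :
    filteredCov θ a α t = ∑ q : Fin (L + 1), ∑ r : Fin (L + 1), a q * a r *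
      ((rho θ (t - (α * (q : ℕ) - α * (r : ℕ))) +
        rho θ (t + (α * (q : ℕ) - α * (r : ℕ)))) / 2) := by
  rw [filteredCov, sum_sum_mul_symmetrize a fun q r : Fin (L + 1) =>
    rho θ (t - (α * (q : ℕ) - α * (r : ℕ)))]
  simp only [← sub_neg_eq_add t, neg_sub]

theorem filteredCov_neg {L : ℕ} (θ : Param) (a : Fin (L + 1) → ℝ) (α t : ℝ) :
    filteredCov θ a α (-t) = filteredCov θ a α t := by
  simp only [filteredCov_eq_sum_symm]
  refine Finset.sum_congr rfl fun q _ => Finset.sum_congr rfl fun r _ => ?_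
  rw [← rho_neg θ (t - _), ← rho_neg θ (t + _), add_comm (rho θ (-(t - _)))]
  ring_nf

theorem theoreticalVariance_eq_filteredCov {L : ℕ} (θ : Param) (a : Fin (L + 1) → ℝ) (α : ℝ) :
    theoreticalVariance a α θ = filteredCov θ a α 0 := by
  have heven : ∀ x, rho θ (α * -x) = rho θ (α * x) := fun x => by rw [mul_neg, rho_neg]
  rw [theoreticalVariance, filteredCov, sum_filterB_mul a (g := fun x => rho θ (α * x)) heven]
  simp only [zero_sub, rho_neg, mul_sub]

theorem filteredCov_eq_sum_second_difference {L : ℕ} (θ : Param) {a : Fin (L + 1) → ℝ}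
    (ha : ∑ q, a q = 0) (α t : ℝ) :
    filteredCov θ a α t = -∑ q : Fin (L + 1), ∑ r : Fin (L + 1), a q * a r *
      (rho θ t - (rho θ (t - (α * (q : ℕ) - α * (r : ℕ))) +
        rho θ (t + (α * (q : ℕ) - α * (r : ℕ)))) / 2) := by
  have hconst : ∑ q : Fin (L + 1), ∑ r : Fin (L + 1), a q * a r * rho θ t = 0 := by
    simp only [← Finset.sum_mul]
    rw [← Finset.sum_mul_sum, ha, zero_mul, zero_mul]
  simp only [mul_sub (_ * _) (rho θ t), Finset.sum_sub_distrib, hconst, zero_sub, neg_neg,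
    filteredCov_eq_sum_symm θ a α t]

theorem exists_abs_filteredCov_le {L : ℕ} {θ : Param} (hH0 : 0 < θ 0) (hH1 : θ 0 < 1)
    (hl : 0 < θ 1) {a : Fin (L + 1) → ℝ} (ha : ∑ q, a q = 0) (α : ℝ) :
    ∃ C, ∀ t ≠ 0, |filteredCov θ a α t| ≤ C / |t| := by
  choose C hC using fun q r : Fin (L + 1) =>
    exists_abs_rho_second_difference_le hH0 hH1 hl (α * (q : ℕ) - α * (r : ℕ))
  refine ⟨∑ q : Fin (L + 1), ∑ r : Fin (L + 1), |a q * a r| * C q r, fun t ht => ?_⟩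
  rw [filteredCov_eq_sum_second_difference θ ha, abs_neg]
  simp only [Finset.sum_div]
  refine (Finset.abs_sum_le_sum_abs _ _).trans (Finset.sum_le_sum fun q _ => ?_)
  refine (Finset.abs_sum_le_sum_abs _ _).trans (Finset.sum_le_sum fun r _ => ?_)
  rw [abs_mul, mul_div_assoc]
  exact mul_le_mul_of_nonneg_left (hC q r t ht) (abs_nonneg _)

theorem summable_filteredCov_sq {L : ℕ} {θ : Param} (hH0 : 0 < θ 0) (hH1 : θ 0 < 1)
    (hl : 0 < θ 1) {a : Fin (L + 1) → ℝ} (ha : ∑ q, a q = 0) {α : ℝ} (hα : 0 < α) :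
    Summable fun k : ℤ => filteredCov θ a α (α * k) ^ 2 := by
  obtain ⟨C, hC⟩ := exists_abs_filteredCov_le hH0 hH1 hl ha α
  have hsum : Summable fun k : ℤ => (C / α) ^ 2 * (1 / (k : ℝ) ^ 2) :=
    (Real.summable_one_div_int_pow.mpr one_lt_two).mul_left _
  refine Summable.of_norm_bounded_eventually hsum ?_
  filter_upwards [eventually_cofinite_ne 0] with k hk
  have hk' : (k : ℝ) ≠ 0 := Int.cast_ne_zero.mpr hk
  rw [Real.norm_of_nonneg (sq_nonneg _), ← sq_abs]
  calc |filteredCov θ a α (α * k)| ^ 2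
      ≤ (C / |α * k|) ^ 2 := by
        gcongr
        exact hC _ (mul_ne_zero hα.ne' hk')
    _ = (C / α) ^ 2 * (1 / (k : ℝ) ^ 2) := by
        rw [div_pow, sq_abs]
        field_simp

theorem sum_rho_nonneg {θ : Param} (hH0 : 0 < θ 0) (hH1 : θ 0 < 1)
    (hl : 0 < θ 1) {ι : Type*} (s : Finset ι) (c t : ι → ℝ) :
    0 ≤ ∑ i ∈ s, ∑ j ∈ s, c i * c j * rho θ (t i - t j) := by
  rw [← integral_norm_sum_sq_eq_sum_rho hH0 hH1 hl]
  refine mul_nonneg (by linarith [cH_pos hH0 hH1]) (setIntegral_nonneg measurableSet_Ioi ?_)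
  intro x (hx : 0 < x)
  positivity

theorem sum_mul_rho_eq_mul_filteredCov {L : ℕ} (θ : Param) (a : Fin (L + 1) → ℝ)
    (α x y u w : ℝ) :
    ∑ q : Fin (L + 1), ∑ r : Fin (L + 1),
      u * a q * (w * a r) * rho θ (x - α * (q : ℕ) - (y - α * (r : ℕ))) =
      u * w * filteredCov θ a α (x - y) := by
  simp only [filteredCov, Finset.mul_sum, sub_sub_sub_comm x]
  refine Finset.sum_congr rfl fun q _ => Finset.sum_congr rfl fun r _ => ?_
  ring

section FilteredMoments

variable {Ω : Type*} [MeasurableSpace Ω] {μ : Measure Ω} [IsProbabilityMeasure μ]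
  {θ : Param} {X : ℝ → Ω → ℝ} {L : ℕ}

theorem IsStationaryFOU.isCenteredGaussianPair_filtered (hX : IsStationaryFOU μ θ X)
    (hH0 : 0 < θ 0) (hH1 : θ 0 < 1) (hl : 0 < θ 1) (a : Fin (L + 1) → ℝ) (α s t : ℝ) :
    IsCenteredGaussianPair μ (filtered X a α s) (filtered X a α t)
      (filteredCov θ a α 0) (filteredCov θ a α (s - t)) (filteredCov θ a α 0) := by
  intro u w
  set c : Fin 2 × Fin (L + 1) → ℝ := fun k => ![u, w] k.1 * a k.2 with hc
  set τ : Fin 2 × Fin (L + 1) → ℝ := fun k => ![s, t] k.1 - α * (k.2 : ℕ) with hτ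
  have hlaw := hX.hasLaw_sum hH0 hH1 hl Finset.univ c τ
  have hnn := sum_rho_nonneg hH0 hH1 hl Finset.univ c τ
  have hvar : ∑ i, ∑ j, c i * c j * rho θ (τ i - τ j) = u ^ 2 * filteredCov θ a α 0 +
      2 * u * w * filteredCov θ a α (s - t) + w ^ 2 * filteredCov θ a α 0 := by
    simp only [Fintype.sum_prod_type, hc, hτ, Fin.sum_univ_two, Matrix.cons_val_zero,
      Matrix.cons_val_one, Finset.sum_add_distrib, sum_mul_rho_eq_mul_filteredCov]
    rw [← neg_sub s t, filteredCov_neg, sub_self, sub_self]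
    ring
  have hsum : (fun ω => ∑ j, c j * X (τ j) ω) =
      fun ω => u * filtered X a α s ω + w * filtered X a α t ω := by
    funext ω
    simp only [Fintype.sum_prod_type, hc, hτ, Fin.sum_univ_two, Matrix.cons_val_zero,
      Matrix.cons_val_one, filtered, Finset.mul_sum, mul_assoc]
  rw [hvar] at hlaw hnn
  rw [hsum] at hlaw
  exact ⟨hnn, hlaw⟩

theorem IsStationaryFOU.integral_sum_sq_le (hX : IsStationaryFOU μ θ X)
    (hH0 : 0 < θ 0) (hH1 : θ 0 < 1) (hl : 0 < θ 1) {a : Fin (L + 1) → ℝ} (ha : ∑ q, a q = 0)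
    {α : ℝ} (hα : 0 < α) (s : Finset ℕ) :
    Integrable (fun ω =>
      (∑ i ∈ s, (filtered X a α (α * i) ω ^ 2 - theoreticalVariance a α θ)) ^ 2) μ ∧
    ∫ ω, (∑ i ∈ s, (filtered X a α (α * i) ω ^ 2 - theoreticalVariance a α θ)) ^ 2 ∂μ ≤
      (∑' k : ℤ, 2 * filteredCov θ a α (α * k) ^ 2) * s.card := by
  have hpair := fun i j : ℕ =>
    hX.isCenteredGaussianPair_filtered hH0 hH1 hl a α (α * i) (α * j)
  rw [theoreticalVariance_eq_filteredCov]
  refine integral_sum_sq_le_tsum_mul_card s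
    (fun i j => (hpair i j).integrable_centered_sq_mul_and_integral.1) (fun i j => ?_)
    ((summable_filteredCov_sq hH0 hH1 hl ha hα).mul_left 2) fun k => by positivity
  rw [(hpair i j).integrable_centered_sq_mul_and_integral.2, ← mul_sub]
  push_cast
  rfl

end FilteredMoments

/-! ### A strong law from second moments -/

/-- The sum of the squares of the sums of `x` over the dyadic blocks inside `[0, 2 ^ k)`. It
dominates the squares of all partial sums of `x` up to `2 ^ k`, at the cost of a factor `k`. -/
noncomputable def dyadicSquares (x : ℕ → ℝ) (k : ℕ) : ℝ :=
  ∑ j ∈ Finset.range k, ∑ b ∈ Finset.range (2 ^ (k - j)),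
    (∑ i ∈ Finset.Ico (b * 2 ^ j) ((b + 1) * 2 ^ j), x i) ^ 2

theorem dyadicSquares_nonneg (x : ℕ → ℝ) (k : ℕ) : 0 ≤ dyadicSquares x k :=
  Finset.sum_nonneg fun _ _ => Finset.sum_nonneg fun _ _ => sq_nonneg _

-- Rounding `n` down to a multiple of `2 ^ (j + 1)` removes at most one block of length `2 ^ j`.
theorem sq_sum_range_sub_le_sum_blocks (x : ℕ → ℝ) {n j m : ℕ} (hm : n / 2 ^ j < m) :
    (∑ i ∈ Finset.range (n / 2 ^ j * 2 ^ j), x i -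
        ∑ i ∈ Finset.range (n / 2 ^ (j + 1) * 2 ^ (j + 1)), x i) ^ 2 ≤
      ∑ b ∈ Finset.range m, (∑ i ∈ Finset.Ico (b * 2 ^ j) ((b + 1) * 2 ^ j), x i) ^ 2 := by
  have hround : n / 2 ^ (j + 1) * 2 ^ (j + 1) = 2 * (n / 2 ^ j / 2) * 2 ^ j := by
    rw [pow_succ, Nat.div_div_eq_div_mul]
    ring
  rw [hround]
  rcases Nat.even_or_odd' (n / 2 ^ j) with ⟨c, hc | hc⟩
  · rw [show n / 2 ^ j / 2 = c by omega, ← hc, sub_self, zero_pow two_ne_zero]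
    exact Finset.sum_nonneg fun b _ => sq_nonneg _
  · rw [show n / 2 ^ j / 2 = c by omega, hc,
      ← Finset.sum_Ico_eq_sub _ (Nat.mul_le_mul_right _ (Nat.le_succ _))]
    set block : ℕ → ℝ := fun b => ∑ i ∈ Finset.Ico (b * 2 ^ j) ((b + 1) * 2 ^ j), x i
    have hmem : 2 * c ∈ Finset.range m := Finset.mem_range.mpr (by omega)
    exact Finset.single_le_sum (f := fun b => block b ^ 2) (fun b _ => sq_nonneg _) hmem

theorem sq_sum_range_le_dyadicSquares (x : ℕ → ℝ) {k n : ℕ} (hn : n < 2 ^ k) :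
    (∑ i ∈ Finset.range n, x i) ^ 2 ≤ k * dyadicSquares x k := by
  set S : ℕ → ℝ := fun j => ∑ i ∈ Finset.range (n / 2 ^ j * 2 ^ j), x i with hS
  have htelescope : ∑ j ∈ Finset.range k, (S j - S (j + 1)) = ∑ i ∈ Finset.range n, x i := by
    rw [Finset.sum_range_sub']
    simp [Nat.div_eq_of_lt hn, hS]
  rw [← htelescope]
  refine sq_sum_le_card_mul_sum_sq.trans ?_
  rw [Finset.card_range, dyadicSquares]
  gcongr with j hj
  refine sq_sum_range_sub_le_sum_blocks x ?_
  rwa [Nat.div_lt_iff_lt_mul (by positivity), ← pow_add,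
    Nat.sub_add_cancel (Finset.mem_range.mp hj).le]

theorem tendsto_rpow_mul_abs_sum_range {x : ℕ → ℝ} {γ : ℝ} (hγ : γ ≤ 1)
    (h : Tendsto (fun k : ℕ => k * (2 ^ (2 * γ - 2) : ℝ) ^ k * dyadicSquares x k) atTop (𝓝 0)) :
    Tendsto (fun n : ℕ => (n : ℝ) ^ (γ - 1) * |∑ i ∈ Finset.range n, x i|) atTop (𝓝 0) := by
  set β : ℝ := 2 ^ (2 * γ - 2)
  have hβ0 : 0 < β := by positivity
  have hlog : Tendsto (fun n : ℕ => Nat.log 2 n + 1) atTop atTop := by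
    refine tendsto_atTop_mono (fun n => Nat.le_succ _) (tendsto_atTop_atTop.mpr fun b => ?_)
    exact ⟨2 ^ b, fun n hn => Nat.le_log_of_pow_le one_lt_two hn⟩
  have hbound := (h.comp hlog).const_mul β⁻¹
  rw [mul_zero] at hbound
  suffices hsq : Tendsto (fun n : ℕ => ((n : ℝ) ^ (γ - 1) * |∑ i ∈ Finset.range n, x i|) ^ 2)
      atTop (𝓝 0) by
    have hsqrt := (Real.continuous_sqrt.tendsto 0).comp hsq
    rw [Real.sqrt_zero] at hsqrt
    exact hsqrt.congr fun n => Real.sqrt_sq (by positivity)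
  refine squeeze_zero' (Eventually.of_forall fun n => sq_nonneg _) ?_ hbound
  filter_upwards [eventually_gt_atTop 0] with n hn
  have hpow : ((n : ℝ) ^ (γ - 1)) ^ 2 ≤ β ^ Nat.log 2 n := by
    calc ((n : ℝ) ^ (γ - 1)) ^ 2 = (n : ℝ) ^ (2 * γ - 2) := by
          rw [← Real.rpow_mul_natCast n.cast_nonneg]
          push_cast
          ring_nf
      _ ≤ ((2 : ℝ) ^ Nat.log 2 n) ^ (2 * γ - 2) := by
          refine Real.rpow_le_rpow_of_nonpos (by positivity) ?_ (by linarith)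
          exact_mod_cast Nat.pow_log_le_self 2 hn.ne'
      _ = β ^ Nat.log 2 n := Real.rpow_pow_comm two_pos.le _ _ |>.symm
  rw [mul_pow, sq_abs]
  calc ((n : ℝ) ^ (γ - 1)) ^ 2 * (∑ i ∈ Finset.range n, x i) ^ 2
      ≤ β ^ Nat.log 2 n *
          ((Nat.log 2 n + 1 : ℕ) * dyadicSquares x (Nat.log 2 n + 1)) := by
        gcongr
        exact sq_sum_range_le_dyadicSquares x (Nat.lt_pow_succ_log_self one_lt_two n)
    _ = _ := by
        simp only [Function.comp_apply, pow_succ]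
        field_simp

theorem ae_tendsto_zero_of_summable_integral {Ω : Type*} [MeasurableSpace Ω] {μ : Measure Ω}
    {f : ℕ → Ω → ℝ} (hf : ∀ n, Integrable (f n) μ) (hnn : ∀ n ω, 0 ≤ f n ω)
    (hsum : Summable fun n => ∫ ω, f n ω ∂μ) :
    ∀ᵐ ω ∂μ, Tendsto (fun n => f n ω) atTop (𝓝 0) := by
  have hmeas := fun n => (hf n).aemeasurable.ennreal_ofReal
  have hfinite : ∫⁻ ω, ∑' n, ENNReal.ofReal (f n ω) ∂μ ≠ ⊤ := by
    simp only [lintegral_tsum hmeas,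
      ← fun n => ofReal_integral_eq_lintegral_ofReal (hf n) (Eventually.of_forall (hnn n))]
    exact hsum.tsum_ofReal_ne_top
  filter_upwards [ae_lt_top' (AEMeasurable.tsum hmeas) hfinite] with ω hω
  have := (ENNReal.tendsto_toReal ENNReal.zero_ne_top).comp
    (ENNReal.tendsto_atTop_zero_of_tsum_ne_top hω.ne)
  simpa only [Function.comp_def, ENNReal.toReal_ofReal (hnn _ ω), ENNReal.toReal_zero] using this

section StrongLaw

variable {Ω : Type*} [MeasurableSpace Ω] {μ : Measure Ω} {ξ : ℕ → Ω → ℝ} {C : ℝ}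
  (hint : ∀ s : Finset ℕ, Integrable (fun ω => (∑ i ∈ s, ξ i ω) ^ 2) μ)
  (hC : ∀ s : Finset ℕ, ∫ ω, (∑ i ∈ s, ξ i ω) ^ 2 ∂μ ≤ C * s.card)
include hint hC

theorem integral_dyadicSquares_le (k : ℕ) :
    ∫ ω, dyadicSquares (fun i => ξ i ω) k ∂μ ≤ k * (C * 2 ^ k) := by
  have hblock : ∀ b j : ℕ, ∫ ω, (∑ i ∈ Finset.Ico (b * 2 ^ j) ((b + 1) * 2 ^ j), ξ i ω) ^ 2 ∂μ ≤
      C * 2 ^ j := fun b j => (hC _).trans_eq (by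
    rw [Nat.card_Ico, ← Nat.sub_mul, Nat.add_sub_cancel_left, one_mul]
    push_cast
    rfl)
  have hlevel : ∀ j ∈ Finset.range k, ∫ ω, ∑ b ∈ Finset.range (2 ^ (k - j)),
      (∑ i ∈ Finset.Ico (b * 2 ^ j) ((b + 1) * 2 ^ j), ξ i ω) ^ 2 ∂μ ≤ C * 2 ^ k := by
    intro j hj
    rw [integral_finsetSum _ fun b _ => hint _]
    refine (Finset.sum_le_card_nsmul _ _ _ fun b _ => hblock b j).trans_eq ?_
    rw [Finset.card_range, nsmul_eq_mul, Nat.cast_pow, Nat.cast_ofNat, mul_left_comm, ← pow_add,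
      Nat.sub_add_cancel (Finset.mem_range.mp hj).le]
  simp only [dyadicSquares]
  rw [integral_finsetSum _ fun j _ => integrable_finsetSum _ fun b _ => hint _]
  refine (Finset.sum_le_card_nsmul _ _ _ hlevel).trans_eq ?_
  rw [Finset.card_range, nsmul_eq_mul]

theorem ae_tendsto_mul_pow_mul_dyadicSquares {β : ℝ} (hβ0 : 0 ≤ β) (hβ1 : 2 * β < 1) :
    ∀ᵐ ω ∂μ, Tendsto (fun k : ℕ => k * β ^ k * dyadicSquares (fun i => ξ i ω) k) atTop (𝓝 0) := by
  have hnn : ∀ k ω, 0 ≤ k * β ^ k * dyadicSquares (fun i => ξ i ω) k := fun k ω =>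
    mul_nonneg (by positivity) (dyadicSquares_nonneg _ _)
  have hgeom : Summable fun k : ℕ => C * ((k : ℝ) ^ 2 * (2 * β) ^ k) :=
    (summable_pow_mul_geometric_of_norm_lt_one 2
      (by rwa [Real.norm_of_nonneg (by positivity)])).mul_left C
  refine ae_tendsto_zero_of_summable_integral (fun k => Integrable.const_mul ?_ _) hnn
    (Summable.of_nonneg_of_le (fun k => integral_nonneg (hnn k)) (fun k => ?_) hgeom)
  · exact integrable_finsetSum _ fun j _ => integrable_finsetSum _ fun b _ => hint _
  · rw [integral_const_mul]
    calc k * β ^ k * ∫ ω, dyadicSquares (fun i => ξ i ω) k ∂μ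
        ≤ k * β ^ k * (k * (C * 2 ^ k)) := by
          gcongr
          exact integral_dyadicSquares_le hint hC k
      _ = C * (k ^ 2 * (2 * β) ^ k) := by
          rw [mul_pow]
          ring

theorem ae_tendsto_rpow_mul_abs_sum_range {γ : ℝ} (hγ : γ < 1 / 2) :
    ∀ᵐ ω ∂μ, Tendsto (fun n : ℕ => (n : ℝ) ^ (γ - 1) * |∑ i ∈ Finset.range n, ξ i ω|)
      atTop (𝓝 0) := by
  have hβ : (2 : ℝ) * 2 ^ (2 * γ - 2) < 1 := by
    rw [← Real.rpow_one_add' two_pos.le (by linarith)]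
    exact Real.rpow_lt_one_of_one_lt_of_neg one_lt_two (by linarith)
  filter_upwards [ae_tendsto_mul_pow_mul_dyadicSquares hint hC (by positivity) hβ] with ω hω
  exact tendsto_rpow_mul_abs_sum_range (by linarith) hω

end StrongLaw

/-! ### The semivariogram at small lags -/

theorem contDiffAt_Gamma {s : ℝ} (hs : 0 < s) : ContDiffAt ℝ 1 Real.Gamma s := by
  have hdiff : DifferentiableOn ℂ Complex.Gamma {z | 0 < z.re} := fun z hz =>
    (Complex.differentiableAt_Gamma z fun m h => by
      have hz : 0 < z.re := hz
      rw [h, Complex.neg_re, Complex.natCast_re] at hz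
      linarith [m.cast_nonneg (α := ℝ)]).differentiableWithinAt
  have hopen : IsOpen {z : ℂ | 0 < z.re} := isOpen_lt continuous_const Complex.continuous_re
  have hmem : {z : ℂ | 0 < z.re} ∈ 𝓝 (s : ℂ) := hopen.mem_nhds (by simpa using hs)
  exact (hdiff.analyticAt hmem).contDiffAt.real_of_complex

theorem contDiffAt_cH {H : ℝ} (hH : 0 < H) : ContDiffAt ℝ 1 cH H := by
  have hGamma : ContDiffAt ℝ 1 (fun H => Real.Gamma (2 * H + 1)) H :=
    (contDiffAt_Gamma (by positivity)).comp H (by fun_prop)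
  unfold cH
  fun_prop

theorem exists_lipschitzOnWith_cH {h₁ : ℝ} (h1 : 0 < h₁) (h₂ : ℝ) :
    ∃ K, LipschitzOnWith K cH (Set.Icc h₁ h₂) :=
  ContDiffOn.exists_lipschitzOnWith
    (fun _ hH => (contDiffAt_cH (h1.trans_le hH.1)).contDiffWithinAt) one_ne_zero
    (convex_Icc h₁ h₂) isCompact_Icc

theorem exists_cH_mem_Icc {h₁ h₂ : ℝ} (h1 : 0 < h₁) (h2 : h₂ < 1) :
    ∃ c C : ℝ, 0 < c ∧ 0 < C ∧ ∀ H ∈ Set.Icc h₁ h₂, cH H ∈ Set.Icc c C := by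
  rcases Set.eq_empty_or_nonempty (Set.Icc h₁ h₂) with hempty | hne
  · exact ⟨1, 1, one_pos, one_pos, by simp [hempty]⟩
  have hpos : ∀ H ∈ Set.Icc h₁ h₂, 0 < cH H := fun H hH =>
    cH_pos (h1.trans_le hH.1) (hH.2.trans_lt h2)
  have hcont : ContinuousOn cH (Set.Icc h₁ h₂) :=
    (exists_lipschitzOnWith_cH h1 h₂).choose_spec.continuousOn
  obtain ⟨x, hx, hmin⟩ := isCompact_Icc.exists_isMinOn hne hcont
  obtain ⟨y, hy, hmax⟩ := isCompact_Icc.exists_isMaxOn hne hcont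
  exact ⟨cH x, cH y, hpos x hx, hpos y hy, fun H hH => ⟨hmin hH, hmax hH⟩⟩

/-- The function `(1 - cos z) / z ^ (2 H)`, the kernel of the spectral representation of fractional
Brownian motion in the scale-free variable `z = t x`. -/
noncomputable def weightedVersine (H z : ℝ) : ℝ := (1 - Real.cos z) * z ^ (-(2 * H))

theorem measurable_weightedVersine (H : ℝ) : Measurable (weightedVersine H) := by
  unfold weightedVersine
  fun_prop

theorem weightedVersine_nonneg (H : ℝ) {z : ℝ} (hz : 0 ≤ z) : 0 ≤ weightedVersine H z :=
  mul_nonneg (one_sub_cos_nonneg z) (by positivity)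

theorem weightedVersine_le {h₂ H z : ℝ} (hH0 : 0 ≤ H) (hH : H ≤ h₂) (h2 : h₂ ≤ 1) (hz : 0 < z) :
    weightedVersine H z ≤ 2 * z ^ (1 - h₂) := by
  rcases le_total z 1 with h | h
  · calc weightedVersine H z ≤ z ^ 2 * z ^ (-(2 * H)) := by
          unfold weightedVersine
          gcongr
          exact one_sub_cos_le_sq z
      _ = z ^ (2 - 2 * H) := by rw [← Real.rpow_two, ← Real.rpow_add hz, sub_eq_add_neg]
      _ ≤ z ^ (1 - h₂) := Real.rpow_le_rpow_of_exponent_ge hz h (by linarith)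
      _ ≤ 2 * z ^ (1 - h₂) := by linarith [Real.rpow_pos_of_pos hz (1 - h₂)]
  · calc weightedVersine H z ≤ 2 * 1 := by
          unfold weightedVersine
          gcongr
          · exact one_sub_cos_le_two z
          · exact Real.rpow_le_one_of_one_le_of_nonpos h (by linarith)
      _ ≤ 2 * z ^ (1 - h₂) := by
          gcongr
          exact Real.one_le_rpow h (by linarith)

theorem abs_exp_sub_exp_le {u v M : ℝ} (hu : Real.exp u ≤ M) (hv : Real.exp v ≤ M) :
    |Real.exp u - Real.exp v| ≤ M * |u - v| := by
  wlog h : v ≤ u generalizing u v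
  · rw [abs_sub_comm, abs_sub_comm u]
    exact this hv hu (le_of_not_ge h)
  rw [abs_of_nonneg (sub_nonneg.mpr (Real.exp_le_exp.mpr h)), abs_of_nonneg (sub_nonneg.mpr h)]
  calc Real.exp u - Real.exp v = Real.exp u * (1 - Real.exp (v - u)) := by
        rw [mul_sub, ← Real.exp_add]
        ring_nf
    _ ≤ Real.exp u * (u - v) :=
        mul_le_mul_of_nonneg_left (by linarith [Real.add_one_le_exp (v - u)]) (Real.exp_pos u).le
    _ ≤ M * (u - v) := mul_le_mul_of_nonneg_right hu (sub_nonneg.mpr h)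

theorem abs_rpow_sub_rpow_le {z a b M : ℝ} (hz : 0 < z) (ha : z ^ a ≤ M) (hb : z ^ b ≤ M) :
    |z ^ a - z ^ b| ≤ M * (|Real.log z| * |a - b|) := by
  rw [Real.rpow_def_of_pos hz] at ha hb ⊢
  rw [Real.rpow_def_of_pos hz]
  exact (abs_exp_sub_exp_le ha hb).trans_eq (by rw [← mul_sub, abs_mul])

theorem abs_weightedVersine_sub_le {h₂ H H' z : ℝ} (hH0 : 0 ≤ H) (hH : H ≤ h₂) (hH0' : 0 ≤ H')
    (hH' : H' ≤ h₂) (h2 : h₂ < 1) (hz : 0 < z) :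
    |weightedVersine H z - weightedVersine H' z| ≤ 4 / (1 - h₂) * z ^ (1 - h₂) * |H - H'| := by
  have hε : 0 < 1 - h₂ := by linarith
  have hexp : |-(2 * H) - -(2 * H')| = 2 * |H - H'| := by
    rw [← abs_neg, show -(-(2 * H) - -(2 * H')) = 2 * (H - H') by ring, abs_mul, abs_two]
  rw [weightedVersine, weightedVersine, ← mul_sub, abs_mul, abs_of_nonneg (one_sub_cos_nonneg z)]
  rcases le_total z 1 with h | h
  · have hpow : ∀ K ≤ h₂, z ^ (-(2 * K)) ≤ z ^ (-(2 * h₂)) := fun K hK =>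
      Real.rpow_le_rpow_of_exponent_ge hz h (by linarith)
    have hlog := (Real.abs_log_mul_self_rpow_lt z (1 - h₂) hz h hε).le
    rw [abs_mul, abs_of_pos (Real.rpow_pos_of_pos hz _)] at hlog
    calc (1 - Real.cos z) * |z ^ (-(2 * H)) - z ^ (-(2 * H'))|
        ≤ z ^ 2 * (z ^ (-(2 * h₂)) * (|Real.log z| * (2 * |H - H'|))) := by
          rw [← hexp]
          gcongr
          · exact one_sub_cos_le_sq z
          · exact abs_rpow_sub_rpow_le hz (hpow H hH) (hpow H' hH')
      _ = 2 * (|Real.log z| * z ^ (1 - h₂)) * z ^ (1 - h₂) * |H - H'| := by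
          have hsplit : z ^ 2 * z ^ (-(2 * h₂)) = z ^ (1 - h₂) * z ^ (1 - h₂) := by
            rw [← Real.rpow_two, ← Real.rpow_add hz, ← Real.rpow_add hz]
            ring_nf
          linear_combination 2 * |Real.log z| * |H - H'| * hsplit
      _ ≤ 4 * (1 / (1 - h₂)) * z ^ (1 - h₂) * |H - H'| := by
          gcongr
          norm_num
      _ = 4 / (1 - h₂) * z ^ (1 - h₂) * |H - H'| := by ring
  · have hpow : ∀ K : ℝ, 0 ≤ K → z ^ (-(2 * K)) ≤ 1 := fun K hK =>
      Real.rpow_le_one_of_one_le_of_nonpos h (by linarith)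
    have hlog := Real.log_le_rpow_div hz.le hε
    rw [← abs_of_nonneg (Real.log_nonneg h)] at hlog
    calc (1 - Real.cos z) * |z ^ (-(2 * H)) - z ^ (-(2 * H'))|
        ≤ 2 * (1 * (|Real.log z| * (2 * |H - H'|))) := by
          rw [← hexp]
          gcongr
          · exact one_sub_cos_le_two z
          · exact abs_rpow_sub_rpow_le hz (hpow H hH0) (hpow H' hH0')
      _ ≤ 2 * (1 * (z ^ (1 - h₂) / (1 - h₂) * (2 * |H - H'|))) := by gcongr
      _ = 4 / (1 - h₂) * z ^ (1 - h₂) * |H - H'| := by ring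

theorem integrableOn_rpow_div_sq_add_sq_pow {l p : ℝ} (hl : 0 < l) {n : ℕ} (hp : -1 < p)
    (hp' : p < 2 * n - 1) :
    IntegrableOn (fun x : ℝ => x ^ p / (l ^ 2 + x ^ 2) ^ n) (Set.Ioi 0) := by
  have hinv : 0 < ((l ^ 2) ^ n)⁻¹ := by positivity
  refine integrableOn_Ioi_of_rpow_bounds (C := 1 + ((l ^ 2) ^ n)⁻¹) hp (q := p - (2 * n : ℕ))
    (by push_cast; linarith) (Measurable.aestronglyMeasurable (by fun_prop))
    (fun x hx _ => ?_) (fun x hx => ?_)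
  · rw [abs_of_nonneg (by positivity), div_eq_mul_inv, mul_comm]
    gcongr
    calc ((l ^ 2 + x ^ 2) ^ n)⁻¹ ≤ ((l ^ 2) ^ n)⁻¹ := by
          gcongr
          exact le_add_of_nonneg_right (sq_nonneg x)
      _ ≤ 1 + ((l ^ 2) ^ n)⁻¹ := by linarith
  · have hx0 : 0 < x := one_pos.trans hx
    rw [abs_of_nonneg (by positivity), Real.rpow_sub_natCast hx0.ne', pow_mul]
    calc x ^ p / (l ^ 2 + x ^ 2) ^ n ≤ x ^ p / (x ^ 2) ^ n := by
          gcongr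
          exact le_add_of_nonneg_left (sq_nonneg l)
      _ ≤ (1 + ((l ^ 2) ^ n)⁻¹) * (x ^ p / (x ^ 2) ^ n) :=
        le_mul_of_one_le_left (by positivity) (by linarith)

/-- The integral defining `defect`, without the constant `4 * cH H`. -/
noncomputable def defectIntegral (H lam t : ℝ) : ℝ :=
  ∫ x in Set.Ioi (0 : ℝ), weightedVersine H (t * x) * (lam ^ 2 * x⁻¹ / (lam ^ 2 + x ^ 2))

/-- The relative deviation of the variogram of the Ornstein-Uhlenbeck process from the variogram of
fractional Brownian motion. -/
noncomputable def defect (H lam t : ℝ) : ℝ := 4 * cH H * defectIntegral H lam t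

theorem rpow_mul_lorentzian_le {l₁ l₂ lam ε t x : ℝ} (hl₁ : 0 < l₁) (h1 : l₁ ≤ lam) (h2 : lam ≤ l₂)
    (ht : 0 ≤ t) (hx : 0 < x) :
    (t * x) ^ ε * (lam ^ 2 * x⁻¹ / (lam ^ 2 + x ^ 2)) ≤
      t ^ ε * (l₂ ^ 2 * (x ^ (ε - 1) / (l₁ ^ 2 + x ^ 2) ^ 1)) := by
  have hlam : 0 < lam := hl₁.trans_le h1
  rw [Real.mul_rpow ht hx.le, Real.rpow_sub_one hx.ne', pow_one]
  calc t ^ ε * x ^ ε * (lam ^ 2 * x⁻¹ / (lam ^ 2 + x ^ 2))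
      ≤ t ^ ε * x ^ ε * (l₂ ^ 2 * x⁻¹ / (l₁ ^ 2 + x ^ 2)) := by gcongr
    _ = t ^ ε * (l₂ ^ 2 * (x ^ ε / x / (l₁ ^ 2 + x ^ 2))) := by ring

theorem norm_mul_lorentzian_le {l₁ l₂ lam ε t c x y : ℝ} (hl₁ : 0 < l₁) (h1 : l₁ ≤ lam)
    (h2 : lam ≤ l₂) (ht : 0 ≤ t) (hc : 0 ≤ c) (hx : 0 < x) (hy : |y| ≤ c * (t * x) ^ ε) :
    ‖y * (lam ^ 2 * x⁻¹ / (lam ^ 2 + x ^ 2))‖ ≤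
      c * t ^ ε * l₂ ^ 2 * (x ^ (ε - 1) / (l₁ ^ 2 + x ^ 2) ^ 1) := by
  have hlam : 0 < lam := hl₁.trans_le h1
  rw [Real.norm_eq_abs, abs_mul,
    abs_of_nonneg (by positivity : 0 ≤ lam ^ 2 * x⁻¹ / (lam ^ 2 + x ^ 2))]
  calc |y| * (lam ^ 2 * x⁻¹ / (lam ^ 2 + x ^ 2))
      ≤ c * ((t * x) ^ ε * (lam ^ 2 * x⁻¹ / (lam ^ 2 + x ^ 2))) := by
        rw [← mul_assoc]
        gcongr
    _ ≤ c * (t ^ ε * (l₂ ^ 2 * (x ^ (ε - 1) / (l₁ ^ 2 + x ^ 2) ^ 1))) := by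
        exact mul_le_mul_of_nonneg_left (rpow_mul_lorentzian_le hl₁ h1 h2 ht hx) hc
    _ = c * t ^ ε * l₂ ^ 2 * (x ^ (ε - 1) / (l₁ ^ 2 + x ^ 2) ^ 1) := by ring

theorem abs_integral_mul_lorentzian_le {l₁ l₂ lam ε t c : ℝ} {g : ℝ → ℝ} (hl₁ : 0 < l₁)
    (h1 : l₁ ≤ lam) (h2 : lam ≤ l₂) (hε0 : 0 < ε) (hε2 : ε < 2) (ht : 0 ≤ t) (hc : 0 ≤ c)
    (hg : ∀ x > 0, |g x| ≤ c * (t * x) ^ ε) :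
    |∫ x in Set.Ioi (0 : ℝ), g x * (lam ^ 2 * x⁻¹ / (lam ^ 2 + x ^ 2))| ≤
      c * t ^ ε * (l₂ ^ 2 * ∫ x in Set.Ioi (0 : ℝ), x ^ (ε - 1) / (l₁ ^ 2 + x ^ 2) ^ 1) := by
  rw [← mul_assoc, ← integral_const_mul, ← Real.norm_eq_abs]
  refine norm_integral_le_of_norm_le (Integrable.const_mul (integrableOn_rpow_div_sq_add_sq_pow
    (n := 1) (p := ε - 1) hl₁ (by linarith) (by push_cast; linarith)) _) ?_
  exact ae_restrict_of_forall_mem measurableSet_Ioi fun x hx =>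
    norm_mul_lorentzian_le hl₁ h1 h2 ht hc hx (hg x hx)

theorem integrableOn_defectIntegrand {H lam t : ℝ} (hH0 : 0 < H) (hH1 : H < 1) (hl : 0 < lam)
    (ht : 0 < t) :
    IntegrableOn (fun x : ℝ => weightedVersine H (t * x) *
      (lam ^ 2 * x⁻¹ / (lam ^ 2 + x ^ 2))) (Set.Ioi 0) := by
  have hmeas := measurable_weightedVersine H
  refine Integrable.mono' (Integrable.const_mul (integrableOn_rpow_div_sq_add_sq_pow (n := 1)
    (p := 1 - H - 1) hl (by linarith) (by push_cast; linarith)) (2 * t ^ (1 - H) * lam ^ 2))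
    (Measurable.aestronglyMeasurable (by fun_prop)) ?_
  refine ae_restrict_of_forall_mem measurableSet_Ioi fun x hx => ?_
  have htx : 0 < t * x := mul_pos ht hx
  refine norm_mul_lorentzian_le hl le_rfl le_rfl ht.le two_pos.le hx ?_
  rw [abs_of_nonneg (weightedVersine_nonneg H htx.le)]
  exact weightedVersine_le hH0.le le_rfl hH1.le htx

theorem defectIntegral_nonneg (H lam : ℝ) {t : ℝ} (ht : 0 ≤ t) : 0 ≤ defectIntegral H lam t :=
  setIntegral_nonneg measurableSet_Ioi fun x hx => by
    have hx : 0 < x := hx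
    exact mul_nonneg (weightedVersine_nonneg H (by positivity)) (by positivity)

theorem exists_defectIntegral_bounds {h₁ h₂ l₁ l₂ : ℝ} (hh₁ : 0 < h₁) (hh₂ : h₂ < 1)
    (hl₁ : 0 < l₁) :
    ∃ C, 0 ≤ C ∧ ∀ H ∈ Set.Icc h₁ h₂, ∀ lam ∈ Set.Icc l₁ l₂, ∀ t > 0,
      defectIntegral H lam t ≤ C * t ^ (1 - h₂) ∧ ∀ H' ∈ Set.Icc h₁ h₂,
        |defectIntegral H lam t - defectIntegral H' lam t| ≤ C * t ^ (1 - h₂) * |H - H'| := by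
  set J := l₂ ^ 2 * ∫ x in Set.Ioi (0 : ℝ), x ^ (1 - h₂ - 1) / (l₁ ^ 2 + x ^ 2) ^ 1
  have hJ : 0 ≤ J := mul_nonneg (sq_nonneg _) (setIntegral_nonneg measurableSet_Ioi fun x hx => by
    have hx : 0 < x := hx
    positivity)
  have hε : 0 < 1 - h₂ := by linarith
  refine ⟨max 2 (4 / (1 - h₂)) * J, by positivity, fun H hH lam hlam t ht => ?_⟩
  have hH0 : 0 < H := hh₁.trans_le hH.1
  have hlam0 : 0 < lam := hl₁.trans_le hlam.1
  have hε2 : 1 - h₂ < 2 := by linarith [hH.2]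
  constructor
  · calc defectIntegral H lam t ≤ 2 * t ^ (1 - h₂) * J := by
          refine (le_abs_self _).trans (abs_integral_mul_lorentzian_le hl₁ hlam.1 hlam.2 hε hε2
            ht.le two_pos.le fun x hx => ?_)
          have htx : 0 < t * x := mul_pos ht hx
          rw [abs_of_nonneg (weightedVersine_nonneg H htx.le)]
          exact weightedVersine_le hH0.le hH.2 hh₂.le htx
      _ ≤ max 2 (4 / (1 - h₂)) * t ^ (1 - h₂) * J := by gcongr; exact le_max_left _ _
      _ = max 2 (4 / (1 - h₂)) * J * t ^ (1 - h₂) := by ring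
  · intro H' hH'
    have hH0' : 0 < H' := hh₁.trans_le hH'.1
    rw [defectIntegral, defectIntegral,
      ← integral_sub (integrableOn_defectIntegrand hH0 (hH.2.trans_lt hh₂) hlam0 ht)
        (integrableOn_defectIntegrand hH0' (hH'.2.trans_lt hh₂) hlam0 ht)]
    simp only [← sub_mul]
    calc _ ≤ 4 / (1 - h₂) * |H - H'| * t ^ (1 - h₂) * J := by
          refine abs_integral_mul_lorentzian_le hl₁ hlam.1 hlam.2 hε hε2 ht.le (by positivity)
            fun x hx => ?_
          rw [mul_right_comm]
          exact abs_weightedVersine_sub_le hH0.le hH.2 hH0'.le hH'.2 hh₂ (mul_pos ht hx)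
      _ ≤ max 2 (4 / (1 - h₂)) * |H - H'| * t ^ (1 - h₂) * J := by
          gcongr
          exact le_max_right _ _
      _ = max 2 (4 / (1 - h₂)) * J * t ^ (1 - h₂) * |H - H'| := by ring

theorem exists_defect_bounds {h₁ h₂ l₁ l₂ : ℝ} (hh₁ : 0 < h₁) (hh₂ : h₂ < 1) (hl₁ : 0 < l₁) :
    ∃ C, 0 ≤ C ∧ ∀ H ∈ Set.Icc h₁ h₂, ∀ lam ∈ Set.Icc l₁ l₂, ∀ t > 0,
      0 ≤ defect H lam t ∧ defect H lam t ≤ C * t ^ (1 - h₂) ∧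
      ∀ H' ∈ Set.Icc h₁ h₂, |defect H lam t - defect H' lam t| ≤ C * t ^ (1 - h₂) * |H - H'| := by
  obtain ⟨c, M, hc, hM, hcM⟩ := exists_cH_mem_Icc hh₁ hh₂
  obtain ⟨K, hK⟩ := exists_lipschitzOnWith_cH hh₁ h₂
  obtain ⟨J, hJ, hI⟩ := exists_defectIntegral_bounds (l₂ := l₂) hh₁ hh₂ hl₁
  have hcH : ∀ H ∈ Set.Icc h₁ h₂, 0 ≤ cH H := fun H hH => hc.le.trans (hcM H hH).1
  refine ⟨4 * (K + M) * J, by positivity, fun H hH lam hlam t ht => ?_⟩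
  have hI0 := defectIntegral_nonneg H lam ht.le
  obtain ⟨hle, hlip⟩ := hI H hH lam hlam t ht
  refine ⟨mul_nonneg (by linarith [hcH H hH]) hI0, ?_, fun H' hH' => ?_⟩
  · calc defect H lam t ≤ 4 * M * (J * t ^ (1 - h₂)) := by
          unfold defect
          gcongr
          exact (hcM H hH).2
      _ ≤ 4 * (K + M) * (J * t ^ (1 - h₂)) := by
          gcongr
          exact le_add_of_nonneg_left K.2
      _ = 4 * (K + M) * J * t ^ (1 - h₂) := by ring
  · have hK' : |cH H - cH H'| ≤ K * |H - H'| := hK.dist_le_mul H hH H' hH'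
    calc |defect H lam t - defect H' lam t|
        = 4 * |(cH H - cH H') * defectIntegral H lam t +
            cH H' * (defectIntegral H lam t - defectIntegral H' lam t)| := by
          have h4 (y : ℝ) : 4 * |y| = |4 * y| := by rw [abs_mul, Nat.abs_ofNat]
          rw [h4, defect, defect]
          ring_nf
      _ ≤ 4 * (|cH H - cH H'| * defectIntegral H lam t +
            cH H' * |defectIntegral H lam t - defectIntegral H' lam t|) := by
          refine mul_le_mul_of_nonneg_left ((abs_add_le _ _).trans_eq ?_) four_pos.le
          rw [abs_mul, abs_mul, abs_of_nonneg hI0, abs_of_nonneg (hcH H' hH')]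
      _ ≤ 4 * (K * |H - H'| * (J * t ^ (1 - h₂)) + M * (J * t ^ (1 - h₂) * |H - H'|)) := by
          gcongr
          · exact (hcM H' hH').2
          · exact hlip H' hH'
      _ = 4 * (K + M) * J * t ^ (1 - h₂) * |H - H'| := by ring

theorem rpow_mul_defectIntegral {H lam t : ℝ} (hH0 : 0 < H) (hH1 : H < 1) (hl : 0 < lam)
    (ht : 0 < t) :
    t ^ (2 * H) * defectIntegral H lam t =
      (∫ x in Set.Ioi (0 : ℝ), (1 - Real.cos (t * x)) * x ^ (-1 - 2 * H)) -
      ((∫ x in Set.Ioi (0 : ℝ), Real.cos (0 * x) * spectralDensity H lam x) -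
        ∫ x in Set.Ioi (0 : ℝ), Real.cos (t * x) * spectralDensity H lam x) := by
  have hint := integrableOn_cos_mul_spectralDensity hH0 hH1 hl
  have hdiff : IntegrableOn (fun x => Real.cos (0 * x) * spectralDensity H lam x -
      Real.cos (t * x) * spectralDensity H lam x) (Set.Ioi 0) := (hint 0).sub (hint t)
  rw [← integral_sub (hint 0) (hint t),
    ← integral_sub (integrableOn_one_sub_cos hH0 hH1 t) hdiff, defectIntegral,
    ← integral_const_mul]
  refine setIntegral_congr_fun measurableSet_Ioi fun x (hx : 0 < x) => ?_
  have hscale : t ^ (2 * H) * (t * x) ^ (-(2 * H)) = x ^ (-(2 * H)) := by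
    rw [Real.mul_rpow ht.le hx.le, ← mul_assoc, ← Real.rpow_add ht, add_neg_cancel,
      Real.rpow_zero, one_mul]
  have hlow : x ^ (-1 - 2 * H) = x ^ (-(2 * H)) * x⁻¹ := by
    rw [show -1 - 2 * H = -(2 * H) - 1 by ring, Real.rpow_sub_one hx.ne', div_eq_mul_inv]
  have hhigh : x ^ (1 - 2 * H) = x ^ (-(2 * H)) * x := by
    rw [show 1 - 2 * H = -(2 * H) + 1 by ring, Real.rpow_add_one hx.ne']
  calc t ^ (2 * H) * (weightedVersine H (t * x) * (lam ^ 2 * x⁻¹ / (lam ^ 2 + x ^ 2)))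
      = (1 - Real.cos (t * x)) * x ^ (-(2 * H)) * (lam ^ 2 * x⁻¹ / (lam ^ 2 + x ^ 2)) := by
        rw [← hscale, weightedVersine]
        ring
    _ = (1 - Real.cos (t * x)) * x ^ (-1 - 2 * H) - (Real.cos (0 * x) * spectralDensity H lam x -
          Real.cos (t * x) * spectralDensity H lam x) := by
        rw [hlow, spectralDensity, hhigh, zero_mul, Real.cos_zero]
        field_simp
        ring

/-- The semivariogram `t ↦ E[(X t - X 0) ^ 2] / 2` of a stationary fractional Ornstein-Uhlenbeck
process, in terms of its autocovariance. -/
noncomputable def semivariogram (θ : Param) (t : ℝ) : ℝ := rho θ 0 - rho θ t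

theorem semivariogram_eq {θ : Param} (hH0 : 0 < θ 0) (hH1 : θ 0 < 1) (hl : 0 < θ 1) {t : ℝ}
    (ht : 0 < t) :
    semivariogram θ t = θ 2 ^ 2 / 2 * t ^ (2 * θ 0) * (1 - defect (θ 0) (θ 1) t) := by
  have hfbm := abs_rpow_eq_integral hH0 hH1 t
  rw [abs_of_pos ht] at hfbm
  rw [semivariogram, rho_eq, rho_eq, defect]
  linear_combination θ 2 ^ 2 / 2 * (4 * cH (θ 0) * rpow_mul_defectIntegral hH0 hH1 hl ht - hfbm)

theorem abs_one_sub_cos_sub_half_sq_le {h z : ℝ} (hh : 0 ≤ h) (hh2 : h ≤ 2) (hz : 0 < z) :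
    |1 - Real.cos z - z ^ 2 / 2| ≤ z ^ 2 * z ^ h := by
  have hz2 : 0 < z ^ 2 := by positivity
  rcases le_total z 1 with h1 | h1
  · have hcos := Real.cos_bound (x := z) (by rwa [abs_of_pos hz])
    have hpow : z ^ 2 ≤ z ^ h := by
      rw [← Real.rpow_two]
      exact Real.rpow_le_rpow_of_exponent_ge hz h1 hh2
    calc |1 - Real.cos z - z ^ 2 / 2| = |Real.cos z - (1 - z ^ 2 / 2)| := by
          rw [← abs_neg]
          ring_nf
      _ ≤ z ^ 2 * z ^ 2 := by
          rw [abs_of_pos hz] at hcos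
          linarith [mul_pos hz2 hz2]
      _ ≤ z ^ 2 * z ^ h := by gcongr
  · have hpow : z ^ 2 * 1 ≤ z ^ 2 * z ^ h := by
      gcongr
      exact Real.one_le_rpow h1 hh
    rw [abs_le]
    constructor <;> linarith [Real.cos_le_one z, Real.one_sub_sq_div_two_le_cos (x := z)]

theorem rpow_le_one_add_rpow {x p q : ℝ} (hx : 0 ≤ x) (hp : 0 ≤ p) (hpq : p ≤ q) :
    x ^ p ≤ 1 + x ^ q := by
  rcases le_total x 1 with h | h
  · linarith [Real.rpow_le_one hx h hp, Real.rpow_nonneg hx q]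
  · linarith [Real.rpow_le_rpow_of_exponent_le h hpq]

/-- The moment of order `q` of the product of two Lorentzian densities. Its value at `3 - 2 * H` is
the leading coefficient, for small times, of a difference of two values of `defect H`. -/
noncomputable def lorentzianMoment (lam lam' q : ℝ) : ℝ :=
  ∫ x in Set.Ioi (0 : ℝ), x ^ q / ((lam ^ 2 + x ^ 2) * (lam' ^ 2 + x ^ 2))

theorem rpow_div_mul_le {l₁ lam lam' q r x : ℝ} (hl₁ : 0 < l₁) (h : l₁ ≤ lam) (h' : l₁ ≤ lam')
    (hq : 0 ≤ q) (hqr : q ≤ r) (hx : 0 < x) :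
    x ^ q / ((lam ^ 2 + x ^ 2) * (lam' ^ 2 + x ^ 2)) ≤
      x ^ (0 : ℝ) / (l₁ ^ 2 + x ^ 2) ^ 2 + x ^ r / (l₁ ^ 2 + x ^ 2) ^ 2 := by
  rw [← add_div, Real.rpow_zero]
  gcongr
  · exact rpow_le_one_add_rpow hx.le hq hqr
  · rw [sq (l₁ ^ 2 + x ^ 2)]
    gcongr

theorem integrableOn_rpow_div_add_rpow_div {l r : ℝ} (hl : 0 < l) (hr : 0 ≤ r) (hr' : r < 3) :
    IntegrableOn (fun x : ℝ => x ^ (0 : ℝ) / (l ^ 2 + x ^ 2) ^ 2 + x ^ r / (l ^ 2 + x ^ 2) ^ 2)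
      (Set.Ioi 0) :=
  (integrableOn_rpow_div_sq_add_sq_pow hl (by norm_num) (by norm_num)).add
    (integrableOn_rpow_div_sq_add_sq_pow hl (by linarith) (by push_cast; linarith))

theorem integrableOn_lorentzianMoment {lam lam' q : ℝ} (hl : 0 < lam) (hl' : 0 < lam')
    (hq : 0 ≤ q) (hq' : q < 3) :
    IntegrableOn (fun x : ℝ => x ^ q / ((lam ^ 2 + x ^ 2) * (lam' ^ 2 + x ^ 2))) (Set.Ioi 0) := by
  refine Integrable.mono' (integrableOn_rpow_div_add_rpow_div (lt_min hl hl') hq hq')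
    (Measurable.aestronglyMeasurable (by fun_prop)) ?_
  refine ae_restrict_of_forall_mem measurableSet_Ioi fun x (hx : 0 < x) => ?_
  rw [Real.norm_of_nonneg (by positivity)]
  exact rpow_div_mul_le (lt_min hl hl') (min_le_left _ _) (min_le_right _ _) hq le_rfl hx

theorem exists_lorentzianMoment_le {l₁ r : ℝ} (hl₁ : 0 < l₁) (hr : 0 ≤ r) (hr' : r < 3) :
    ∃ J, 0 ≤ J ∧ ∀ lam ≥ l₁, ∀ lam' ≥ l₁, ∀ q ∈ Set.Icc 0 r, lorentzianMoment lam lam' q ≤ J := by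
  refine ⟨_, setIntegral_nonneg measurableSet_Ioi fun x (hx : 0 < x) => ?_,
    fun lam hlam lam' hlam' q hq => setIntegral_mono_on (integrableOn_lorentzianMoment
      (hl₁.trans_le hlam) (hl₁.trans_le hlam') hq.1 (hq.2.trans_lt hr'))
      (integrableOn_rpow_div_add_rpow_div hl₁ hr hr') measurableSet_Ioi
      fun x hx => rpow_div_mul_le hl₁ hlam hlam' hq.1 hq.2 hx⟩
  positivity

theorem le_lorentzianMoment {lam lam' l₂ q : ℝ} (hl : 0 < lam) (h : lam ≤ l₂) (hl' : 0 < lam')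
    (h' : lam' ≤ l₂) (hq : 0 ≤ q) (hq' : q < 3) :
    ((l₂ ^ 2 + 4) ^ 2)⁻¹ ≤ lorentzianMoment lam lam' q := by
  have hint := integrableOn_lorentzianMoment hl hl' hq hq'
  have hsub : Set.Ioc (1 : ℝ) 2 ⊆ Set.Ioi 0 := fun x hx => one_pos.trans hx.1
  calc ((l₂ ^ 2 + 4) ^ 2)⁻¹ = ∫ _x in Set.Ioc (1 : ℝ) 2, ((l₂ ^ 2 + 4) ^ 2)⁻¹ := by
        rw [setIntegral_const, Real.volume_real_Ioc]
        norm_num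
    _ ≤ ∫ x in Set.Ioc (1 : ℝ) 2, x ^ q / ((lam ^ 2 + x ^ 2) * (lam' ^ 2 + x ^ 2)) := by
        refine setIntegral_mono_on (by simp) (hint.mono_set hsub) measurableSet_Ioc fun x hx => ?_
        have hx0 : 0 < x := hsub hx
        have hx2 : x ^ 2 ≤ 4 := by nlinarith [hx.2]
        rw [inv_eq_one_div, sq (l₂ ^ 2 + 4)]
        gcongr
        exact Real.one_le_rpow hx.1.le hq
    _ ≤ lorentzianMoment lam lam' q := by
        refine setIntegral_mono_set hint ?_ (LE.le.eventuallyLE hsub)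
        refine ae_restrict_of_forall_mem measurableSet_Ioi fun x (hx : 0 < x) => ?_
        simp only [Pi.zero_apply]
        positivity

theorem defect_sub_defect {H lam lam' t : ℝ} (hH0 : 0 < H) (hH1 : H < 1) (hl : 0 < lam)
    (hl' : 0 < lam') (ht : 0 < t) :
    defect H lam' t - defect H lam t = 4 * cH H * (lam' ^ 2 - lam ^ 2) *
      ∫ x in Set.Ioi (0 : ℝ), weightedVersine H (t * x) *
        (x / ((lam ^ 2 + x ^ 2) * (lam' ^ 2 + x ^ 2))) := by
  unfold defect defectIntegral
  rw [← mul_sub, ← integral_sub (integrableOn_defectIntegrand hH0 hH1 hl' ht)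
    (integrableOn_defectIntegrand hH0 hH1 hl ht), mul_assoc (4 * cH H) (lam' ^ 2 - lam ^ 2),
    ← integral_const_mul (lam' ^ 2 - lam ^ 2)]
  refine congrArg (4 * cH H * ·) (setIntegral_congr_fun measurableSet_Ioi fun x (hx : 0 < x) => ?_)
  field_simp
  ring

theorem abs_weightedVersine_mul_sub_le {H h t w x : ℝ} (hh : 0 ≤ h) (hh2 : h ≤ 2) (ht : 0 < t)
    (hx : 0 < x) (hw : 0 ≤ w) :
    |weightedVersine H (t * x) * (x / w) - t ^ (2 - 2 * H) / 2 * (x ^ (3 - 2 * H) / w)| ≤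
      t ^ h * t ^ (2 - 2 * H) * (x ^ (3 - 2 * H + h) / w) := by
  have hz : 0 < t * x := mul_pos ht hx
  have hpow : (t * x) ^ 2 * (t * x) ^ (-(2 * H)) * x = t ^ (2 - 2 * H) * x ^ (3 - 2 * H) := by
    rw [← Real.rpow_two, ← Real.rpow_add hz, Real.mul_rpow ht.le hx.le,
      show 3 - 2 * H = 2 + -(2 * H) + 1 by ring, Real.rpow_add_one hx.ne', ← sub_eq_add_neg]
    ring
  calc |weightedVersine H (t * x) * (x / w) - t ^ (2 - 2 * H) / 2 * (x ^ (3 - 2 * H) / w)|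
      = |1 - Real.cos (t * x) - (t * x) ^ 2 / 2| * ((t * x) ^ (-(2 * H)) * (x / w)) := by
        rw [← abs_of_nonneg (by positivity : 0 ≤ (t * x) ^ (-(2 * H)) * (x / w)), ← abs_mul,
          weightedVersine]
        congr 1
        linear_combination (1 / 2 / w) * hpow
    _ ≤ (t * x) ^ 2 * (t * x) ^ h * ((t * x) ^ (-(2 * H)) * (x / w)) := by
        gcongr
        exact abs_one_sub_cos_sub_half_sq_le hh hh2 hz
    _ = (t * x) ^ 2 * (t * x) ^ (-(2 * H)) * x * (t * x) ^ h / w := by ring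
    _ = t ^ h * t ^ (2 - 2 * H) * (x ^ (3 - 2 * H + h) / w) := by
        rw [hpow, Real.mul_rpow ht.le hx.le, Real.rpow_add hx (3 - 2 * H)]
        ring

theorem abs_integral_weightedVersine_sub_le {H h lam lam' t : ℝ} (hH : H ≤ 1) (hh : 0 ≤ h)
    (hhH : h < 2 * H) (hl : 0 < lam) (hl' : 0 < lam') (ht : 0 < t) :
    |(∫ x in Set.Ioi (0 : ℝ), weightedVersine H (t * x) *
        (x / ((lam ^ 2 + x ^ 2) * (lam' ^ 2 + x ^ 2)))) -
      t ^ (2 - 2 * H) / 2 * lorentzianMoment lam lam' (3 - 2 * H)| ≤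
      t ^ h * t ^ (2 - 2 * H) * lorentzianMoment lam lam' (3 - 2 * H + h) := by
  have hmain := (integrableOn_lorentzianMoment hl hl' (by linarith : 0 ≤ 3 - 2 * H)
    (by linarith)).const_mul (t ^ (2 - 2 * H) / 2)
  have hrem := (integrableOn_lorentzianMoment hl hl' (by linarith : 0 ≤ 3 - 2 * H + h)
    (by linarith)).const_mul (t ^ h * t ^ (2 - 2 * H))
  have hle : ∀ᵐ x ∂volume.restrict (Set.Ioi (0 : ℝ)),
      ‖weightedVersine H (t * x) * (x / ((lam ^ 2 + x ^ 2) * (lam' ^ 2 + x ^ 2))) -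
        t ^ (2 - 2 * H) / 2 * (x ^ (3 - 2 * H) / ((lam ^ 2 + x ^ 2) * (lam' ^ 2 + x ^ 2)))‖ ≤
        t ^ h * t ^ (2 - 2 * H) *
          (x ^ (3 - 2 * H + h) / ((lam ^ 2 + x ^ 2) * (lam' ^ 2 + x ^ 2))) :=
    ae_restrict_of_forall_mem measurableSet_Ioi fun x hx =>
      abs_weightedVersine_mul_sub_le hh (by linarith) ht hx (by positivity)
  have hmeas := measurable_weightedVersine H
  have hint : IntegrableOn (fun x : ℝ => weightedVersine H (t * x) *
      (x / ((lam ^ 2 + x ^ 2) * (lam' ^ 2 + x ^ 2)))) (Set.Ioi 0) := by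
    refine ((hrem.mono' (Measurable.aestronglyMeasurable (by fun_prop)) hle).add hmain).congr ?_
    exact ae_of_all _ fun x => sub_add_cancel _ _
  rw [lorentzianMoment, lorentzianMoment, ← integral_const_mul, ← integral_const_mul,
    ← integral_sub hint hmain, ← Real.norm_eq_abs]
  exact norm_integral_le_of_norm_le hrem hle

theorem abs_defect_sub_defect_sub_le {H h lam lam' t : ℝ} (hH : 0 < H) (hH1 : H < 1) (hh : 0 ≤ h)
    (hhH : h < 2 * H) (hl : 0 < lam) (hl' : 0 < lam') (ht : 0 < t) :
    |defect H lam' t - defect H lam t -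
        2 * cH H * (lam' ^ 2 - lam ^ 2) * lorentzianMoment lam lam' (3 - 2 * H) *
          t ^ (2 - 2 * H)| ≤
      4 * cH H * |lam' ^ 2 - lam ^ 2| *
        (t ^ h * t ^ (2 - 2 * H) * lorentzianMoment lam lam' (3 - 2 * H + h)) := by
  have hcH : 0 < cH H := cH_pos hH hH1
  rw [defect_sub_defect hH hH1 hl hl' ht]
  calc _ = 4 * cH H * |lam' ^ 2 - lam ^ 2| * |(∫ x in Set.Ioi (0 : ℝ),
          weightedVersine H (t * x) * (x / ((lam ^ 2 + x ^ 2) * (lam' ^ 2 + x ^ 2)))) -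
          t ^ (2 - 2 * H) / 2 * lorentzianMoment lam lam' (3 - 2 * H)| := by
        rw [← abs_of_pos (by positivity : 0 < 4 * cH H), ← abs_mul, ← abs_mul,
          abs_of_pos (by positivity : 0 < 4 * cH H)]
        ring_nf
    _ ≤ _ := by
        gcongr
        exact abs_integral_weightedVersine_sub_le hH1.le hh hhH hl hl' ht

theorem abs_sq_sub_sq_bounds {l₁ l₂ x y : ℝ} (hl₁ : 0 ≤ l₁) (hx : x ∈ Set.Icc l₁ l₂)
    (hy : y ∈ Set.Icc l₁ l₂) :
    2 * l₁ * |y - x| ≤ |y ^ 2 - x ^ 2| ∧ |y ^ 2 - x ^ 2| ≤ 2 * l₂ * |y - x| := by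
  rw [sq_sub_sq, abs_mul, abs_of_nonneg (by linarith [hx.1, hy.1] : 0 ≤ y + x)]
  constructor <;> gcongr <;> linarith [hx.1, hx.2, hy.1, hy.2]

theorem exists_defect_sub_defect_expansion {h₁ h₂ l₁ l₂ : ℝ} (hh₁ : 0 < h₁) (hh₂ : h₂ < 1)
    (hl₁ : 0 < l₁) :
    ∃ d E : ℝ, 0 < d ∧ 0 ≤ E ∧
      ∀ H ∈ Set.Icc h₁ h₂, ∀ lam ∈ Set.Icc l₁ l₂, ∀ lam' ∈ Set.Icc l₁ l₂, ∃ p : ℝ,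
        d * |lam' - lam| ≤ |p| ∧ ∀ t > 0,
          |defect H lam' t - defect H lam t - p * t ^ (2 - 2 * H)| ≤
            E * t ^ h₁ * t ^ (2 - 2 * H) * |lam' - lam| := by
  obtain ⟨c, M, hc, hM, hcM⟩ := exists_cH_mem_Icc hh₁ hh₂
  obtain ⟨J, hJ, hmoment⟩ := exists_lorentzianMoment_le (r := 3 - min h₁ 1) hl₁
    (by linarith [min_le_right h₁ 1]) (by linarith [lt_min hh₁ one_pos])
  refine ⟨2 * c * (2 * l₁) * ((l₂ ^ 2 + 4) ^ 2)⁻¹, 4 * M * (2 * |l₂|) * J,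
    by positivity, by positivity, fun H hH lam hlam lam' hlam' => ?_⟩
  have hl : 0 < lam := hl₁.trans_le hlam.1
  have hl' : 0 < lam' := hl₁.trans_le hlam'.1
  have hH0 : 0 < H := hh₁.trans_le hH.1
  have hH1 : H < 1 := hH.2.trans_lt hh₂
  have hcH : 0 < cH H := hc.trans_le (hcM H hH).1
  have hmin : min h₁ 1 = h₁ := min_eq_left (hH.1.trans hH1.le)
  rw [hmin] at hmoment
  have hl₂ : 0 < l₂ := hl.trans_le hlam.2
  rw [abs_of_pos hl₂]
  have hmomentLow : ((l₂ ^ 2 + 4) ^ 2)⁻¹ ≤ lorentzianMoment lam lam' (3 - 2 * H) :=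
    le_lorentzianMoment hl hlam.2 hl' hlam'.2 (by linarith) (by linarith)
  have hmomentPos : 0 < lorentzianMoment lam lam' (3 - 2 * H) :=
    hmomentLow.trans_lt' (by positivity)
  obtain ⟨hsqLow, hsqUp⟩ := abs_sq_sub_sq_bounds hl₁.le hlam hlam'
  have habs : |2 * cH H * (lam' ^ 2 - lam ^ 2) * lorentzianMoment lam lam' (3 - 2 * H)| =
      2 * cH H * |lam' ^ 2 - lam ^ 2| * lorentzianMoment lam lam' (3 - 2 * H) := by
    rw [abs_mul, abs_mul, abs_of_pos hmomentPos, abs_of_pos (by positivity : 0 < 2 * cH H)]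
  refine ⟨2 * cH H * (lam' ^ 2 - lam ^ 2) * lorentzianMoment lam lam' (3 - 2 * H), ?_,
    fun t ht => ?_⟩
  · calc _ = 2 * c * (2 * l₁ * |lam' - lam|) * ((l₂ ^ 2 + 4) ^ 2)⁻¹ := by ring
      _ ≤ _ := by
        rw [habs]
        gcongr
        exact (hcM H hH).1
  · calc _ ≤ 4 * cH H * |lam' ^ 2 - lam ^ 2| *
          (t ^ h₁ * t ^ (2 - 2 * H) * lorentzianMoment lam lam' (3 - 2 * H + h₁)) :=
          abs_defect_sub_defect_sub_le hH0 hH1 hh₁.le (by linarith [hH.1]) hl hl' ht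
      _ ≤ 4 * cH H * |lam' ^ 2 - lam ^ 2| * (t ^ h₁ * t ^ (2 - 2 * H) * J) := by
          gcongr
          exact hmoment lam hlam.1 lam' hlam'.1 _ ⟨by linarith, by linarith [hH.1]⟩
      _ ≤ 4 * M * (2 * l₂ * |lam' - lam|) * (t ^ h₁ * t ^ (2 - 2 * H) * J) := by
          gcongr
          exact (hcM H hH).2
      _ = _ := by ring

/-! ### Identification of the parameter from three lags -/

theorem abs_log_sub_log_le {a b m : ℝ} (hm : 0 < m) (ha : m ≤ a) (hb : m ≤ b) :
    |Real.log a - Real.log b| ≤ m⁻¹ * |a - b| := by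
  wlog h : b ≤ a generalizing a b
  · rw [abs_sub_comm, abs_sub_comm a]
    exact this hb ha (le_of_not_ge h)
  have hb0 : 0 < b := hm.trans_le hb
  have ha0 : 0 < a := hm.trans_le ha
  have hab : 0 ≤ a - b := sub_nonneg.mpr h
  rw [abs_of_nonneg (sub_nonneg.mpr (Real.log_le_log hb0 h)), abs_of_nonneg hab,
    ← Real.log_div ha0.ne' hb0.ne']
  calc Real.log (a / b) ≤ a / b - 1 := Real.log_le_sub_one_of_pos (by positivity)
    _ = b⁻¹ * (a - b) := by field_simp
    _ ≤ m⁻¹ * (a - b) := by gcongr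

theorem abs_log_one_sub_sub_log_one_sub_sub_le {b c M : ℝ} (hb : 0 ≤ b) (hc : 0 ≤ c)
    (hbM : b ≤ M) (hcM : c ≤ M) (hM : M ≤ 1 / 2) :
    |Real.log (1 - b) - Real.log (1 - c) - (c - b)| ≤ 2 * M * |c - b| := by
  have h1b : 0 < 1 - b := by linarith
  have h1c : 0 < 1 - c := by linarith
  have hratio (u : ℝ) (hu : 0 ≤ u) (huM : u ≤ M) : |(c - b) * (u / (1 - u))| ≤ 2 * M * |c - b| := by
    have h1u : 0 < 1 - u := by linarith
    rw [abs_mul, abs_of_nonneg (div_nonneg hu h1u.le), mul_comm]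
    gcongr
    rw [div_le_iff₀ h1u]
    nlinarith
  have hup : Real.log ((1 - b) / (1 - c)) - (c - b) ≤ (c - b) * (c / (1 - c)) := by
    have heq : (1 - b) / (1 - c) - 1 - (c - b) = (c - b) * (c / (1 - c)) := by
      field_simp
      ring
    linarith [Real.log_le_sub_one_of_pos (div_pos h1b h1c)]
  have hlow : (c - b) * (b / (1 - b)) ≤ Real.log ((1 - b) / (1 - c)) - (c - b) := by
    have heq : 1 - ((1 - b) / (1 - c))⁻¹ - (c - b) = (c - b) * (b / (1 - b)) := by
      field_simp
      ring
    linarith [Real.one_sub_inv_le_log_of_pos (div_pos h1b h1c)]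
  rw [← Real.log_div h1b.ne' h1c.ne']
  exact abs_le.mpr ⟨(neg_le_of_abs_le (hratio b hb hbM)).trans hlow,
    hup.trans (le_of_abs_le (hratio c hc hcM))⟩

theorem abs_log_one_sub_sub_log_one_sub_add_le {a b c P M m δ : ℝ} (ha : a ∈ Set.Icc 0 M)
    (hb : b ∈ Set.Icc 0 M) (hc : c ∈ Set.Icc 0 M) (hM : M ≤ 1 / 2) (hab : |a - b| ≤ M * m)
    (hbc : |b - c - P| ≤ δ * |P|) (hδ : δ ≤ 1) :
    |Real.log (1 - a) - Real.log (1 - c) + P| ≤ 2 * M * m + (4 * M + δ) * |P| := by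
  have hM0 : 0 ≤ M := ha.1.trans ha.2
  have hcb : |c - b| ≤ 2 * |P| := by
    rw [abs_sub_comm]
    have hδP : δ * |P| ≤ 1 * |P| := by gcongr
    linarith [abs_sub_abs_le_abs_sub (b - c) P]
  have hlog_ab : |Real.log (1 - a) - Real.log (1 - b)| ≤ 2 * (M * m) := by
    refine (abs_log_sub_log_le (m := 1 / 2) (by norm_num) (by linarith [ha.2])
      (by linarith [hb.2])).trans ?_
    rw [sub_sub_sub_cancel_left, abs_sub_comm b]
    linarith
  have hlog_bc : |Real.log (1 - b) - Real.log (1 - c) - (c - b)| ≤ 2 * M * (2 * |P|) :=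
    (abs_log_one_sub_sub_log_one_sub_sub_le hb.1 hc.1 hb.2 hc.2 hM).trans (by gcongr)
  calc _ = |(Real.log (1 - a) - Real.log (1 - b)) +
          (Real.log (1 - b) - Real.log (1 - c) - (c - b)) - (b - c - P)| := by ring_nf
    _ ≤ 2 * (M * m) + 2 * M * (2 * |P|) + δ * |P| :=
        (abs_sub _ _).trans (add_le_add ((abs_add_le _ _).trans (add_le_add hlog_ab hlog_bc)) hbc)
    _ = 2 * M * m + (4 * M + δ) * |P| := by ring

theorem log_three_mul_lt {β : ℝ} (hβ : 0 < β) :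
    Real.log 3 * ((2 : ℝ) ^ β - 1) < Real.log 2 * ((3 : ℝ) ^ β - 1) := by
  have : 0 < Real.log 2 := Real.log_pos (by norm_num)
  have : 0 < Real.log 3 := Real.log_pos (by norm_num)
  have h23 : Real.log 2 < Real.log 3 := Real.log_lt_log (by norm_num) (by norm_num)
  -- the slopes of the secants of `exp` from `0` to `log 2 * β` and to `log 3 * β`
  have hslope := strictConvexOn_exp.secant_strict_mono (a := 0) (x := Real.log 2 * β)
    (y := Real.log 3 * β) (Set.mem_univ _) (Set.mem_univ _) (Set.mem_univ _) (by positivity)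
    (by positivity) (mul_lt_mul_of_pos_right h23 hβ)
  rw [← Real.rpow_def_of_pos (by norm_num), ← Real.rpow_def_of_pos (by norm_num), Real.exp_zero,
    sub_zero, sub_zero, div_lt_div_iff₀ (by positivity) (by positivity)] at hslope
  refine lt_of_mul_lt_mul_right ?_ hβ.le
  linarith

theorem exists_pos_le_of_rpow {b₁ b₂ : ℝ} (hb : 0 < b₁) :
    ∃ κ > 0, ∀ β ∈ Set.Icc b₁ b₂,
      κ ≤ Real.log 2 * ((3 : ℝ) ^ β - 1) - Real.log 3 * ((2 : ℝ) ^ β - 1) := by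
  rcases Set.eq_empty_or_nonempty (Set.Icc b₁ b₂) with hempty | hne
  · exact ⟨1, one_pos, by simp [hempty]⟩
  have hcont : Continuous fun β : ℝ =>
      Real.log 2 * ((3 : ℝ) ^ β - 1) - Real.log 3 * ((2 : ℝ) ^ β - 1) := by
    have h3 : Continuous fun β : ℝ => (3 : ℝ) ^ β := Real.continuous_const_rpow (by norm_num)
    have h2 : Continuous fun β : ℝ => (2 : ℝ) ^ β := Real.continuous_const_rpow (by norm_num)
    fun_prop
  obtain ⟨β₀, hβ₀, hmin⟩ := isCompact_Icc.exists_isMinOn hne hcont.continuousOn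
  exact ⟨_, sub_pos.mpr (log_three_mul_lt (hb.trans_le hβ₀.1)), fun β hβ => hmin hβ⟩

theorem rpow_le_three_rpow {k β b₂ : ℝ} (hk : 0 ≤ k) (hk3 : k ≤ 3) (hβ : 0 ≤ β) (hβ' : β ≤ b₂) :
    k ^ β ≤ 3 ^ b₂ :=
  (Real.rpow_le_rpow hk hk3 hβ).trans (Real.rpow_le_rpow_of_exponent_le (by norm_num) hβ')

theorem abs_log_mul_sub_sub_log_mul_sub_le (v₁ v₂ v₃ : ℝ) :
    |Real.log 2 * (v₃ - v₁) - Real.log 3 * (v₂ - v₁)| ≤ 3 * (|v₁| + |v₂| + |v₃|) := by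
  have hlog2 : 0 ≤ Real.log 2 := Real.log_nonneg (by norm_num)
  have hlog2' : Real.log 2 ≤ 1 := by linarith [Real.log_two_lt_d9]
  have hlog3 : 0 ≤ Real.log 3 := Real.log_nonneg (by norm_num)
  have hlog3' : Real.log 3 ≤ 2 := by linarith [Real.log_le_sub_one_of_pos (x := 3) (by norm_num)]
  calc _ ≤ Real.log 2 * |v₃ - v₁| + Real.log 3 * |v₂ - v₁| := by
        refine (abs_sub _ _).trans_eq ?_
        rw [abs_mul, abs_mul, abs_of_nonneg hlog2, abs_of_nonneg hlog3]
    _ ≤ 1 * (|v₃| + |v₁|) + 2 * (|v₂| + |v₁|) := by gcongr <;> exact abs_sub _ _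
    _ ≤ 3 * (|v₁| + |v₂| + |v₃|) := by linarith [abs_nonneg v₂, abs_nonneg v₃]

theorem exists_abs_add_le_sum_abs_log_rpow {b₁ b₂ : ℝ} (hb : 0 < b₁) :
    ∃ C > 0, ∀ β ∈ Set.Icc b₁ b₂, ∀ Λ m P : ℝ,
      |Λ| + |m| + |P| ≤ C * ∑ k ∈ Finset.Icc (1 : ℕ) 3, |Λ + 2 * m * Real.log k + P * k ^ β| := by
  obtain ⟨κ, hκ, hκle⟩ := exists_pos_le_of_rpow (b₂ := b₂) hb
  have hlog2 : 1 ≤ 2 * Real.log 2 := by linarith [Real.log_two_gt_d9]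
  refine ⟨2 + (2 + 3 ^ b₂) * (κ⁻¹ * 3), by positivity, fun β hβ Λ m P => ?_⟩
  have hpow1 : (1 : ℝ) ≤ 2 ^ β := Real.one_le_rpow (by norm_num) (hb.trans_le hβ.1).le
  have hpow2 : (2 : ℝ) ^ β ≤ 3 ^ b₂ :=
    rpow_le_three_rpow two_pos.le (by norm_num) (hb.trans_le hβ.1).le hβ.2
  have hsum : ∑ k ∈ Finset.Icc (1 : ℕ) 3, |Λ + 2 * m * Real.log k + P * k ^ β| =
      |Λ + P| + |Λ + 2 * m * Real.log 2 + P * 2 ^ β| + |Λ + 2 * m * Real.log 3 + P * 3 ^ β| := by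
    simp [Finset.sum_Icc_succ_top]
  rw [hsum]
  set v₁ := Λ + P with hv₁
  set v₂ := Λ + 2 * m * Real.log 2 + P * 2 ^ β with hv₂
  set v₃ := Λ + 2 * m * Real.log 3 + P * 3 ^ β with hv₃
  have hP : |P| ≤ κ⁻¹ * 3 * (|v₁| + |v₂| + |v₃|) := by
    rw [mul_assoc, inv_mul_eq_div, le_div_iff₀ hκ]
    calc |P| * κ ≤ |P| * (Real.log 2 * ((3 : ℝ) ^ β - 1) - Real.log 3 * ((2 : ℝ) ^ β - 1)) :=
          mul_le_mul_of_nonneg_left (hκle β hβ) (abs_nonneg P)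
      _ = |Real.log 2 * (v₃ - v₁) - Real.log 3 * (v₂ - v₁)| := by
          rw [← abs_of_pos (hκ.trans_le (hκle β hβ)), ← abs_mul, hv₁, hv₂, hv₃]
          ring_nf
      _ ≤ _ := abs_log_mul_sub_sub_log_mul_sub_le v₁ v₂ v₃
  have hm : |m| ≤ |v₁| + |v₂| + 3 ^ b₂ * |P| := by
    calc |m| ≤ |m| * (2 * Real.log 2) := le_mul_of_one_le_right (abs_nonneg m) hlog2
      _ = |v₂ - v₁ - P * (2 ^ β - 1)| := by
          rw [← abs_of_nonneg (by linarith : 0 ≤ 2 * Real.log 2), ← abs_mul, hv₁, hv₂]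
          ring_nf
      _ ≤ |v₂| + |v₁| + |P| * (2 ^ β - 1) := by
          refine (abs_sub _ _).trans (add_le_add (abs_sub _ _) ?_)
          rw [abs_mul, abs_of_nonneg (by linarith : 0 ≤ (2 : ℝ) ^ β - 1)]
      _ ≤ |v₂| + |v₁| + |P| * 3 ^ b₂ := by
          gcongr
          linarith
      _ = |v₁| + |v₂| + 3 ^ b₂ * |P| := by ring
  have hΛ : |Λ| ≤ |v₁| + |P| := by
    rw [show Λ = v₁ - P by rw [hv₁]; ring]
    exact abs_sub _ _
  calc |Λ| + |m| + |P| ≤ 2 * (|v₁| + |v₂| + |v₃|) + (2 + 3 ^ b₂) * |P| := by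
        linarith [abs_nonneg v₂, abs_nonneg v₃]
    _ ≤ 2 * (|v₁| + |v₂| + |v₃|) + (2 + 3 ^ b₂) * (κ⁻¹ * 3 * (|v₁| + |v₂| + |v₃|)) := by gcongr
    _ = (2 + (2 + 3 ^ b₂) * (κ⁻¹ * 3)) * (|v₁| + |v₂| + |v₃|) := by ring

theorem exists_abs_add_le_sum_abs_of_perturbation {b₁ b₂ : ℝ} (hb : 0 < b₁) :
    ∃ C > 0, ∃ ε > 0, ∀ β ∈ Set.Icc b₁ b₂, ∀ (Λ m P : ℝ) (w : ℕ → ℝ),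
      (∀ k ∈ Finset.Icc (1 : ℕ) 3,
        |w k - (Λ + 2 * m * Real.log k + P * k ^ β)| ≤ ε * (|m| + |P| * k ^ β)) →
      |Λ| + |m| + |P| ≤ C * ∑ k ∈ Finset.Icc (1 : ℕ) 3, |w k| := by
  obtain ⟨C, hC, hstable⟩ := exists_abs_add_le_sum_abs_log_rpow (b₂ := b₂) hb
  refine ⟨2 * C, by positivity, (6 * C * (1 + 3 ^ b₂))⁻¹, by positivity,
    fun β hβ Λ m P w hw => ?_⟩
  set N := |Λ| + |m| + |P|
  have herror (k : ℕ) (hk : k ∈ Finset.Icc 1 3) :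
      |w k - (Λ + 2 * m * Real.log k + P * k ^ β)| ≤ (6 * C)⁻¹ * N := by
    have hk3 : (k : ℝ) ^ β ≤ 3 ^ b₂ := rpow_le_three_rpow k.cast_nonneg
      (by exact_mod_cast (Finset.mem_Icc.mp hk).2) (hb.trans_le hβ.1).le hβ.2
    calc _ ≤ (6 * C * (1 + 3 ^ b₂))⁻¹ * (|m| + |P| * k ^ β) := hw k hk
      _ ≤ (6 * C * (1 + 3 ^ b₂))⁻¹ * ((1 + 3 ^ b₂) * N) := by
          gcongr
          have hcross : 0 ≤ (3 : ℝ) ^ b₂ * (|Λ| + |m|) := by positivity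
          calc |m| + |P| * k ^ β ≤ |m| + |P| * 3 ^ b₂ := by gcongr
            _ ≤ (1 + 3 ^ b₂) * N := by linarith [abs_nonneg Λ, abs_nonneg P]
      _ = (6 * C)⁻¹ * N := by field_simp
  have hsum : N ≤ C * ∑ k ∈ Finset.Icc (1 : ℕ) 3, |w k| + N / 2 := by
    calc N ≤ C * ∑ k ∈ Finset.Icc (1 : ℕ) 3, |Λ + 2 * m * Real.log k + P * k ^ β| :=
          hstable β hβ Λ m P
      _ ≤ C * ∑ k ∈ Finset.Icc (1 : ℕ) 3, (|w k| + (6 * C)⁻¹ * N) := by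
          gcongr with k hk
          linarith [herror k hk, abs_sub_abs_le_abs_sub (Λ + 2 * m * Real.log k + P * k ^ β) (w k),
            abs_sub_comm (w k) (Λ + 2 * m * Real.log k + P * k ^ β)]
      _ = C * ∑ k ∈ Finset.Icc (1 : ℕ) 3, |w k| + N / 2 := by
          rw [Finset.sum_add_distrib, Finset.sum_const, Nat.card_Icc, mul_add]
          norm_num
          field_simp
          ring
  linarith

theorem exists_const_mul_rpow_le (c : ℝ) {q δ : ℝ} (hq : 0 < q) (hδ : 0 < δ) :
    ∃ τ > 0, ∀ t ∈ Set.Ioc 0 τ, c * t ^ q ≤ δ := by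
  have hlim : Tendsto (fun t : ℝ => c * t ^ q) (𝓝[>] 0) (𝓝 0) := by
    have hcont : ContinuousAt (fun t : ℝ => c * t ^ q) 0 :=
      continuousAt_const.mul (Real.continuousAt_rpow_const 0 q (Or.inr hq.le))
    simpa [ContinuousAt, Real.zero_rpow hq.ne'] using hcont.mono_left nhdsWithin_le_nhds
  obtain ⟨τ, hτ, hsub⟩ := mem_nhdsGT_iff_exists_Ioc_subset.mp (hlim.eventually_le_const hδ)
  exact ⟨τ, hτ, hsub⟩

theorem exists_defect_le {h₁ h₂ l₁ l₂ δ : ℝ} (hh₁ : 0 < h₁) (hh₂ : h₂ < 1) (hl₁ : 0 < l₁)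
    (hδ : 0 < δ) :
    ∃ τ > 0, ∀ t ∈ Set.Ioc 0 τ, ∀ H ∈ Set.Icc h₁ h₂, ∀ lam ∈ Set.Icc l₁ l₂,
      defect H lam t ≤ δ ∧ ∀ H' ∈ Set.Icc h₁ h₂,
        |defect H lam t - defect H' lam t| ≤ δ * |H - H'| := by
  obtain ⟨C, -, hdefect⟩ := exists_defect_bounds (l₂ := l₂) hh₁ hh₂ hl₁
  obtain ⟨τ, hτ, hsmall⟩ := exists_const_mul_rpow_le C (sub_pos.mpr hh₂) hδ
  refine ⟨τ, hτ, fun t ht H hH lam hlam => ?_⟩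
  obtain ⟨-, hle, hlip⟩ := hdefect H hH lam hlam t ht.1
  exact ⟨hle.trans (hsmall t ht), fun H' hH' => (hlip H' hH').trans (by gcongr; exact hsmall t ht)⟩

theorem exists_log_one_sub_defect_expansion {h₁ h₂ l₁ l₂ ε : ℝ} (hh₁ : 0 < h₁) (hh₂ : h₂ < 1)
    (hl₁ : 0 < l₁) (hε : 0 < ε) :
    ∃ τ > 0, ∃ d > 0, ∀ H ∈ Set.Icc h₁ h₂, ∀ H' ∈ Set.Icc h₁ h₂, ∀ lam ∈ Set.Icc l₁ l₂,
      ∀ lam' ∈ Set.Icc l₁ l₂, ∃ p : ℝ, d * |lam - lam'| ≤ |p| ∧ ∀ t ∈ Set.Ioc 0 τ,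
        |Real.log (1 - defect H lam t) - Real.log (1 - defect H' lam' t) - p * t ^ (2 - 2 * H')| ≤
          ε * (|H - H'| + |p| * t ^ (2 - 2 * H')) := by
  obtain ⟨M, hM, hMhalf, hMε⟩ : ∃ M : ℝ, 0 < M ∧ M ≤ 1 / 2 ∧ M ≤ ε / 6 :=
    ⟨min (1 / 2) (ε / 6), by positivity, min_le_left _ _, min_le_right _ _⟩
  obtain ⟨C, -, hbounds⟩ := exists_defect_bounds (l₂ := l₂) hh₁ hh₂ hl₁
  obtain ⟨τ₁, hτ₁, hdefect⟩ := exists_defect_le (l₂ := l₂) hh₁ hh₂ hl₁ hM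
  obtain ⟨d, E, hd, hE, hexpansion⟩ := exists_defect_sub_defect_expansion (l₂ := l₂) hh₁ hh₂ hl₁
  obtain ⟨τ₂, hτ₂, hremainder⟩ :=
    exists_const_mul_rpow_le (E / d) hh₁ (lt_min one_pos (by positivity : 0 < ε / 3))
  refine ⟨min τ₁ τ₂, lt_min hτ₁ hτ₂, d, hd, fun H hH H' hH' lam hlam lam' hlam' => ?_⟩
  obtain ⟨p, hp, hexp⟩ := hexpansion H' hH' lam' hlam' lam hlam
  refine ⟨-p, by rwa [abs_neg], fun t ht => ?_⟩
  have ht₁ : t ∈ Set.Ioc 0 τ₁ := ⟨ht.1, ht.2.trans (min_le_left _ _)⟩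
  have ht₂ : t ∈ Set.Ioc 0 τ₂ := ⟨ht.1, ht.2.trans (min_le_right _ _)⟩
  have hpow : 0 < t ^ (2 - 2 * H') := Real.rpow_pos_of_pos ht.1 _
  have hpt : |p| * t ^ (2 - 2 * H') = |p * t ^ (2 - 2 * H')| := by rw [abs_mul, abs_of_pos hpow]
  have hmem (h : ℝ) (hh : h ∈ Set.Icc h₁ h₂) (l : ℝ) (hl : l ∈ Set.Icc l₁ l₂) :
      defect h l t ∈ Set.Icc 0 M :=
    ⟨(hbounds h hh l hl t ht.1).1, (hdefect t ht₁ h hh l hl).1⟩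
  have hfirst : |defect H' lam t - defect H' lam' t - p * t ^ (2 - 2 * H')| ≤
      min 1 (ε / 3) * |p * t ^ (2 - 2 * H')| := by
    calc _ ≤ E * t ^ h₁ * t ^ (2 - 2 * H') * |lam - lam'| := hexp t ht.1
      _ ≤ E * t ^ h₁ * t ^ (2 - 2 * H') * (|p| / d) := by
          have : 0 < t := ht.1
          gcongr
          rwa [le_div_iff₀' hd]
      _ = E / d * t ^ h₁ * |p * t ^ (2 - 2 * H')| := by rw [← hpt]; ring
      _ ≤ min 1 (ε / 3) * |p * t ^ (2 - 2 * H')| := by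
          gcongr
          exact hremainder t ht₂
  rw [neg_mul, sub_neg_eq_add, abs_neg, hpt]
  calc _ ≤ 2 * M * |H - H'| + (4 * M + min 1 (ε / 3)) * |p * t ^ (2 - 2 * H')| :=
        abs_log_one_sub_sub_log_one_sub_add_le (hmem H hH lam hlam) (hmem H' hH' lam hlam)
          (hmem H' hH' lam' hlam') hMhalf ((hdefect t ht₁ H hH lam hlam).2 H' hH') hfirst
          (min_le_left _ _)
    _ ≤ ε * |H - H'| + ε * |p * t ^ (2 - 2 * H')| := by
        gcongr
        · linarith
        · linarith [min_le_right 1 (ε / 3)]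
    _ = ε * (|H - H'| + |p * t ^ (2 - 2 * H')|) := by ring

theorem log_semivariogram {θ : Param} (hH0 : 0 < θ 0) (hH1 : θ 0 < 1) (hl : 0 < θ 1)
    (hσ : θ 2 ≠ 0) {t : ℝ} (ht : 0 < t) (hdefect : defect (θ 0) (θ 1) t < 1) :
    Real.log (semivariogram θ t) =
      Real.log (θ 2 ^ 2 / 2) + 2 * θ 0 * Real.log t + Real.log (1 - defect (θ 0) (θ 1) t) := by
  rw [semivariogram_eq hH0 hH1 hl ht, Real.log_mul (by positivity) (sub_pos.mpr hdefect).ne',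
    Real.log_mul (by positivity) (Real.rpow_pos_of_pos ht _).ne', Real.log_rpow ht]

theorem ne_zero_of_mem_Icc {σ₁ σ₂ σ : ℝ} (hσ : 0 < σ₁ ∨ σ₂ < 0) (hmem : σ ∈ Set.Icc σ₁ σ₂) :
    σ ≠ 0 :=
  hσ.elim (fun h => (h.trans_le hmem.1).ne') fun h => (hmem.2.trans_lt h).ne

theorem exists_log_semivariogram_expansion {lo hi : Param} (hH₁ : 0 < lo 0) (hH₂ : hi 0 < 1)
    (hlam : 0 < lo 1) (hσ : 0 < lo 2 ∨ hi 2 < 0) {ε : ℝ} (hε : 0 < ε) :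
    ∃ τ > 0, ∃ d > 0, ∀ θ ∈ rectangle lo hi, ∀ θ' ∈ rectangle lo hi, ∃ p : ℝ,
      d * |θ 1 - θ' 1| ≤ |p| ∧ ∀ t ∈ Set.Ioc 0 τ,
        |Real.log (semivariogram θ t) - Real.log (semivariogram θ' t) -
          (Real.log (θ 2 ^ 2 / 2) - Real.log (θ' 2 ^ 2 / 2) + 2 * (θ 0 - θ' 0) * Real.log t +
            p * t ^ (2 - 2 * θ' 0))| ≤ ε * (|θ 0 - θ' 0| + |p| * t ^ (2 - 2 * θ' 0)) := by
  obtain ⟨τ₁, hτ₁, d, hd, hexpansion⟩ :=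
    exists_log_one_sub_defect_expansion (l₂ := hi 1) hH₁ hH₂ hlam hε
  obtain ⟨τ₂, hτ₂, hdefect⟩ := exists_defect_le (l₂ := hi 1) hH₁ hH₂ hlam one_half_pos
  refine ⟨min τ₁ τ₂, lt_min hτ₁ hτ₂, d, hd, fun θ hθ θ' hθ' => ?_⟩
  obtain ⟨p, hp, hexp⟩ := hexpansion _ (hθ 0) _ (hθ' 0) _ (hθ 1) _ (hθ' 1)
  refine ⟨p, hp, fun t ht => ?_⟩
  have hlog (ϑ : Param) (hϑ : ϑ ∈ rectangle lo hi) :=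
    log_semivariogram (hH₁.trans_le (hϑ 0).1) ((hϑ 0).2.trans_lt hH₂) (hlam.trans_le (hϑ 1).1)
      (ne_zero_of_mem_Icc hσ (hϑ 2)) ht.1
      ((hdefect t ⟨ht.1, ht.2.trans (min_le_right _ _)⟩ _ (hϑ 0) _ (hϑ 1)).1.trans_lt
        one_half_lt_one)
  rw [hlog θ hθ, hlog θ' hθ']
  refine (congrArg abs ?_).trans_le (hexp t ⟨ht.1, ht.2.trans (min_le_left _ _)⟩)
  ring

theorem exists_abs_sub_le_mul_abs_log_sq {σ₁ σ₂ : ℝ} (hσ : 0 < σ₁ ∨ σ₂ < 0) :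
    ∃ K ≥ 0, ∀ σ ∈ Set.Icc σ₁ σ₂, ∀ σ' ∈ Set.Icc σ₁ σ₂,
      |σ - σ'| ≤ K * |Real.log (σ ^ 2 / 2) - Real.log (σ' ^ 2 / 2)| := by
  refine ⟨max |σ₁| |σ₂| / 2, by positivity, fun σ hmem σ' hmem' => ?_⟩
  have h0 := ne_zero_of_mem_Icc hσ hmem
  have h0' := ne_zero_of_mem_Icc hσ hmem'
  have habs : |σ - σ'| = |(|σ| - |σ'|)| := by
    rcases hσ with h | h
    · rw [abs_of_pos (h.trans_le hmem.1), abs_of_pos (h.trans_le hmem'.1)]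
    · rw [abs_of_neg (hmem.2.trans_lt h), abs_of_neg (hmem'.2.trans_lt h), abs_sub_comm]
      ring_nf
  have hexp := abs_exp_sub_exp_le (u := Real.log |σ|) (v := Real.log |σ'|)
    (M := max |σ₁| |σ₂|)
    (by rw [Real.exp_log (abs_pos.mpr h0)]; exact abs_le_max_abs_abs hmem.1 hmem.2)
    (by rw [Real.exp_log (abs_pos.mpr h0')]; exact abs_le_max_abs_abs hmem'.1 hmem'.2)
  rw [Real.exp_log (abs_pos.mpr h0), Real.exp_log (abs_pos.mpr h0'), ← habs, Real.log_abs,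
    Real.log_abs] at hexp
  refine hexp.trans_eq ?_
  rw [Real.log_div (by positivity) two_ne_zero, Real.log_div (by positivity) two_ne_zero,
    Real.log_pow, Real.log_pow, sub_sub_sub_cancel_right, ← mul_sub, abs_mul]
  norm_num
  ring

theorem exists_mul_sq_le_semivariogram {lo hi : Param} (hH₁ : 0 < lo 0) (hH₂ : hi 0 < 1)
    (hlam : 0 < lo 1) (hσ : 0 < lo 2 ∨ hi 2 < 0) :
    ∃ c > 0, ∃ τ > 0, ∀ θ ∈ rectangle lo hi, ∀ t ∈ Set.Ioc 0 τ, c * t ^ 2 ≤ semivariogram θ t := by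
  obtain ⟨τ, hτ, hdefect⟩ := exists_defect_le (l₂ := hi 1) hH₁ hH₂ hlam one_half_pos
  obtain ⟨m, hm, hmσ⟩ : ∃ m > 0, ∀ σ ∈ Set.Icc (lo 2) (hi 2), m ≤ |σ| := by
    rcases hσ with h | h
    · exact ⟨lo 2, h, fun σ hmem => hmem.1.trans (le_abs_self σ)⟩
    · exact ⟨-hi 2, neg_pos.mpr h, fun σ hmem => (neg_le_neg hmem.2).trans (neg_le_abs σ)⟩
  refine ⟨m ^ 2 / 2 * (1 / 2), by positivity, min τ 1, lt_min hτ one_pos, fun θ hθ t ht => ?_⟩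
  have hpow : t ^ 2 ≤ t ^ (2 * θ 0) := by
    rw [← Real.rpow_two]
    exact Real.rpow_le_rpow_of_exponent_ge ht.1 (ht.2.trans (min_le_right _ _))
      (by linarith [(hθ 0).2])
  have hhalf := (hdefect t ⟨ht.1, ht.2.trans (min_le_left _ _)⟩ _ (hθ 0) _ (hθ 1)).1
  rw [semivariogram_eq (hH₁.trans_le (hθ 0).1) ((hθ 0).2.trans_lt hH₂) (hlam.trans_le (hθ 1).1)
    ht.1]
  calc m ^ 2 / 2 * (1 / 2) * t ^ 2 = m ^ 2 / 2 * t ^ 2 * (1 / 2) := by ring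
    _ ≤ θ 2 ^ 2 / 2 * t ^ (2 * θ 0) * (1 - defect (θ 0) (θ 1) t) := by
        have : 0 ≤ t ^ (2 * θ 0) := Real.rpow_nonneg ht.1.le _
        rw [← sq_abs (θ 2)]
        gcongr
        · exact hmσ _ (hθ 2)
        · linarith

theorem exists_log_semivariogram_stability {lo hi : Param} (hH₁ : 0 < lo 0) (hH₂ : hi 0 < 1)
    (hlam : 0 < lo 1) (hσ : 0 < lo 2 ∨ hi 2 < 0) :
    ∃ τ > 0, ∃ C ≥ 0, ∃ d > 0, ∀ α > 0, 3 * α ≤ τ →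
      ∀ θ ∈ rectangle lo hi, ∀ θ' ∈ rectangle lo hi,
        |Real.log (θ 2 ^ 2 / 2) - Real.log (θ' 2 ^ 2 / 2) + 2 * (θ 0 - θ' 0) * Real.log α| +
            |θ 0 - θ' 0| + d * α ^ 2 * |θ 1 - θ' 1| ≤
          C * ∑ k ∈ Finset.Icc (1 : ℕ) 3,
            |Real.log (semivariogram θ (α * k)) - Real.log (semivariogram θ' (α * k))| := by
  obtain ⟨C, hC, ε, hε, hstable⟩ := exists_abs_add_le_sum_abs_of_perturbation
    (b₁ := 2 - 2 * hi 0) (b₂ := 2 - 2 * lo 0) (by linarith)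
  obtain ⟨τ, hτ, d, hd, hexpansion⟩ := exists_log_semivariogram_expansion hH₁ hH₂ hlam hσ hε
  refine ⟨min τ 1, lt_min hτ one_pos, C, hC.le, d, hd, fun α hα hατ θ hθ θ' hθ' => ?_⟩
  obtain ⟨p, hp, hexp⟩ := hexpansion θ hθ θ' hθ'
  set β := 2 - 2 * θ' 0
  set Λ := Real.log (θ 2 ^ 2 / 2) - Real.log (θ' 2 ^ 2 / 2) + 2 * (θ 0 - θ' 0) * Real.log α with hΛ
  have hαβ : 0 < α ^ β := Real.rpow_pos_of_pos hα β
  have hperturb (k : ℕ) (hk : k ∈ Finset.Icc 1 3) :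
      |Real.log (semivariogram θ (α * k)) - Real.log (semivariogram θ' (α * k)) -
        (Λ + 2 * (θ 0 - θ' 0) * Real.log k + p * α ^ β * k ^ β)| ≤
          ε * (|θ 0 - θ' 0| + |p * α ^ β| * k ^ β) := by
    obtain ⟨hk1, hk3⟩ := Finset.mem_Icc.mp hk
    have hk0 : (0 : ℝ) < k := by exact_mod_cast hk1
    have hk3 : (k : ℝ) ≤ 3 := by exact_mod_cast hk3
    have hlag := hexp (α * k) ⟨by positivity, by nlinarith [min_le_left τ 1]⟩
    rw [Real.log_mul hα.ne' hk0.ne', Real.mul_rpow hα.le hk0.le] at hlag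
    rw [abs_mul, abs_of_pos hαβ, hΛ]
    convert hlag using 2 <;> ring_nf
  have hβ : β ∈ Set.Icc (2 - 2 * hi 0) (2 - 2 * lo 0) :=
    ⟨by linarith [(hθ' 0).2], by linarith [(hθ' 0).1]⟩
  have hpow : α ^ 2 ≤ α ^ β := by
    rw [← Real.rpow_two]
    exact Real.rpow_le_rpow_of_exponent_ge hα (by linarith [min_le_right τ 1])
      (by linarith [hβ.2])
  calc _ ≤ |Λ| + |θ 0 - θ' 0| + |p * α ^ β| := by
        rw [abs_mul p, abs_of_pos hαβ, mul_right_comm]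
        gcongr
    _ ≤ _ := hstable β hβ Λ (θ 0 - θ' 0) (p * α ^ β) (fun k => _) hperturb

theorem norm_le_sum_abs {ι : Type*} [Fintype ι] (x : EuclideanSpace ℝ ι) : ‖x‖ ≤ ∑ i, |x i| := by
  rw [EuclideanSpace.norm_eq, Real.sqrt_le_iff]
  exact ⟨Finset.sum_nonneg fun i _ => abs_nonneg _,
    Finset.sum_sq_le_sq_sum_of_nonneg fun i _ => abs_nonneg (x i)⟩

theorem exists_norm_sub_le_log_semivariogram {lo hi : Param} (hH₁ : 0 < lo 0) (hH₂ : hi 0 < 1)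
    (hlam : 0 < lo 1) (hσ : 0 < lo 2 ∨ hi 2 < 0) :
    ∃ τ > 0, ∀ α > 0, 3 * α ≤ τ → ∃ C ≥ 0, ∀ θ ∈ rectangle lo hi, ∀ θ' ∈ rectangle lo hi,
      ‖θ - θ'‖ ≤ C * ∑ k ∈ Finset.Icc (1 : ℕ) 3,
        |Real.log (semivariogram θ (α * k)) - Real.log (semivariogram θ' (α * k))| := by
  obtain ⟨τ, hτ, C, hC, d, hd, hstable⟩ := exists_log_semivariogram_stability hH₁ hH₂ hlam hσ
  obtain ⟨K, hK, hsigma⟩ := exists_abs_sub_le_mul_abs_log_sq hσ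
  refine ⟨τ, hτ, fun α hα hατ => ⟨(1 + (d * α ^ 2)⁻¹ + K * (1 + 2 * |Real.log α|)) * C,
    by positivity, fun θ hθ θ' hθ' => ?_⟩⟩
  set W := ∑ k ∈ Finset.Icc (1 : ℕ) 3,
    |Real.log (semivariogram θ (α * k)) - Real.log (semivariogram θ' (α * k))|
  have hW := hstable α hα hατ θ hθ θ' hθ'
  set Λ₀ := Real.log (θ 2 ^ 2 / 2) - Real.log (θ' 2 ^ 2 / 2)
  set Λ := Λ₀ + 2 * (θ 0 - θ' 0) * Real.log α with hΛ
  have hdα : 0 < d * α ^ 2 := by positivity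
  have hΛ_nonneg := abs_nonneg Λ
  have hH_nonneg := abs_nonneg (θ 0 - θ' 0)
  have hlam_nonneg := mul_nonneg hdα.le (abs_nonneg (θ 1 - θ' 1))
  have hlam_le : |θ 1 - θ' 1| ≤ (d * α ^ 2)⁻¹ * (C * W) := by
    rw [inv_mul_eq_div, le_div_iff₀' hdα]
    linarith
  have hσ_le : |θ 2 - θ' 2| ≤ K * ((1 + 2 * |Real.log α|) * (C * W)) := by
    refine (hsigma _ (hθ 2) _ (hθ' 2)).trans ?_
    gcongr
    calc |Λ₀| = |Λ - 2 * (θ 0 - θ' 0) * Real.log α| := by rw [hΛ, add_sub_cancel_right]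
      _ ≤ |Λ| + 2 * |θ 0 - θ' 0| * |Real.log α| := by
          refine (abs_sub _ _).trans_eq ?_
          rw [abs_mul, abs_mul, abs_two]
      _ ≤ C * W + 2 * (C * W) * |Real.log α| := by gcongr <;> linarith
      _ = (1 + 2 * |Real.log α|) * (C * W) := by ring
  calc ‖θ - θ'‖ ≤ |θ 0 - θ' 0| + |θ 1 - θ' 1| + |θ 2 - θ' 2| := by
        simpa [Fin.sum_univ_three] using norm_le_sum_abs (θ - θ')
    _ ≤ C * W + (d * α ^ 2)⁻¹ * (C * W) + K * ((1 + 2 * |Real.log α|) * (C * W)) := by linarith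
    _ = (1 + (d * α ^ 2)⁻¹ + K * (1 + 2 * |Real.log α|)) * C * W := by ring

theorem exists_norm_sub_le_semivariogram {lo hi : Param} (hH₁ : 0 < lo 0) (hH₂ : hi 0 < 1)
    (hlam : 0 < lo 1) (hσ : 0 < lo 2 ∨ hi 2 < 0) :
    ∃ α₀ > 0, ∀ α > 0, α < α₀ → ∃ C ≥ 0, ∀ θ ∈ rectangle lo hi, ∀ θ' ∈ rectangle lo hi,
      ‖θ - θ'‖ ≤ C * ∑ k ∈ Finset.Icc (1 : ℕ) 3,
        |semivariogram θ (α * k) - semivariogram θ' (α * k)| := by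
  obtain ⟨τ₁, hτ₁, hnorm⟩ := exists_norm_sub_le_log_semivariogram hH₁ hH₂ hlam hσ
  obtain ⟨c, hc, τ₂, hτ₂, hlow⟩ := exists_mul_sq_le_semivariogram hH₁ hH₂ hlam hσ
  refine ⟨min τ₁ τ₂ / 3, by positivity, fun α hα hα₀ => ?_⟩
  have hατ : 3 * α ≤ min τ₁ τ₂ := by linarith
  obtain ⟨C, hC, hnorm⟩ := hnorm α hα (hατ.trans (min_le_left _ _))
  refine ⟨C * (c * α ^ 2)⁻¹, by positivity, fun θ hθ θ' hθ' => (hnorm θ hθ θ' hθ').trans ?_⟩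
  rw [mul_assoc, Finset.mul_sum _ _ (c * α ^ 2)⁻¹]
  refine mul_le_mul_of_nonneg_left (Finset.sum_le_sum fun k hk => ?_) hC
  obtain ⟨hk1, hk3⟩ := Finset.mem_Icc.mp hk
  have hk1 : (1 : ℝ) ≤ k := by exact_mod_cast hk1
  have hk3 : (k : ℝ) ≤ 3 := by exact_mod_cast hk3
  have hge (ϑ : Param) (hϑ : ϑ ∈ rectangle lo hi) : c * α ^ 2 ≤ semivariogram ϑ (α * k) := by
    refine le_trans ?_ (hlow ϑ hϑ (α * k) ⟨by positivity, ?_⟩)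
    · gcongr
      exact le_mul_of_one_le_right hα.le hk1
    · nlinarith [min_le_right τ₁ τ₂]
  exact abs_log_sub_log_le (by positivity) (hge θ hθ) (hge θ' hθ')

/-! ### Rates of convergence of the estimator -/

theorem exists_abs_sub_le_mul_norm_mulVec {L : ℕ} {B : Matrix (Fin L) (Fin (L + 1)) ℝ}
    (hrank : B.rank = L) (hrow : ∀ ℓ, ∑ k, B ℓ k = 0) :
    ∃ C ≥ 0, ∀ (x : Fin (L + 1) → ℝ) (k : Fin (L + 1)), |x 0 - x k| ≤ C * ‖B.mulVec x‖ := by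
  let g : (Fin L → ℝ) →ₗ[ℝ] (Fin L → ℝ) := (B.submatrix id Fin.succ).mulVecLin
  have hg (x : Fin (L + 1) → ℝ) : g (fun k => x k.succ - x 0) = B.mulVec x := by
    ext ℓ
    have hsub : ∑ k, B ℓ k * (x k - x 0) = ∑ k, B ℓ k * x k := by
      simp_rw [mul_sub]
      rw [Finset.sum_sub_distrib, ← Finset.sum_mul, hrow, zero_mul, sub_zero]
    rwa [Fin.sum_univ_succ, sub_self, mul_zero, zero_add] at hsub
  have hBsurj : Function.Surjective B.mulVecLin := by
    refine LinearMap.range_eq_top.mp (Submodule.eq_top_of_finrank_eq ?_)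
    rwa [Module.finrank_fin_fun]
  have hginj : Function.Injective g := by
    rw [LinearMap.injective_iff_surjective]
    intro y
    obtain ⟨x, hx⟩ := hBsurj y
    exact ⟨_, (hg x).trans hx⟩
  obtain ⟨K, -, hK⟩ := g.exists_antilipschitzWith (LinearMap.ker_eq_bot.mpr hginj)
  refine ⟨K, K.2, fun x k => ?_⟩
  refine Fin.cases ?_ (fun k => ?_) k
  · simpa using mul_nonneg K.2 (norm_nonneg (B.mulVec x))
  · have hbound := hK.le_mul_dist (fun k => x k.succ - x 0) 0
    rw [map_zero, dist_zero_right, dist_zero_right, hg] at hbound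
    rw [abs_sub_comm]
    exact (norm_le_pi_norm (fun k : Fin L => x k.succ - x 0) k).trans hbound

theorem matrixB_mulVec_rho_sub {L : ℕ} (a : Fin L → Fin (L + 1) → ℝ) (α : ℝ) (θ θ' : Param) :
    (matrixB a).mulVec (fun k => rho θ (α * (k : ℕ)) - rho θ' (α * (k : ℕ))) =
      fun ℓ => theoreticalVariance (a ℓ) α θ - theoreticalVariance (a ℓ) α θ' := by
  ext ℓ
  simp only [Matrix.mulVec, dotProduct, matrixB, Matrix.of_apply, theoreticalVariance,
    ← Finset.sum_sub_distrib, mul_sub]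

theorem exists_norm_sub_le_theoreticalVariance {lo hi : Param} (hH₁ : 0 < lo 0) (hH₂ : hi 0 < 1)
    (hlam : 0 < lo 1) (hσ : 0 < lo 2 ∨ hi 2 < 0) :
    ∃ α₀ > 0, ∀ α > 0, α < α₀ → ∀ L ≥ 3, ∀ a : Fin L → Fin (L + 1) → ℝ,
      (∀ ℓ, ∑ q, a ℓ q = 0) → (matrixB a).rank = L →
      ∃ C ≥ 0, ∀ θ ∈ rectangle lo hi, ∀ θ' ∈ rectangle lo hi, ‖θ - θ'‖ ≤ C *
        ‖fun ℓ => theoreticalVariance (a ℓ) α θ - theoreticalVariance (a ℓ) α θ'‖ := by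
  obtain ⟨α₀, hα₀, hident⟩ := exists_norm_sub_le_semivariogram hH₁ hH₂ hlam hσ
  refine ⟨α₀, hα₀, fun α hα hαlt L hL a ha hB => ?_⟩
  obtain ⟨C, hC, hnorm⟩ := hident α hα hαlt
  obtain ⟨C', hC', hlag⟩ := exists_abs_sub_le_mul_norm_mulVec hB
    fun ℓ => sum_filterB_eq_zero (ha ℓ)
  refine ⟨C * (3 * C'), by positivity, fun θ hθ θ' hθ' => (hnorm θ hθ θ' hθ').trans ?_⟩
  rw [mul_assoc, ← matrixB_mulVec_rho_sub]
  refine mul_le_mul_of_nonneg_left ?_ hC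
  set x : Fin (L + 1) → ℝ := fun k => rho θ (α * (k : ℕ)) - rho θ' (α * (k : ℕ)) with hx
  have hsemivariogram (k : ℕ) (hk : k ∈ Finset.Icc 1 3) :
      |semivariogram θ (α * k) - semivariogram θ' (α * k)| ≤ C' * ‖(matrixB a).mulVec x‖ := by
    have hk := (Finset.mem_Icc.mp hk).2
    simpa [hx, semivariogram, sub_sub_sub_comm] using hlag x ⟨k, by lia⟩
  refine (Finset.sum_le_card_nsmul _ _ _ hsemivariogram).trans_eq ?_
  rw [Nat.card_Icc, nsmul_eq_mul, mul_assoc]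
  norm_num

theorem exists_mul_norm_sq_le_of_homogeneous {E : Type*} [NormedAddCommGroup E] [NormedSpace ℝ E]
    [ProperSpace E] {q : E → ℝ} (hcont : Continuous q)
    (hsmul : ∀ (r : ℝ) x, q (r • x) = r ^ 2 * q x) (hpos : ∀ x ≠ 0, 0 < q x) :
    ∃ c > 0, ∃ C ≥ 0, ∀ x, c * ‖x‖ ^ 2 ≤ q x ∧ q x ≤ C * ‖x‖ ^ 2 := by
  have hzero : q 0 = 0 := by simpa using hsmul 0 0
  rcases subsingleton_or_nontrivial E with hE | hE
  · exact ⟨1, one_pos, 0, le_rfl, fun x => by simp [Subsingleton.elim x 0, hzero]⟩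
  have hcompact : IsCompact (Metric.sphere (0 : E) 1) := isCompact_sphere _ _
  have hne : (Metric.sphere (0 : E) 1).Nonempty := NormedSpace.sphere_nonempty.mpr zero_le_one
  obtain ⟨x, hx, hmin⟩ := hcompact.exists_isMinOn hne hcont.continuousOn
  obtain ⟨y, -, hmax⟩ := hcompact.exists_isMaxOn hne hcont.continuousOn
  have hxpos : 0 < q x := hpos x (Metric.ne_of_mem_sphere hx one_ne_zero)
  refine ⟨q x, hxpos, q y, hxpos.le.trans (hmax hx), fun u => ?_⟩
  rcases eq_or_ne u 0 with rfl | hu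
  · simp [hzero]
  have hnorm : ‖u‖ ≠ 0 := norm_ne_zero_iff.mpr hu
  have hsphere : ‖u‖⁻¹ • u ∈ Metric.sphere (0 : E) 1 := by
    rw [mem_sphere_zero_iff_norm, norm_smul, norm_inv, norm_norm, inv_mul_cancel₀ hnorm]
  have hscale : q u = q (‖u‖⁻¹ • u) * ‖u‖ ^ 2 := by
    rw [hsmul]
    field_simp
  rw [hscale]
  exact ⟨mul_le_mul_of_nonneg_right (hmin hsphere) (sq_nonneg _),
    mul_le_mul_of_nonneg_right (hmax hsphere) (sq_nonneg _)⟩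

theorem exists_norm_le_of_posDef {ι : Type*} [Fintype ι] {A : Matrix ι ι ℝ} (hA : A.PosDef) :
    ∃ C, ∀ u v : ι → ℝ, u ⬝ᵥ A.mulVec u ≤ v ⬝ᵥ A.mulVec v → ‖u‖ ≤ C * ‖v‖ := by
  obtain ⟨c, hc, C, hC, hquad⟩ := exists_mul_norm_sq_le_of_homogeneous
    (q := fun u : ι → ℝ => u ⬝ᵥ A.mulVec u) (by fun_prop)
    (fun r u => by
      simp only [Matrix.mulVec_smul, smul_dotProduct, dotProduct_smul, smul_eq_mul]
      ring)
    fun u hu => by simpa using hA.dotProduct_mulVec_pos hu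
  refine ⟨√(C / c), fun u v huv => ?_⟩
  refine le_of_sq_le_sq ?_ (by positivity)
  rw [mul_pow, Real.sq_sqrt (by positivity), div_mul_eq_mul_div, le_div_iff₀' hc]
  exact (hquad u).1.trans (huv.trans (hquad v).2)

section GMM

variable {Ω : Type*} {L : ℕ} {X : ℝ → Ω → ℝ} {a : Fin L → Fin (L + 1) → ℝ} {α : ℝ} {N : ℕ}

theorem gHat_eq_sum_range (hN : L ≤ N) (θ : Param) (ω : Ω) (ℓ : Fin L) :
    gHat X a α N θ ω ℓ = ((N + 1 - L : ℕ) : ℝ)⁻¹ * ∑ i ∈ Finset.range (N + 1 - L),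
      (filtered X (a ℓ) α (α * (i + L : ℕ)) ω ^ 2 - theoreticalVariance (a ℓ) α θ) := by
  rw [gHat, ← Finset.Ico_add_one_right_eq_Icc, Finset.sum_Ico_eq_sum_range,
    Nat.cast_sub (by lia), Nat.cast_add_one, sub_add_eq_add_sub]
  simp only [add_comm L]

theorem gHat_sub_gHat (hN : L ≤ N) (θ θ' : Param) (ω : Ω) :
    gHat X a α N θ' ω - gHat X a α N θ ω =
      fun ℓ => theoreticalVariance (a ℓ) α θ - theoreticalVariance (a ℓ) α θ' := by
  ext ℓ
  have hcard : ((N + 1 - L : ℕ) : ℝ) ≠ 0 := by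
    have : N + 1 - L ≠ 0 := by lia
    exact_mod_cast this
  rw [Pi.sub_apply, gHat_eq_sum_range hN, gHat_eq_sum_range hN, ← mul_sub,
    ← Finset.sum_sub_distrib]
  simp only [sub_sub_sub_cancel_left]
  rw [Finset.sum_const, Finset.card_range, nsmul_eq_mul, inv_mul_cancel_left₀ hcard]

theorem IsGMMEstimator.exists_norm_sub_le [MeasurableSpace Ω] {μ : Measure Ω}
    {A : Matrix (Fin L) (Fin L) ℝ} (hA : A.PosDef) {Θ : Set Param} {C : ℝ} (hC : 0 ≤ C)
    (hident : ∀ θ ∈ Θ, ∀ θ' ∈ Θ, ‖θ - θ'‖ ≤ C *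
      ‖fun ℓ => theoreticalVariance (a ℓ) α θ - theoreticalVariance (a ℓ) α θ'‖)
    {θ : Param} (hθ : θ ∈ Θ) {θhat : ℕ → Ω → Param} (hhat : IsGMMEstimator μ X a α A Θ θhat) :
    ∃ K, ∀ N ≥ L, ∀ᵐ ω ∂μ, ‖θhat N ω - θ‖ ≤ K * ‖gHat X a α N θ ω‖ := by
  obtain ⟨C', hle⟩ := exists_norm_le_of_posDef hA
  refine ⟨C * (C' + 1), fun N hN => ?_⟩
  filter_upwards [(hhat N hN).2] with ω ⟨hmem, hmin⟩
  calc ‖θhat N ω - θ‖ = ‖θ - θhat N ω‖ := norm_sub_rev _ _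
    _ ≤ C * ‖gHat X a α N (θhat N ω) ω - gHat X a α N θ ω‖ := by
        rw [gHat_sub_gHat hN]
        exact hident θ hθ _ hmem
    _ ≤ C * (‖gHat X a α N (θhat N ω) ω‖ + ‖gHat X a α N θ ω‖) := by
        gcongr
        exact norm_sub_le _ _
    _ ≤ C * (C' * ‖gHat X a α N θ ω‖ + ‖gHat X a α N θ ω‖) := by
        gcongr
        exact hle _ _ (hmin θ hθ)
    _ = C * (C' + 1) * ‖gHat X a α N θ ω‖ := by ring

end GMM

theorem pi_norm_le_sum_abs {ι : Type*} [Fintype ι] (g : ι → ℝ) : ‖g‖ ≤ ∑ i, |g i| :=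
  (pi_norm_le_iff_of_nonneg (Finset.sum_nonneg fun _ _ => abs_nonneg _)).mpr fun i =>
    Finset.single_le_sum (f := fun i => |g i|) (fun _ _ => abs_nonneg _) (Finset.mem_univ i)

theorem pi_norm_sq_le_sum_sq {ι : Type*} [Fintype ι] (g : ι → ℝ) : ‖g‖ ^ 2 ≤ ∑ i, g i ^ 2 := by
  have hnonneg : 0 ≤ ∑ i, g i ^ 2 := Finset.sum_nonneg fun _ _ => sq_nonneg _
  refine (Real.le_sqrt (norm_nonneg _) hnonneg).mp ?_
  refine (pi_norm_le_iff_of_nonneg (Real.sqrt_nonneg _)).mpr fun i => Real.abs_le_sqrt ?_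
  exact Finset.single_le_sum (f := fun i => g i ^ 2) (fun _ _ => sq_nonneg _) (Finset.mem_univ i)

theorem le_mul_add_one_sub {L N : ℕ} (hL : 0 < L) (hN : L ≤ N) : N ≤ L * (N + 1 - L) := by
  obtain ⟨j, rfl⟩ := Nat.exists_eq_add_of_le hN
  rw [add_assoc, Nat.add_sub_cancel_left]
  nlinarith

theorem rpow_le_rpow_abs_mul_rpow {x y c : ℝ} (hc : 1 ≤ c) (hy : 0 < y) (hyx : y ≤ x)
    (hxy : x ≤ c * y) (γ : ℝ) : x ^ γ ≤ c ^ |γ| * y ^ γ := by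
  rcases le_total 0 γ with hγ | hγ
  · rw [abs_of_nonneg hγ, ← Real.mul_rpow (by positivity) hy.le]
    exact Real.rpow_le_rpow (hy.le.trans hyx) hxy hγ
  · calc x ^ γ ≤ y ^ γ := Real.rpow_le_rpow_of_nonpos hy hyx hγ
      _ ≤ c ^ |γ| * y ^ γ :=
          le_mul_of_one_le_left (by positivity) (Real.one_le_rpow hc (abs_nonneg γ))

theorem integrable_norm_sq_and_integral_le {Ω E ι : Type*} [MeasurableSpace Ω] {μ : Measure Ω}
    [NormedAddCommGroup E] [Fintype ι] {Y : Ω → E} {g : Ω → ι → ℝ} {K : ℝ}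
    (hY : AEStronglyMeasurable Y μ) (hg : Integrable (fun ω => ∑ i, g ω i ^ 2) μ)
    (hle : ∀ᵐ ω ∂μ, ‖Y ω‖ ≤ K * ‖g ω‖) :
    Integrable (fun ω => ‖Y ω‖ ^ 2) μ ∧ ∫ ω, ‖Y ω‖ ^ 2 ∂μ ≤ K ^ 2 * ∫ ω, ∑ i, g ω i ^ 2 ∂μ := by
  have hsq : ∀ᵐ ω ∂μ, ‖Y ω‖ ^ 2 ≤ K ^ 2 * ∑ i, g ω i ^ 2 := by
    filter_upwards [hle] with ω hω
    calc ‖Y ω‖ ^ 2 ≤ (K * ‖g ω‖) ^ 2 := by gcongr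
      _ ≤ K ^ 2 * ∑ i, g ω i ^ 2 := by
          rw [mul_pow]
          gcongr
          exact pi_norm_sq_le_sum_sq _
  have hint : Integrable (fun ω => ‖Y ω‖ ^ 2) μ := by
    refine (hg.const_mul (K ^ 2)).mono' (hY.norm.pow 2) ?_
    filter_upwards [hsq] with ω hω
    rwa [Real.norm_of_nonneg (by positivity)]
  rw [← integral_const_mul]
  exact ⟨hint, integral_mono_ae hint (hg.const_mul _) hsq⟩

theorem rpow_mul_norm_gHat_le {Ω : Type*} {θ : Param} {X : ℝ → Ω → ℝ} {L : ℕ} {α : ℝ}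
    {a : Fin L → Fin (L + 1) → ℝ} (hL : 0 < L) {N : ℕ} (hN : L ≤ N) (γ : ℝ) (ω : Ω) :
    (N : ℝ) ^ γ * ‖gHat X a α N θ ω‖ ≤ (L : ℝ) ^ |γ| * ∑ ℓ, ((N + 1 - L : ℕ) : ℝ) ^ (γ - 1) *
      |∑ i ∈ Finset.range (N + 1 - L),
        (filtered X (a ℓ) α (α * (i + L : ℕ)) ω ^ 2 - theoreticalVariance (a ℓ) α θ)| := by
  have hn : (0 : ℝ) < (N + 1 - L : ℕ) := by
    have : 0 < N + 1 - L := by lia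
    exact_mod_cast this
  have hrpow : (N : ℝ) ^ γ ≤ (L : ℝ) ^ |γ| * ((N + 1 - L : ℕ) : ℝ) ^ γ := by
    have hle : N + 1 - L ≤ N := by lia
    exact rpow_le_rpow_abs_mul_rpow (by exact_mod_cast hL) hn (by exact_mod_cast hle)
      (by exact_mod_cast le_mul_add_one_sub hL hN) γ
  calc (N : ℝ) ^ γ * ‖gHat X a α N θ ω‖
      ≤ ((L : ℝ) ^ |γ| * ((N + 1 - L : ℕ) : ℝ) ^ γ) * ∑ ℓ, |gHat X a α N θ ω ℓ| := by
        gcongr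
        exact pi_norm_le_sum_abs _
    _ = _ := by
        rw [mul_assoc, Finset.mul_sum]
        congr 1
        refine Finset.sum_congr rfl fun ℓ _ => ?_
        rw [gHat_eq_sum_range hN, abs_mul, abs_of_pos (inv_pos.mpr hn), Real.rpow_sub_one hn.ne',
          div_eq_mul_inv, mul_assoc]

section Rates

variable {Ω : Type*} [MeasurableSpace Ω] {μ : Measure Ω} [IsProbabilityMeasure μ] {θ : Param}
  {X : ℝ → Ω → ℝ} {L : ℕ} {α : ℝ}

theorem IsStationaryFOU.integral_shifted_sum_sq_le (hX : IsStationaryFOU μ θ X) (hH0 : 0 < θ 0)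
    (hH1 : θ 0 < 1) (hl : 0 < θ 1) {a : Fin (L + 1) → ℝ} (ha : ∑ q, a q = 0) (hα : 0 < α)
    (m : ℕ) (s : Finset ℕ) :
    Integrable (fun ω => (∑ i ∈ s, (filtered X a α (α * (i + m : ℕ)) ω ^ 2 -
      theoreticalVariance a α θ)) ^ 2) μ ∧
    ∫ ω, (∑ i ∈ s, (filtered X a α (α * (i + m : ℕ)) ω ^ 2 -
      theoreticalVariance a α θ)) ^ 2 ∂μ ≤
        (∑' k : ℤ, 2 * filteredCov θ a α (α * k) ^ 2) * s.card := by
  have hbound := hX.integral_sum_sq_le hH0 hH1 hl ha hα (s.map (addRightEmbedding m))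
  simpa only [Finset.sum_map, Finset.card_map, addRightEmbedding_apply] using hbound

variable {a : Fin L → Fin (L + 1) → ℝ}

theorem IsStationaryFOU.integral_gHat_sq_le (hX : IsStationaryFOU μ θ X) (hH0 : 0 < θ 0)
    (hH1 : θ 0 < 1) (hl : 0 < θ 1) (ha : ∀ ℓ, ∑ q, a ℓ q = 0) (hα : 0 < α) {N : ℕ} (hN : L ≤ N)
    (ℓ : Fin L) :
    Integrable (fun ω => gHat X a α N θ ω ℓ ^ 2) μ ∧ ∫ ω, gHat X a α N θ ω ℓ ^ 2 ∂μ ≤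
      (∑' k : ℤ, 2 * filteredCov θ (a ℓ) α (α * k) ^ 2) * ((N + 1 - L : ℕ) : ℝ)⁻¹ := by
  obtain ⟨hint, hle⟩ :=
    hX.integral_shifted_sum_sq_le hH0 hH1 hl (ha ℓ) hα L (Finset.range (N + 1 - L))
  have hn : ((N + 1 - L : ℕ) : ℝ) ≠ 0 := by
    have : N + 1 - L ≠ 0 := by lia
    exact_mod_cast this
  simp only [gHat_eq_sum_range hN, mul_pow]
  refine ⟨hint.const_mul _, ?_⟩
  rw [integral_const_mul]
  rw [Finset.card_range] at hle
  refine (mul_le_mul_of_nonneg_left hle (by positivity)).trans_eq ?_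
  field_simp

theorem IsStationaryFOU.exists_integral_sum_gHat_sq_le (hX : IsStationaryFOU μ θ X)
    (hH0 : 0 < θ 0) (hH1 : θ 0 < 1) (hl : 0 < θ 1) (ha : ∀ ℓ, ∑ q, a ℓ q = 0) (hα : 0 < α)
    (hL : 0 < L) :
    ∃ C, ∀ N ≥ L, Integrable (fun ω => ∑ ℓ, gHat X a α N θ ω ℓ ^ 2) μ ∧
      ∫ ω, ∑ ℓ, gHat X a α N θ ω ℓ ^ 2 ∂μ ≤ C * (N : ℝ)⁻¹ := by
  set V : Fin L → ℝ := fun ℓ => ∑' k : ℤ, 2 * filteredCov θ (a ℓ) α (α * k) ^ 2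
  have hV (ℓ : Fin L) : 0 ≤ V ℓ := tsum_nonneg fun k => by positivity
  refine ⟨(∑ ℓ, V ℓ) * L, fun N hN => ?_⟩
  have hgHat := hX.integral_gHat_sq_le hH0 hH1 hl ha hα hN
  have hinv : ((N + 1 - L : ℕ) : ℝ)⁻¹ ≤ L * (N : ℝ)⁻¹ := by
    have hn : (0 : ℝ) < (N + 1 - L : ℕ) := by
      have : 0 < N + 1 - L := by lia
      exact_mod_cast this
    have hN0 : (0 : ℝ) < N := by exact_mod_cast hL.trans_le hN
    rw [← div_eq_mul_inv, inv_eq_one_div, div_le_div_iff₀ hn hN0, one_mul]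
    exact_mod_cast le_mul_add_one_sub hL hN
  refine ⟨integrable_finsetSum _ fun ℓ _ => (hgHat ℓ).1, ?_⟩
  calc ∫ ω, ∑ ℓ, gHat X a α N θ ω ℓ ^ 2 ∂μ
      = ∑ ℓ, ∫ ω, gHat X a α N θ ω ℓ ^ 2 ∂μ := integral_finsetSum _ fun ℓ _ => (hgHat ℓ).1
    _ ≤ ∑ ℓ, V ℓ * ((N + 1 - L : ℕ) : ℝ)⁻¹ := Finset.sum_le_sum fun ℓ _ => (hgHat ℓ).2
    _ ≤ ∑ ℓ, V ℓ * (L * (N : ℝ)⁻¹) :=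
        Finset.sum_le_sum fun ℓ _ => mul_le_mul_of_nonneg_left hinv (hV ℓ)
    _ = (∑ ℓ, V ℓ) * L * (N : ℝ)⁻¹ := by rw [← Finset.sum_mul, mul_assoc]

theorem IsStationaryFOU.ae_tendsto_rpow_mul_norm_gHat (hX : IsStationaryFOU μ θ X)
    (hH0 : 0 < θ 0) (hH1 : θ 0 < 1) (hl : 0 < θ 1) (ha : ∀ ℓ, ∑ q, a ℓ q = 0) (hα : 0 < α)
    (hL : 0 < L) {γ : ℝ} (hγ : γ < 1 / 2) :
    ∀ᵐ ω ∂μ, Tendsto (fun N : ℕ => (N : ℝ) ^ γ * ‖gHat X a α N θ ω‖) atTop (𝓝 0) := by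
  have hstrong : ∀ᵐ ω ∂μ, ∀ ℓ, Tendsto (fun n : ℕ => (n : ℝ) ^ (γ - 1) * |∑ i ∈ Finset.range n,
      (filtered X (a ℓ) α (α * (i + L : ℕ)) ω ^ 2 - theoreticalVariance (a ℓ) α θ)|)
      atTop (𝓝 0) := by
    refine ae_all_iff.mpr fun ℓ => ?_
    have hbound := hX.integral_shifted_sum_sq_le hH0 hH1 hl (ha ℓ) hα L
    exact ae_tendsto_rpow_mul_abs_sum_range (fun s => (hbound s).1) (fun s => (hbound s).2) hγ
  filter_upwards [hstrong] with ω hω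
  have hshift : Tendsto (fun N : ℕ => N + 1 - L) atTop atTop :=
    (tendsto_sub_atTop_nat L).comp (tendsto_add_atTop_nat 1)
  have hlim := (tendsto_finsetSum Finset.univ fun ℓ _ => (hω ℓ).comp hshift).const_mul
    ((L : ℝ) ^ |γ|)
  rw [Finset.sum_const_zero, mul_zero] at hlim
  refine squeeze_zero' (Eventually.of_forall fun N => by positivity) ?_ hlim
  filter_upwards [eventually_ge_atTop L] with N hN using rpow_mul_norm_gHat_le hL hN γ ω

end Rates

theorem ae_tendsto_mul_norm_of_le {Ω E F : Type*} [MeasurableSpace Ω] {μ : Measure Ω}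
    [SeminormedAddGroup E] [SeminormedAddGroup F] {Y : ℕ → Ω → E} {Z : ℕ → Ω → F} {c : ℕ → ℝ}
    {K : ℝ} {n₀ : ℕ} (hc : ∀ n, 0 ≤ c n) (hle : ∀ n ≥ n₀, ∀ᵐ ω ∂μ, ‖Y n ω‖ ≤ K * ‖Z n ω‖)
    (hZ : ∀ᵐ ω ∂μ, Tendsto (fun n => c n * ‖Z n ω‖) atTop (𝓝 0)) :
    ∀ᵐ ω ∂μ, Tendsto (fun n => c n * ‖Y n ω‖) atTop (𝓝 0) := by
  have hall : ∀ᵐ ω ∂μ, ∀ n ≥ n₀, ‖Y n ω‖ ≤ K * ‖Z n ω‖ := by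
    simpa only [ae_all_iff] using hle
  filter_upwards [hall, hZ] with ω hω hlim
  have hlimK := hlim.const_mul K
  rw [mul_zero] at hlimK
  refine squeeze_zero' (Eventually.of_forall fun n => mul_nonneg (hc n) (norm_nonneg _)) ?_ hlimK
  filter_upwards [eventually_ge_atTop n₀] with n hn
  exact (mul_le_mul_of_nonneg_left (hω n hn) (hc n)).trans_eq (mul_left_comm _ _ _)

end FOU

open FOU in
theorem proposition3p1_general (lo hi : Param) (hH : 0 < lo 0 ∧ hi 0 < 1) (hlam : 0 < lo 1)
    (hσ : 0 < lo 2 ∨ hi 2 < 0) :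
    ∃ α₀ : ℝ, 0 < α₀ ∧ ∀ α : ℝ, 0 < α → α < α₀ →
      ∀ (L : ℕ) (_ : 3 ≤ L) (a : Fin L → Fin (L + 1) → ℝ) (l : Fin L → ℕ)
        (_ : ∀ ℓ, 1 ≤ l ℓ) (_ : ∀ ℓ, IsFilter (a ℓ) (l ℓ)) (_ : (matrixB a).rank = L)
        (A : Matrix (Fin L) (Fin L) ℝ) (_ : A.PosDef)
        (θ : Param) (_ : θ ∈ rectangle lo hi)
        (Ω : Type*) [MeasurableSpace Ω] (μ : Measure Ω) [IsProbabilityMeasure μ]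
        (X : ℝ → Ω → ℝ) (_ : IsStationaryFOU μ θ X)
        (θhat : ℕ → Ω → Param)
        (_ : IsGMMEstimator μ X a α A (rectangle lo hi) θhat),
        ((∀ N ≥ L, Integrable (fun ω => ‖θhat N ω - θ‖ ^ 2) μ) ∧
          (fun N : ℕ => ∫ ω, ‖θhat N ω - θ‖ ^ 2 ∂μ) =O[atTop] fun N : ℕ => ((N : ℝ))⁻¹) ∧
        ∀ γ : ℝ, γ < 1 / 2 →
          ∀ᵐ ω ∂μ, Tendsto (fun N : ℕ => (N : ℝ) ^ γ * ‖θhat N ω - θ‖) atTop (𝓝 0) := by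
  obtain ⟨α₀, hα₀, hident⟩ := exists_norm_sub_le_theoreticalVariance hH.1 hH.2 hlam hσ
  refine ⟨α₀, hα₀, fun α hα hαlt L hL a l hl hfil hB A hA θ hθ Ω _ μ _ X hX θhat hhat => ?_⟩
  have ha (ℓ : Fin L) : ∑ q, a ℓ q = 0 := (hfil ℓ).sum_eq_zero (hl ℓ)
  have hH0 : 0 < θ 0 := hH.1.trans_le (hθ 0).1
  have hH1 : θ 0 < 1 := (hθ 0).2.trans_lt hH.2
  have hlamθ : 0 < θ 1 := hlam.trans_le (hθ 1).1
  have hL0 : 0 < L := by lia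
  obtain ⟨C, hC, hle⟩ := hident α hα hαlt L hL a ha hB
  obtain ⟨K, herr⟩ := IsGMMEstimator.exists_norm_sub_le hA hC hle hθ hhat
  obtain ⟨D, hgHat⟩ := hX.exists_integral_sum_gHat_sq_le hH0 hH1 hlamθ ha hα hL0
  have hsq (N : ℕ) (hN : N ≥ L) := integrable_norm_sq_and_integral_le
    ((hhat N hN).1.sub_const θ).aestronglyMeasurable (hgHat N hN).1 (herr N hN)
  refine ⟨⟨fun N hN => (hsq N hN).1, Asymptotics.IsBigO.of_bound (K ^ 2 * D) ?_⟩, fun γ hγ => ?_⟩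
  · filter_upwards [eventually_ge_atTop L] with N hN
    rw [Real.norm_of_nonneg (by positivity), Real.norm_of_nonneg (by positivity), mul_assoc]
    exact (hsq N hN).2.trans (mul_le_mul_of_nonneg_left (hgHat N hN).2 (sq_nonneg K))
  · exact ae_tendsto_mul_norm_of_le (fun N => by positivity) herr
      (hX.ae_tendsto_rpow_mul_norm_gHat hH0 hH1 hlamθ ha hα hL0 hγ)

theorem proposition3p1 (lo hi : FOU.Param)
    (hH : 0 < lo 0 ∧ hi 0 < 1)
    (hlam : 0 < lo 1 ∧ hi 1 < Real.exp (FOU.digamma 3))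
    (hσ : 0 < lo 2 ∨ hi 2 < 0) :
    ∃ α₀ : ℝ, 0 < α₀ ∧ ∀ α : ℝ, 0 < α → α < α₀ →
      ∀ (L : ℕ) (_ : 3 ≤ L) (a : Fin L → Fin (L + 1) → ℝ) (l : Fin L → ℕ)
        (_ : ∀ ℓ, 1 ≤ l ℓ) (_ : ∀ ℓ, FOU.IsFilter (a ℓ) (l ℓ)) (_ : (FOU.matrixB a).rank = L)
        (A : Matrix (Fin L) (Fin L) ℝ) (_ : A.PosDef)
        (θ : FOU.Param) (_ : θ ∈ FOU.rectangle lo hi)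
        (Ω : Type*) [MeasurableSpace Ω] (μ : Measure Ω) [IsProbabilityMeasure μ]
        (X : ℝ → Ω → ℝ) (_ : FOU.IsStationaryFOU μ θ X)
        (θhat : ℕ → Ω → FOU.Param)
        (_ : FOU.IsGMMEstimator μ X a α A (FOU.rectangle lo hi) θhat),
        ((∀ N ≥ L, Integrable (fun ω => ‖θhat N ω - θ‖ ^ 2) μ) ∧
          (fun N : ℕ => ∫ ω, ‖θhat N ω - θ‖ ^ 2 ∂μ) =O[atTop] fun N : ℕ => ((N : ℝ))⁻¹) ∧
        ∀ γ : ℝ, γ < 1 / 2 →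
          ∀ᵐ ω ∂μ, Tendsto (fun N : ℕ => (N : ℝ) ^ γ * ‖θhat N ω - θ‖) atTop (𝓝 0) :=
  proposition3p1_general lo hi hH hlam.1 hσ
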